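/- Conventions. Exact categories are in the sense of Quillen, and a functor is exact if it sends exact sequences to exact sequences; $\mathcal{C}^{op}$ carries the opposite exact structure. An equivalence of exact categories is an equivalence of categories such that it and its quasi-inverse are exact. Let $\kappa$ be an infinite cardinal, or $\kappa=\infty$ (no bound). For an exact category $\mathcal{C}$, let $\mathsf{Lex}(\mathcal{C})$ be the abelian category of left exact presheaves of abelian groups on $\mathcal{C}$ (the sheaves for the topology generated by the admissible epics), and let $\mathsf{Ind}^a_\kappa(\mathcal{C})\subset\mathsf{Lex}(\mathcal{C})$ be the full subcategory of the presheaves isomorphic to $U\mapsto\operatorname{colim}_{i\in I}\operatorname{Hom}_{\mathcal{C}}(U,X_i)$ for a diagram $X\colon I\to\mathcal{C}$ that is indexed by a directed poset $I$ of cardinality at most $\kappa$ and has admissible monics as transition maps; a sequence in it is exact if it is short exact in $\mathsf{Lex}(\mathcal{C})$. Put $\mathsf{Pro}^a_\kappa(\mathcal{C})=\mathsf{Ind}^a_\kappa(\mathcal{C}^{op})^{op}$. Let $\mathcal{FM}_\kappa(\mathcal{C})$ and $\mathcal{FM}^\vee_\kappa(\mathcal{C})$ be the idempotent completions of $\mathsf{Ind}^a_\kappa(\mathcal{C})$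 and $\mathsf{Pro}^a_\kappa(\mathcal{C})$; their exact sequences are the direct summands of exact sequences of $\mathsf{Ind}^a_\kappa(\mathcal{C})$, respectively $\mathsf{Pro}^a_\kappa(\mathcal{C})$. Proposition. (1) Let $\mathcal{C}$ and $\mathcal{D}$ be exact categories and $F\colon\mathcal{C}^{op}\to\mathcal{D}$ an exact functor. Then $F$ extends canonically to an exact functor $\widetilde F\colon\mathcal{FM}_\kappa(\mathcal{C})^{op}\to\mathcal{FM}^\vee_\kappa(\mathcal{D})$: there are a functor $\widetilde F$ and an isomorphism $\widetilde F|_{\mathcal{C}^{op}}\cong F$ (as functors to $\mathcal{FM}^\vee_\kappa(\mathcal{D})$) that exhibits $\widetilde F$ as the pointwise right Kan extension of $\mathcal{C}^{op}\xrightarrow{F}\mathcal{D}\to\mathcal{FM}^\vee_\kappa(\mathcal{D})$ along $\mathcal{C}^{op}\to\mathcal{FM}_\kappa(\mathcal{C})^{op}$, so that $\widetilde F$ is determined up to unique isomorphism, and $\widetilde F$ is exact. If $F$ is faithful, or fully faithful, or an equivalence of exact categories, then the same is true of $\widetilde F$. (2) Let $R$ be a ring, $P_f(R)$ and $P_f(R^\circ)$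 the categories of finitely generated projective left, respectively right, $R$-modules with the split exact structure, and $\mathcal{FM}_\kappa(R^\circ)$ the category of flat Mittag-Leffler right $R$-modules that are generated by at most $\kappa$ elements, with the short exact sequences of modules as its exact sequences. Here a module is flat Mittag-Leffler if it is the colimit of a diagram $(M_i)$ of finitely generated projective modules over a directed poset such that for each $i$ there is $j\ge i$ with $\operatorname{Im}(M_k^\vee\to M_i^\vee)=\operatorname{Im}(M_j^\vee\to M_i^\vee)$ for all $k\ge j$, where $(-)^\vee$ is the dual module. Then the functor $\operatorname{Hom}_{R^\circ}(-,R)\colon P_f(R^\circ)^{op}\to P_f(R)$ extends canonically (as a pointwise right Kan extension, as in (1)) to an equivalence $\mathcal{FM}_\kappa(R^\circ)^{op}\to\mathcal{FM}^\vee_\kappa(P_f(R))$ that is exact together with its quasi-inverse, and the quasi-inverse is the functor $\operatorname{Hom}_{\mathcal{FM}^\vee_\kappa(P_f(R))}(-,R)$, with the right $R$-module structure given by right multiplication on $R$. For $\kappa=\infty$ these are exact duality equivalences between $\mathcal{FM}(R^\circ)^{op}$ and $\mathcal{FM}^\vee(P_f(R))$. -/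

import Mathlib

open CategoryTheory CategoryTheory.Limits Opposite

universe v u u₁ u₂ w

noncomputable section

open scoped ZeroObject

namespace AdmInd

/-! ### Classes of sequences and exact functors -/

/-- A class of composable pairs `X ⟶ Y ⟶ Z` in a category. -/
abbrev SeqClass (A : Type u) [Category.{v} A] : Type (max u v) :=
  ∀ ⦃X Y Z : A⦄, (X ⟶ Y) → (Y ⟶ Z) → Prop

/-- The same sequences, read in the opposite category. -/
def SeqClass.op {A : Type u} [Category.{v} A] (S : SeqClass A) : SeqClass Aᵒᵖ :=
  fun _ _ _ f g => S g.unop f.unop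

/-- A functor is exact if it sends exact sequences to exact sequences. -/
def IsExactFunctor {A : Type u₁} [Category A] {B : Type u₂} [Category B]
    (S : SeqClass A) (T : SeqClass B) (F : A ⥤ B) : Prop :=
  ∀ ⦃X Y Z : A⦄ (f : X ⟶ Y) (g : Y ⟶ Z), S f g → T (F.map f) (F.map g)

/-- An equivalence of exact categories: an equivalence of categories under which the exact
sequences correspond to each other (so that the functor and its quasi-inverse are exact). -/
def IsExactEquivalence {A : Type u₁} [Category A] {B : Type u₂} [Category B]
    (S : SeqClass A) (T : SeqClass B) (F : A ⥤ B) : Prop :=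
  F.IsEquivalence ∧ ∀ ⦃X Y Z : A⦄ (f : X ⟶ Y) (g : Y ⟶ Z), S f g ↔ T (F.map f) (F.map g)

/-- `f` is a kernel of `g`, and `g` is a cokernel of `f`. -/
def IsKernelCokernelPair {A : Type u} [Category.{v} A] [Preadditive A] {X Y Z : A}
    (f : X ⟶ Y) (g : Y ⟶ Z) : Prop :=
  ∃ w : f ≫ g = 0, Nonempty (IsLimit (KernelFork.ofι f w)) ∧
    Nonempty (IsColimit (CokernelCofork.ofπ g w))

/-- Admissible monics: the first maps of the sequences of the class. -/
def SeqClass.AdmMono {A : Type u} [Category.{v} A] (S : SeqClass A) {X Y : A} (f : X ⟶ Y) : Prop :=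
  ∃ (Z : A) (g : Y ⟶ Z), S f g

/-- Admissible epics: the second maps of the sequences of the class. -/
def SeqClass.AdmEpi {A : Type u} [Category.{v} A] (S : SeqClass A) {Y Z : A} (g : Y ⟶ Z) : Prop :=
  ∃ (X : A) (f : X ⟶ Y), S f g

/-! ### Exact categories -/

/-- An exact structure (in the sense of Quillen) on an additive category. -/
structure ExactStructure (C : Type u) [Category.{v} C] [Preadditive C] where
  /-- the class of exact sequences -/
  conf : SeqClass C
  isKernelCokernelPair : ∀ {X Y Z : C} (f : X ⟶ Y) (g : Y ⟶ Z), conf f g →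
    IsKernelCokernelPair f g
  of_iso : ∀ {X Y Z X' Y' Z' : C} (f : X ⟶ Y) (g : Y ⟶ Z) (f' : X' ⟶ Y') (g' : Y' ⟶ Z')
    (a : X ≅ X') (b : Y ≅ Y') (c : Z ≅ Z'), f ≫ b.hom = a.hom ≫ f' → g ≫ c.hom = b.hom ≫ g' →
    conf f g → conf f' g'
  id_admMono : ∀ X : C, conf.AdmMono (𝟙 X)
  id_admEpi : ∀ X : C, conf.AdmEpi (𝟙 X)
  comp_admMono : ∀ {X Y Z : C} (f : X ⟶ Y) (g : Y ⟶ Z), conf.AdmMono f → conf.AdmMono g →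
    conf.AdmMono (f ≫ g)
  comp_admEpi : ∀ {X Y Z : C} (f : X ⟶ Y) (g : Y ⟶ Z), conf.AdmEpi f → conf.AdmEpi g →
    conf.AdmEpi (f ≫ g)
  pushout : ∀ {X Y X' : C} (f : X ⟶ Y) (a : X ⟶ X'), conf.AdmMono f →
    ∃ (Y' : C) (a' : Y ⟶ Y') (f' : X' ⟶ Y'), IsPushout f a a' f' ∧ conf.AdmMono f'
  pullback : ∀ {Y Z Z' : C} (g : Y ⟶ Z) (a : Z' ⟶ Z), conf.AdmEpi g →
    ∃ (Y' : C) (a' : Y' ⟶ Y) (g' : Y' ⟶ Z'), IsPullback a' g' g a ∧ conf.AdmEpi g'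

namespace ExactStructure

/-- The opposite exact structure. -/
def op {C : Type u} [Category.{v} C] [Preadditive C] (E : ExactStructure C) : ExactStructure Cᵒᵖ where
  conf := E.conf.op
  isKernelCokernelPair := by
    rintro X Y Z f g h
    obtain ⟨w, ⟨h₁⟩, ⟨h₂⟩⟩ := E.isKernelCokernelPair _ _ h
    refine ⟨Quiver.Hom.unop_inj w, ⟨?_⟩, ⟨?_⟩⟩
    · exact CokernelCofork.IsColimit.ofπOp _ _ h₂
    · exact KernelFork.IsLimit.ofιOp _ _ h₁
  of_iso := by
    intro X Y Z X' Y' Z' f g f' g' a b c h₁ h₂ h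
    refine E.of_iso g.unop f.unop g'.unop f'.unop c.unop.symm b.unop.symm a.unop.symm ?_ ?_ h
    · apply Quiver.Hom.op_inj
      change b.inv ≫ g = g' ≫ c.inv
      rw [Iso.inv_comp_eq, ← Category.assoc, Iso.eq_comp_inv, h₂]
    · apply Quiver.Hom.op_inj
      change a.inv ≫ f = f' ≫ b.inv
      rw [Iso.inv_comp_eq, ← Category.assoc, Iso.eq_comp_inv, h₁]
  id_admMono X := by
    obtain ⟨Z, f, h⟩ := E.id_admEpi X.unop
    exact ⟨_, f.op, h⟩
  id_admEpi X := by
    obtain ⟨Z, f, h⟩ := E.id_admMono X.unop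
    exact ⟨_, f.op, h⟩
  comp_admMono := by
    rintro X Y Z f g ⟨_, a, ha⟩ ⟨_, b, hb⟩
    obtain ⟨W, c, hc⟩ := E.comp_admEpi g.unop f.unop ⟨_, b.unop, hb⟩ ⟨_, a.unop, ha⟩
    exact ⟨_, c.op, hc⟩
  comp_admEpi := by
    rintro X Y Z f g ⟨_, a, ha⟩ ⟨_, b, hb⟩
    obtain ⟨W, c, hc⟩ := E.comp_admMono g.unop f.unop ⟨_, b.unop, hb⟩ ⟨_, a.unop, ha⟩
    exact ⟨_, c.op, hc⟩
  pushout := by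
    rintro X Y X' f a ⟨_, b, hb⟩
    obtain ⟨Y', a', f', h, _, c, hc⟩ := E.pullback f.unop a.unop ⟨_, b.unop, hb⟩
    exact ⟨_, a'.op, f'.op, h.op.flip, _, c.op, hc⟩
  pullback := by
    rintro Y Z Z' g a ⟨_, b, hb⟩
    obtain ⟨Y', a', f', h, _, c, hc⟩ := E.pushout g.unop a.unop ⟨_, b.unop, hb⟩
    exact ⟨_, a'.op, f'.op, h.op.flip, _, c.op, hc⟩

/-- The split exact structure on an additive category: the exact sequences are the sequences
`X ⟶ Y ⟶ Z` that are split, i.e. identify `Y` with `X ⊕ Z`. -/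
def split (C : Type u) [Category.{v} C] [Preadditive C] [HasZeroObject C]
    [HasBinaryBiproducts C] :
    ExactStructure C where
  conf X Y Z f g := f ≫ g = 0 ∧ ∃ (r : Y ⟶ X) (s : Z ⟶ Y),
    f ≫ r = 𝟙 X ∧ s ≫ g = 𝟙 Z ∧ s ≫ r = 0 ∧ r ≫ f + g ≫ s = 𝟙 Y
  isKernelCokernelPair := by
    rintro X Y Z f g ⟨w, r, s, h₁, h₂, h₃, h₄⟩
    have hf : Mono f := mono_of_mono_fac h₁
    have hg : Epi g := epi_of_epi_fac h₂
    refine ⟨w, ⟨?_⟩, ⟨?_⟩⟩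
    · refine KernelFork.IsLimit.ofι' _ _ fun {W} k hk => ⟨k ≫ r, ?_⟩
      have := k ≫= h₄
      rw [Preadditive.comp_add, reassoc_of% hk] at this
      simpa using this
    · refine CokernelCofork.IsColimit.ofπ' _ _ fun {W} k hk => ⟨s ≫ k, ?_⟩
      have := h₄ =≫ k
      rw [Preadditive.add_comp, Category.assoc, hk] at this
      simpa using this
  of_iso := by
    rintro X Y Z X' Y' Z' f g f' g' a b c e₁ e₂ ⟨w, r, s, h₁, h₂, h₃, h₄⟩
    have e₁' : f' = a.inv ≫ f ≫ b.hom := by simp [e₁]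
    have e₂' : g' = b.inv ≫ g ≫ c.hom := by simp [e₂]
    refine ⟨by simp [e₁', e₂', reassoc_of% w], b.inv ≫ r ≫ a.hom, c.inv ≫ s ≫ b.hom, ?_, ?_, ?_, ?_⟩
    · simp [e₁', reassoc_of% h₁]
    · simp [e₂', reassoc_of% h₂]
    · simp [reassoc_of% h₃]
    · have := b.inv ≫= h₄ =≫ b.hom
      simpa [e₁', e₂'] using this
  id_admMono X := by
    refine ⟨0, 0, by simp, 𝟙 X, 0, by simp, ?_, by simp, by simp⟩
    exact (isZero_zero C).eq_of_src _ _
  id_admEpi X := by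
    refine ⟨0, 0, by simp, 0, 𝟙 X, ?_, by simp, by simp, by simp⟩
    exact (isZero_zero C).eq_of_src _ _
  comp_admMono := by
    rintro X Y W f f₂ ⟨Z, g, w, r, s, h₁, h₂, h₃, h₄⟩ ⟨Z₂, g₂, w₂, r₂, s₂, k₁, k₂, k₃, k₄⟩
    refine ⟨Z ⊞ Z₂, biprod.lift (r₂ ≫ g) g₂, ?_, r₂ ≫ r, biprod.desc (s ≫ f₂) s₂, ?_, ?_, ?_, ?_⟩
    · ext <;> simp [w₂, reassoc_of% k₁, w]
    · simp [reassoc_of% k₁, h₁]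
    · ext <;> simp [reassoc_of% k₁, h₂, w₂, reassoc_of% k₃, k₂]
    · ext <;> simp [reassoc_of% k₁, h₃, reassoc_of% k₃]
    · have := r₂ ≫= h₄ =≫ f₂
      simp only [Preadditive.comp_add, Preadditive.add_comp, Category.assoc, Category.id_comp] at this
      simp [biprod.lift_desc, ← add_assoc, this, k₄]
  comp_admEpi := by
    rintro Y Z W g g₂ ⟨X, f, w, r, s, h₁, h₂, h₃, h₄⟩ ⟨X₂, f₂, w₂, r₂, s₂, k₁, k₂, k₃, k₄⟩
    refine ⟨X ⊞ X₂, biprod.desc f (f₂ ≫ s), ?_, biprod.lift r (g ≫ r₂), s₂ ≫ s, ?_, ?_, ?_, ?_⟩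
    · ext <;> simp [w₂, reassoc_of% h₂, reassoc_of% w]
    · ext <;> simp [h₁, h₃, reassoc_of% w, reassoc_of% h₂, k₁]
    · simp [reassoc_of% h₂, k₂]
    · ext <;> simp [h₃, reassoc_of% h₂, k₃]
    · have := g ≫= k₄ =≫ s
      simp only [Preadditive.comp_add, Preadditive.add_comp, Category.assoc, Category.id_comp] at this
      simp [biprod.lift_desc, add_assoc, this, h₄]
  pushout := by
    rintro X Y X' f a ⟨Z, g, w, r, s, h₁, h₂, h₃, h₄⟩
    refine ⟨X' ⊞ Z, biprod.lift (r ≫ a) g, biprod.inl, ⟨⟨?_⟩, ⟨?_⟩⟩, Z, biprod.snd, ?_⟩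
    · ext <;> simp [reassoc_of% h₁, w]
    · refine PushoutCocone.IsColimit.mk _ (fun c => biprod.desc c.inr (s ≫ c.inl)) ?_ ?_ ?_
      · intro c
        have := h₄ =≫ c.inl
        simp only [Preadditive.add_comp, Category.assoc, Category.id_comp, c.condition] at this
        simpa [biprod.lift_desc] using this
      · intro c
        simp
      · intro c m hm₁ hm₂
        have e : s ≫ biprod.lift (r ≫ a) g = biprod.inr := by
          ext <;> simp [reassoc_of% h₃, h₂]
        ext
        · simp [hm₂]
        · rw [← e, Category.assoc, hm₁]
          simp [reassoc_of% h₃, reassoc_of% h₂]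
    · exact ⟨by simp, biprod.fst, biprod.inr, by simp, by simp, by simp, by simp⟩
  pullback := by
    rintro Y Z Z' g a ⟨X, f, w, r, s, h₁, h₂, h₃, h₄⟩
    refine ⟨X ⊞ Z', biprod.desc f (a ≫ s), biprod.snd, ⟨⟨?_⟩, ⟨?_⟩⟩, X, biprod.inl, ?_⟩
    · ext <;> simp [h₂, w]
    · refine PullbackCone.IsLimit.mk _ (fun c => biprod.lift (c.fst ≫ r) c.snd) ?_ ?_ ?_
      · intro c
        have := c.fst ≫= h₄
        simp only [Preadditive.comp_add, Category.comp_id, reassoc_of% c.condition] at this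
        simpa [biprod.lift_desc] using this
      · intro c
        simp
      · intro c m hm₁ hm₂
        have e : biprod.desc f (a ≫ s) ≫ r = biprod.fst := by
          ext <;> simp [h₁, h₃]
        ext
        · rw [← e, reassoc_of% hm₁]
          simp [e]
        · simp [hm₂]
    · exact ⟨by simp, biprod.fst, biprod.inr, by simp, by simp, by simp, by simp⟩

end ExactStructure

/-! ### Admissible Ind-objects and Pro-objects

The bound `κ` lives in `WithTop Cardinal`; `κ = ⊤` means that no bound is imposed. -/

section Ind

variable {C : Type u} [Category.{v} C] [Preadditive C]

/-- Left exact presheaves of abelian groups: for every exact sequence `X ⟶ Y ⟶ Z` in `C`, the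
sequence `0 ⟶ P Z ⟶ P Y ⟶ P X` is exact. -/
def ExactStructure.IsLex (E : ExactStructure C) : ObjectProperty (Cᵒᵖ ⥤ AddCommGrpCat.{v}) :=
  fun P => ∀ ⦃X Y Z : C⦄ (f : X ⟶ Y) (g : Y ⟶ Z), E.conf f g →
    Function.Injective (P.map g.op) ∧ Function.Exact (P.map g.op) (P.map f.op)

/-- Admissible Ind-diagrams of size at most `κ`: diagrams of admissible monics, indexed by a
(nonempty) directed poset of cardinality at most `κ`. -/
structure ExactStructure.IsAdmissibleIndDiagram (E : ExactStructure C) (κ : WithTop Cardinal.{v})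
    {I : Type v} [PartialOrder I] (X : I ⥤ C) : Prop where
  nonempty : Nonempty I
  directed : IsDirectedOrder I
  card_le : ((Cardinal.mk I : Cardinal.{v}) : WithTop Cardinal.{v}) ≤ κ
  admMono : ∀ ⦃i j : I⦄ (a : i ⟶ j), E.conf.AdmMono (X.map a)

/-- The left exact presheaves isomorphic to `U ↦ colim_i Hom(U, X_i)` for an admissible
Ind-diagram `X` of size at most `κ`. -/
def ExactStructure.IsIndObject (E : ExactStructure C) (κ : WithTop Cardinal.{v}) :
    ObjectProperty (Cᵒᵖ ⥤ AddCommGrpCat.{v}) :=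
  fun P => E.IsLex P ∧ ∃ (I : Type v) (_ : PartialOrder I) (X : I ⥤ C),
    E.IsAdmissibleIndDiagram κ X ∧ Nonempty (P ≅ colimit (X ⋙ preadditiveYoneda))

/-- The category of admissible Ind-objects of size at most `κ`, a full subcategory of the category
of left exact presheaves. -/
abbrev Ind (E : ExactStructure C) (κ : WithTop Cardinal.{v}) : Type (max u (v + 1)) :=
  (E.IsIndObject κ).FullSubcategory

/-- The exact sequences of admissible Ind-objects: the sequences `P ⟶ Q ⟶ R` such that
`0 ⟶ P ⟶ Q ⟶ R ⟶ 0` is exact in the abelian category of left exact presheaves. The latter are the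
sheaves of abelian groups for the topology generated by the admissible epics, so this means that
`0 ⟶ P U ⟶ Q U ⟶ R U` is exact for every `U`, and that every section of `R` lifts to `Q` locally,
i.e. after restriction along an admissible epic (the presheaf cokernel of `Q ⟶ R` is
effaceable). -/
def indExact (E : ExactStructure C) (κ : WithTop Cardinal.{v}) : SeqClass (Ind E κ) :=
  fun _ Q R f g =>
    (∀ U : C, Function.Injective (f.hom.app (op U)) ∧
      Function.Exact (f.hom.app (op U)) (g.hom.app (op U))) ∧
    ∀ (U : C) (z : R.obj.obj (op U)), ∃ (V : C) (q : V ⟶ U) (y : Q.obj.obj (op V)),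
      E.conf.AdmEpi q ∧ g.hom.app (op V) y = R.obj.map q.op z

lemma isLex_preadditiveYoneda (E : ExactStructure C) (X : C) :
    E.IsLex (preadditiveYoneda.obj X) := by
  intro A B Z f g h
  obtain ⟨w, -, ⟨hc⟩⟩ := E.isKernelCokernelPair f g h
  refine ⟨fun a b hab => ?_, fun b => ⟨fun hb => ?_, ?_⟩⟩
  · exact Cofork.IsColimit.hom_ext hc hab
  · obtain ⟨l, hl⟩ := CokernelCofork.IsColimit.desc' hc (b : B ⟶ X) hb
    exact ⟨l, hl⟩
  · rintro ⟨l, rfl⟩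
    have key : ∀ l' : Z ⟶ X, f ≫ g ≫ l' = 0 := fun l' => by rw [reassoc_of% w, zero_comp]
    exact key l

lemma isIndObject_preadditiveYoneda (E : ExactStructure C) {κ : WithTop Cardinal.{v}}
    (hκ : ((Cardinal.aleph0 : Cardinal.{v}) : WithTop Cardinal.{v}) ≤ κ) (X : C) :
    E.IsIndObject κ (preadditiveYoneda.obj X) := by
  refine ⟨isLex_preadditiveYoneda E X, PUnit.{v + 1}, inferInstance,
    (Functor.const _).obj X, ⟨⟨⟨⟩⟩, inferInstance, ?_, fun _ _ _ => E.id_admMono X⟩, ⟨?_⟩⟩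
  · refine le_trans ?_ hκ
    rw [WithTop.coe_le_coe]
    exact Cardinal.mk_le_aleph0
  · let t : IsTerminal (PUnit.unit : PUnit.{v + 1}) :=
      IsTerminal.ofUniqueHom (fun _ => homOfLE le_rfl) (fun _ _ => Subsingleton.elim _ _)
    exact (colimitOfDiagramTerminal t ((Functor.const _).obj X ⋙
      preadditiveYoneda)).coconePointUniqueUpToIso (colimit.isColimit _)

/-- The embedding of `C` into its admissible Ind-objects. -/
def Ind.incl (E : ExactStructure C) (κ : WithTop Cardinal.{v})
    (hκ : ((Cardinal.aleph0 : Cardinal.{v}) : WithTop Cardinal.{v}) ≤ κ) : C ⥤ Ind E κ :=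
  (E.IsIndObject κ).lift preadditiveYoneda (isIndObject_preadditiveYoneda E hκ)

/-- The category of admissible Pro-objects of size at most `κ`. -/
abbrev Pro (E : ExactStructure C) (κ : WithTop Cardinal.{v}) : Type (max u (v + 1)) :=
  (Ind E.op κ)ᵒᵖ

/-- The exact sequences of admissible Pro-objects. -/
def proExact (E : ExactStructure C) (κ : WithTop Cardinal.{v}) : SeqClass (Pro E κ) :=
  (indExact E.op κ).op

/-- The embedding of `C` into its admissible Pro-objects. -/
def Pro.incl (E : ExactStructure C) (κ : WithTop Cardinal.{v})
    (hκ : ((Cardinal.aleph0 : Cardinal.{v}) : WithTop Cardinal.{v}) ≤ κ) : C ⥤ Pro E κ :=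
  (Ind.incl E.op κ hκ).rightOp

end Ind

/-! ### Idempotent completions -/

/-- The exact sequences of the idempotent completion of an exact category `A`: the direct summands
of the exact sequences of `A`. Explicitly, there are a second sequence `X' ⟶ Y' ⟶ Z'` in the
idempotent completion and an exact sequence `u, v` in `A` isomorphic to the direct sum of the two
sequences. -/
def SeqClass.karoubi {A : Type u} [Category.{v} A] [Preadditive A] (S : SeqClass A) :
    SeqClass (Idempotents.Karoubi A) :=
  fun X Y Z f g =>
    ∃ (X' Y' Z' : Idempotents.Karoubi A) (f' : X' ⟶ Y') (g' : Y' ⟶ Z')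
      (bX : BinaryBicone X X') (bY : BinaryBicone Y Y') (bZ : BinaryBicone Z Z')
      (A₀ A₁ A₂ : A) (u : A₀ ⟶ A₁) (v : A₁ ⟶ A₂)
      (a : bX.pt ≅ (Idempotents.toKaroubi A).obj A₀)
      (b : bY.pt ≅ (Idempotents.toKaroubi A).obj A₁)
      (c : bZ.pt ≅ (Idempotents.toKaroubi A).obj A₂),
      Nonempty bX.IsBilimit ∧ Nonempty bY.IsBilimit ∧ Nonempty bZ.IsBilimit ∧ S u v ∧
      (bX.fst ≫ f ≫ bY.inl + bX.snd ≫ f' ≫ bY.inr) ≫ b.hom =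
        a.hom ≫ (Idempotents.toKaroubi A).map u ∧
      (bY.fst ≫ g ≫ bZ.inl + bY.snd ≫ g' ≫ bZ.inr) ≫ c.hom =
        b.hom ≫ (Idempotents.toKaroubi A).map v

section FM

variable {C : Type u} [Category.{v} C] [Preadditive C]

/-- The category of `κ`-generated flat Mittag-Leffler objects of an exact category. -/
abbrev FM (E : ExactStructure C) (κ : WithTop Cardinal.{v}) : Type (max u (v + 1)) :=
  Idempotents.Karoubi (Ind E κ)

/-- The exact sequences of `FM E κ`. -/
def fmExact (E : ExactStructure C) (κ : WithTop Cardinal.{v}) : SeqClass (FM E κ) :=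
  (indExact E κ).karoubi

/-- The embedding of `C` into `FM E κ`. -/
def FM.incl (E : ExactStructure C) (κ : WithTop Cardinal.{v})
    (hκ : ((Cardinal.aleph0 : Cardinal.{v}) : WithTop Cardinal.{v}) ≤ κ) : C ⥤ FM E κ :=
  Ind.incl E κ hκ ⋙ Idempotents.toKaroubi _

/-- The category of formal duals to `κ`-generated flat Mittag-Leffler objects of an exact
category. -/
abbrev FMDual (E : ExactStructure C) (κ : WithTop Cardinal.{v}) : Type (max u (v + 1)) :=
  Idempotents.Karoubi (Pro E κ)

/-- The exact sequences of `FMDual E κ`. -/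
def fmDualExact (E : ExactStructure C) (κ : WithTop Cardinal.{v}) : SeqClass (FMDual E κ) :=
  (proExact E κ).karoubi

/-- The embedding of `C` into `FMDual E κ`. -/
def FMDual.incl (E : ExactStructure C) (κ : WithTop Cardinal.{v})
    (hκ : ((Cardinal.aleph0 : Cardinal.{v}) : WithTop Cardinal.{v}) ≤ κ) : C ⥤ FMDual E κ :=
  Pro.incl E κ hκ ⋙ Idempotents.toKaroubi _

lemma FMDual.incl_map_add (E : ExactStructure C) (κ : WithTop Cardinal.{v})
    (hκ : ((Cardinal.aleph0 : Cardinal.{v}) : WithTop Cardinal.{v}) ≤ κ) {X Y : C} (f g : X ⟶ Y) :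
    (FMDual.incl E κ hκ).map (f + g) =
      (FMDual.incl E κ hκ).map f + (FMDual.incl E κ hκ).map g := by
  apply Idempotents.Karoubi.hom_ext
  apply Quiver.Hom.unop_inj
  apply ObjectProperty.hom_ext
  apply NatTrans.ext
  funext U
  apply AddCommGrpCat.ext
  intro (x : U.unop ⟶ op Y)
  exact Preadditive.comp_add _ _ _ x f.op g.op

end FM

/-! ### Finitely generated projective modules -/

/-- Finitely generated projective modules. -/
def IsPf (A : Type w) [Ring A] : ObjectProperty (ModuleCat.{w} A) :=
  fun M => Module.Finite A M ∧ Module.Projective A M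

/-- The category of finitely generated projective left `A`-modules. Right `R`-modules are left
modules over `Rᵐᵒᵖ`. -/
abbrev Pf (A : Type w) [Ring A] : Type (w + 1) := (IsPf A).FullSubcategory

instance (A : Type w) [Ring A] : HasZeroObject (Pf A) := by
  refine ⟨⟨ModuleCat.of A PUnit, ⟨inferInstance, inferInstance⟩⟩, ⟨fun Y => ⟨⟨⟨0⟩, fun f => ?_⟩⟩,
    fun Y => ⟨⟨⟨0⟩, fun f => ?_⟩⟩⟩⟩
  · apply ObjectProperty.hom_ext
    exact (ModuleCat.isZero_of_subsingleton (ModuleCat.of A PUnit.{w + 1})).eq_of_src _ _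
  · apply ObjectProperty.hom_ext
    exact (ModuleCat.isZero_of_subsingleton (ModuleCat.of A PUnit.{w + 1})).eq_of_tgt _ _

instance (A : Type w) [Ring A] : HasBinaryBiproducts (Pf A) where
  has_binary_biproduct M N := by
    have := M.property.1
    have := M.property.2
    have := N.property.1
    have := N.property.2
    exact HasBinaryBiproduct.mk
      { bicone :=
          { pt := ⟨ModuleCat.of A (M.obj × N.obj), ⟨inferInstance, inferInstance⟩⟩
            fst := ObjectProperty.homMk (ModuleCat.ofHom (LinearMap.fst A M.obj N.obj))
            snd := ObjectProperty.homMk (ModuleCat.ofHom (LinearMap.snd A M.obj N.obj))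
            inl := ObjectProperty.homMk (ModuleCat.ofHom (LinearMap.inl A M.obj N.obj))
            inr := ObjectProperty.homMk (ModuleCat.ofHom (LinearMap.inr A M.obj N.obj))
            inl_fst := rfl
            inl_snd := rfl
            inr_fst := rfl
            inr_snd := rfl }
        isBilimit := isBinaryBilimitOfTotal _ (by
          apply ObjectProperty.hom_ext
          apply ModuleCat.hom_ext
          apply LinearMap.ext
          rintro ⟨x, y⟩
          change ((x, (0 : N.obj)) + ((0 : M.obj), y) : M.obj × N.obj) = (x, y)
          simp) }

/-- The (split) exact structure on `Pf A`. -/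
def Pf.exactStructure (A : Type w) [Ring A] : ExactStructure (Pf A) :=
  ExactStructure.split (Pf A)

/-! ### Flat Mittag-Leffler modules -/

/-- A flat Mittag-Leffler module is a colimit of a diagram `X` of finitely generated projective
modules `X i`, indexed by a directed poset, such that for each `i` the images of the maps
`Hom(X k, A) ⟶ Hom(X i, A)` stabilize as `k` grows. -/
def IsFlatMittagLeffler {A : Type w} [Ring A] (M : ModuleCat.{w} A) : Prop :=
  ∃ (I : Type w) (_ : PartialOrder I) (X : I ⥤ Pf A) (c : Cocone (X ⋙ (IsPf A).ι)),
    Nonempty I ∧ IsDirectedOrder I ∧ Nonempty (IsColimit c) ∧ Nonempty (M ≅ c.pt) ∧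
    ∀ i : I, ∃ (j : I) (a : i ⟶ j), ∀ (k : I) (b : j ⟶ k),
      Set.range (fun φ : (X.obj k).obj →ₗ[A] A => φ ∘ₗ (X.map (a ≫ b)).hom.hom) =
        Set.range (fun φ : (X.obj j).obj →ₗ[A] A => φ ∘ₗ (X.map a).hom.hom)

/-- `κ`-generated flat Mittag-Leffler modules. -/
def IsFMModule (A : Type w) [Ring A] (κ : WithTop Cardinal.{w}) :
    ObjectProperty (ModuleCat.{w} A) :=
  fun M => IsFlatMittagLeffler M ∧ ∃ s : Set M,
    ((Cardinal.mk s : Cardinal.{w}) : WithTop Cardinal.{w}) ≤ κ ∧ Submodule.span A s = ⊤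

/-- The category of `κ`-generated flat Mittag-Leffler modules (of all flat Mittag-Leffler modules
if `κ = ⊤`). -/
abbrev FMMod (A : Type w) [Ring A] (κ : WithTop Cardinal.{w}) : Type (w + 1) :=
  (IsFMModule A κ).FullSubcategory

/-- The exact sequences of flat Mittag-Leffler modules: the short exact sequences of modules. -/
def fmModExact (A : Type w) [Ring A] (κ : WithTop Cardinal.{w}) : SeqClass (FMMod A κ) :=
  fun _ _ _ f g => Function.Injective f.hom.hom ∧ Function.Exact f.hom.hom g.hom.hom ∧
    Function.Surjective g.hom.hom

lemma isFMModule_of_isPf (A : Type w) [Ring A] {κ : WithTop Cardinal.{w}}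
    (hκ : ((Cardinal.aleph0 : Cardinal.{w}) : WithTop Cardinal.{w}) ≤ κ)
    (M : ModuleCat.{w} A) (hM : IsPf A M) : IsFMModule A κ M := by
  refine ⟨?_, ?_⟩
  · let t : IsTerminal (PUnit.unit : PUnit.{w + 1}) :=
      IsTerminal.ofUniqueHom (fun _ => homOfLE le_rfl) (fun _ _ => Subsingleton.elim _ _)
    refine ⟨PUnit.{w + 1}, inferInstance, (Functor.const _).obj ⟨M, hM⟩, _, ⟨⟨⟩⟩, inferInstance,
      ⟨colimitOfDiagramTerminal t _⟩, ⟨Iso.refl _⟩, fun i => ⟨i, 𝟙 i, fun k b => ?_⟩⟩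
    obtain rfl : i = k := Subsingleton.elim _ _
    rfl
  · obtain ⟨s, hs⟩ := hM.1
    refine ⟨s, le_trans ?_ hκ, hs⟩
    rw [WithTop.coe_le_coe]
    exact Cardinal.mk_le_aleph0

/-- The inclusion of the finitely generated projective modules into the `κ`-generated flat
Mittag-Leffler modules. -/
def Pf.toFMMod (A : Type w) [Ring A] (κ : WithTop Cardinal.{w})
    (hκ : ((Cardinal.aleph0 : Cardinal.{w}) : WithTop Cardinal.{w}) ≤ κ) : Pf A ⥤ FMMod A κ :=
  ObjectProperty.ιOfLE (isFMModule_of_isPf A hκ)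

/-! ### Duality -/

section Dual

variable (R : Type w) [Ring R]

lemma isPf_dual (M : ModuleCat.{w} Rᵐᵒᵖ) (hM : IsPf Rᵐᵒᵖ M) :
    IsPf R (ModuleCat.of R (M →ₗ[Rᵐᵒᵖ] R)) := by
  have := hM.1
  have := hM.2
  obtain ⟨n, f, g, -, -, hfg⟩ := Module.Finite.exists_comp_eq_id_of_projective Rᵐᵒᵖ M
  let e : (Fin n → R) ≃ₗ[R] ((Fin n → Rᵐᵒᵖ) →ₗ[Rᵐᵒᵖ] R) :=
    (LinearEquiv.piCongrRight fun _ => (LinearMap.ringLmapEquivSelf Rᵐᵒᵖ R R).symm) ≪≫ₗ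
      LinearMap.lsum Rᵐᵒᵖ (fun _ : Fin n => Rᵐᵒᵖ) R
  let r : (M →ₗ[Rᵐᵒᵖ] R) →ₗ[R] ((Fin n → Rᵐᵒᵖ) →ₗ[Rᵐᵒᵖ] R) :=
    { toFun := fun φ => φ ∘ₗ f
      map_add' := fun _ _ => rfl
      map_smul' := fun _ _ => rfl }
  let s : ((Fin n → Rᵐᵒᵖ) →ₗ[Rᵐᵒᵖ] R) →ₗ[R] (M →ₗ[Rᵐᵒᵖ] R) :=
    { toFun := fun φ => φ ∘ₗ g
      map_add' := fun _ _ => rfl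
      map_smul' := fun _ _ => rfl }
  have hsr : s ∘ₗ r = LinearMap.id := by
    apply LinearMap.ext
    intro φ
    change (φ ∘ₗ f) ∘ₗ g = φ
    rw [LinearMap.comp_assoc, hfg, LinearMap.comp_id]
  have : Module.Finite R ((Fin n → Rᵐᵒᵖ) →ₗ[Rᵐᵒᵖ] R) := Module.Finite.equiv e
  have : Module.Projective R ((Fin n → Rᵐᵒᵖ) →ₗ[Rᵐᵒᵖ] R) := Module.Projective.of_equiv e
  exact ⟨Module.Finite.of_surjective s fun φ => ⟨r φ, LinearMap.congr_fun hsr φ⟩,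
    Module.Projective.of_split r s hsr⟩

/-- The functor `Hom(-, R)` from finitely generated projective right `R`-modules to finitely
generated projective left `R`-modules. -/
def Pf.dual : (Pf Rᵐᵒᵖ)ᵒᵖ ⥤ Pf R where
  obj M := ⟨ModuleCat.of R (M.unop.obj →ₗ[Rᵐᵒᵖ] R), isPf_dual R _ M.unop.property⟩
  map f := ObjectProperty.homMk (ModuleCat.ofHom
    { toFun := fun φ => φ ∘ₗ f.unop.hom.hom
      map_add' := fun _ _ => rfl
      map_smul' := fun _ _ => rfl })

/-- `R` as a finitely generated projective left `R`-module. -/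
def Pf.self : Pf R := ⟨ModuleCat.of R R, ⟨inferInstance, inferInstance⟩⟩

/-- Right multiplication by an element of `R`, an endomorphism of the left module `R`. -/
def Pf.mulRight (a : Rᵐᵒᵖ) : Pf.self R ⟶ Pf.self R :=
  ObjectProperty.homMk (ModuleCat.ofHom (Module.toModuleEnd R (S := Rᵐᵒᵖ) R a))

/-- The right action of `R` on the object `R` of `FMDual (Pf R)`. -/
def mulRightHom (κ : WithTop Cardinal.{w})
    (hκ : ((Cardinal.aleph0 : Cardinal.{w}) : WithTop Cardinal.{w}) ≤ κ) :
    Rᵐᵒᵖ →+* End ((FMDual.incl (Pf.exactStructure R) κ hκ).obj (Pf.self R)) where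
  toFun a := (FMDual.incl (Pf.exactStructure R) κ hκ).map (Pf.mulRight R a)
  map_one' := by
    have h : Pf.mulRight R 1 = 𝟙 _ := by
      apply ObjectProperty.hom_ext
      apply ModuleCat.hom_ext
      exact map_one (Module.toModuleEnd R (S := Rᵐᵒᵖ) R)
    rw [h]
    exact (FMDual.incl (Pf.exactStructure R) κ hκ).map_id _
  map_mul' a b := by
    have h : Pf.mulRight R (a * b) = Pf.mulRight R b ≫ Pf.mulRight R a := by
      apply ObjectProperty.hom_ext
      apply ModuleCat.hom_ext
      exact map_mul (Module.toModuleEnd R (S := Rᵐᵒᵖ) R) a b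
    rw [h]
    exact (FMDual.incl (Pf.exactStructure R) κ hκ).map_comp _ _
  map_zero' := by
    have h : Pf.mulRight R 0 = Pf.mulRight R 0 + Pf.mulRight R 0 := by
      apply ObjectProperty.hom_ext
      apply ModuleCat.hom_ext
      apply LinearMap.ext
      intro (x : R)
      change (0 : Rᵐᵒᵖ) • x = (0 : Rᵐᵒᵖ) • x + (0 : Rᵐᵒᵖ) • x
      simp
    have h' := congrArg (FMDual.incl (Pf.exactStructure R) κ hκ).map h
    rw [FMDual.incl_map_add] at h'
    exact left_eq_add.mp h'
  map_add' a b := by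
    have h : Pf.mulRight R (a + b) = Pf.mulRight R a + Pf.mulRight R b := by
      apply ObjectProperty.hom_ext
      apply ModuleCat.hom_ext
      exact map_add (Module.toModuleEnd R (S := Rᵐᵒᵖ) R) a b
    rw [h]
    exact FMDual.incl_map_add _ _ _ _ _

/-- The functor `Hom(-, R)` on `FMDual (Pf R)`, with values in right `R`-modules. -/
def FMDual.homToSelf (κ : WithTop Cardinal.{w})
    (hκ : ((Cardinal.aleph0 : Cardinal.{w}) : WithTop Cardinal.{w}) ≤ κ) :
    (FMDual (Pf.exactStructure R) κ)ᵒᵖ ⥤ ModuleCat.{w + 1} Rᵐᵒᵖ :=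
  preadditiveYonedaObj ((FMDual.incl (Pf.exactStructure R) κ hκ).obj (Pf.self R)) ⋙
    ModuleCat.restrictScalars (mulRightHom R κ hκ)

end Dual

end AdmInd

end

open AdmInd

/-! Since `Pro D` is by definition the opposite of `Ind` of the opposite category, a contravariant
exact functor is the same as a covariant exact functor `G` from `C` to the opposite of `D`, and the
first part reduces to extending `G` to admissible Ind-objects. An admissible Ind-object is a
filtered union of representables: each section comes from some stage of the diagram, and since the
transition maps are monic it does so in at most one way at a given stage (`IndPres`). Hence a
presentation is final among all objects over the Ind-object, the left Kan extension `K` of `G`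
exists, and it takes the union of the `X i` to the union of the `G (X i)`. Sections of `K P` are
therefore restrictions of sections coming from `P`, and faithfulness, fullness and essential
surjectivity are checked on these.

Exactness of `K` rests on `indExact.exists_conf`: given an exact sequence of Ind-objects, a section
of the middle term over `U` extends to a section over some larger `W` whose image in the quotient is
represented by an admissible epic from `W` to a stage. The kernel of that epic turns the question
into one about a conflation of `C`, which `G` preserves.

Idempotent completion is formal once direct summands of exact sequences are recognized as retracts
(`SeqClass.karoubi_iff`), because any functor preserves retract diagrams; it also preserves
pointwise Kan extensions.

For modules, duality on finitely generated projectives is an exact equivalence, so the first part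
applies, and what remains is to identify flat Mittag-Leffler modules with the idempotent completion
of Ind-objects. A map from a finitely generated projective module to a flat Mittag-Leffler module
`M` need not factor through one that is split in all later stages, but it does after a free module
of countable rank is added to `M` (`IsFlatML.exists_isLocallySplit`): the failure to be split is
recorded in fresh coordinates. So `M × (ℕ →₀ A)` is a directed union of submodules with split
inclusions, an admissible Ind-object, and `M` is its summand. Conversely, an admissible diagram has
split transition maps, so its colimit is Mittag-Leffler with trivially stable dual images. Finally,
an element of `M` is a map from the free module of rank one, and duality turns it into a functional
on the dual object; this identifies the inverse. -/

noncomputable section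

namespace AdmInd

/-! ### Exact sequences in idempotent completions as retracts -/

section KaroubiSeq

open Idempotents

/-- A sequence in the idempotent completion that is a retract of a sequence of the class. -/
def SeqClass.IsRetract {A : Type u} [Category.{v} A] (S : SeqClass A) {X Y Z : Karoubi A}
    (f : X ⟶ Y) (g : Y ⟶ Z) : Prop :=
  ∃ (A₀ A₁ A₂ : A) (a : A₀ ⟶ A₁) (b : A₁ ⟶ A₂) (i₀ : X ⟶ (toKaroubi A).obj A₀)
    (r₀ : (toKaroubi A).obj A₀ ⟶ X) (i₁ : Y ⟶ (toKaroubi A).obj A₁)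
    (r₁ : (toKaroubi A).obj A₁ ⟶ Y) (i₂ : Z ⟶ (toKaroubi A).obj A₂)
    (r₂ : (toKaroubi A).obj A₂ ⟶ Z), S a b ∧ i₀ ≫ r₀ = 𝟙 X ∧ i₁ ≫ r₁ = 𝟙 Y ∧ i₂ ≫ r₂ = 𝟙 Z ∧
    f ≫ i₁ = i₀ ≫ (toKaroubi A).map a ∧ r₀ ≫ f = (toKaroubi A).map a ≫ r₁ ∧
    g ≫ i₂ = i₁ ≫ (toKaroubi A).map b ∧ r₁ ≫ g = (toKaroubi A).map b ≫ r₂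

section Complement

variable {A : Type u} [Category.{v} A] {X : Karoubi A} {B : A}
  (i : X ⟶ (toKaroubi A).obj B) (r : (toKaroubi A).obj B ⟶ X) (h : i ≫ r = 𝟙 X)

/-- The idempotent of a retract. -/
def retractIdem : B ⟶ B := r.f ≫ i.f

include h in
lemma retractIdem_comp : retractIdem i r ≫ retractIdem i r = retractIdem i r := by
  have h' : i.f ≫ r.f = X.p := congrArg Karoubi.Hom.f h
  change (r.f ≫ i.f) ≫ (r.f ≫ i.f) = r.f ≫ i.f
  rw [Category.assoc, reassoc_of% h', Karoubi.p_comp]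

variable [Preadditive A]

/-- The complement of a retract of an object in the idempotent completion. -/
def retractCompl : Karoubi A where
  X := B
  p := 𝟙 B - retractIdem i r
  idem := by
    have := retractIdem_comp i r h
    simp only [Preadditive.sub_comp, Preadditive.comp_sub, Category.comp_id, Category.id_comp, this]
    simp

/-- The inclusion of the complement of a retract. -/
def retractComplι : retractCompl i r h ⟶ (toKaroubi A).obj B where
  f := 𝟙 B - retractIdem i r
  comm := by
    have : _ ≫ _ = 𝟙 B - retractIdem i r := (retractCompl i r h).idem
    change (𝟙 B - retractIdem i r) ≫ (𝟙 B - retractIdem i r) ≫ 𝟙 B = _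
    rw [Category.comp_id]
    exact this

/-- The projection to the complement of a retract. -/
def retractComplπ : (toKaroubi A).obj B ⟶ retractCompl i r h where
  f := 𝟙 B - retractIdem i r
  comm := by
    have : _ ≫ _ = 𝟙 B - retractIdem i r := (retractCompl i r h).idem
    change 𝟙 B ≫ (𝟙 B - retractIdem i r) ≫ (𝟙 B - retractIdem i r) = _
    rw [Category.id_comp]
    exact this

lemma retractCompl_ι_π : retractComplι i r h ≫ retractComplπ i r h = 𝟙 _ :=
  Karoubi.hom_ext _ _ (retractCompl i r h).idem

lemma retractCompl_total : r ≫ i + retractComplπ i r h ≫ retractComplι i r h = 𝟙 _ := by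
  apply Karoubi.hom_ext
  have : (𝟙 B - retractIdem i r) ≫ (𝟙 B - retractIdem i r) = 𝟙 B - retractIdem i r :=
    (retractCompl i r h).idem
  change retractIdem i r + (𝟙 B - retractIdem i r) ≫ (𝟙 B - retractIdem i r) = 𝟙 B
  rw [this]
  abel

lemma comp_retractComplπ : i ≫ retractComplπ i r h = 0 := by
  apply Karoubi.hom_ext
  have h' : i.f ≫ r.f = X.p := congrArg Karoubi.Hom.f h
  have h'' : i.f ≫ retractIdem i r = i.f := by
    rw [retractIdem, reassoc_of% h', Karoubi.p_comp]
  change (show X.X ⟶ B from i.f) ≫ (𝟙 B - retractIdem i r) = 0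
  rw [Preadditive.comp_sub, Category.comp_id, sub_eq_zero]
  exact h''.symm

lemma retractComplι_comp : retractComplι i r h ≫ r = 0 := by
  apply Karoubi.hom_ext
  have h' : i.f ≫ r.f = X.p := congrArg Karoubi.Hom.f h
  have h'' : retractIdem i r ≫ r.f = r.f := by
    rw [retractIdem, Category.assoc, h', Karoubi.comp_p]
  change (𝟙 B - retractIdem i r) ≫ (show B ⟶ X.X from r.f) = 0
  rw [Preadditive.sub_comp, Category.id_comp, sub_eq_zero]
  exact h''.symm

/-- The decomposition of an object into a retract and its complement. -/
def retractBicone : BinaryBicone X (retractCompl i r h) where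
  pt := (toKaroubi A).obj B
  fst := r
  snd := retractComplπ i r h
  inl := i
  inr := retractComplι i r h
  inl_fst := h
  inl_snd := comp_retractComplπ i r h
  inr_fst := retractComplι_comp i r h
  inr_snd := retractCompl_ι_π i r h

end Complement

section CompMap

variable {A : Type u} [Category.{v} A] [Preadditive A] {X Y : Karoubi A} {B B' : A}
  (i : X ⟶ (toKaroubi A).obj B) (r : (toKaroubi A).obj B ⟶ X) (h : i ≫ r = 𝟙 X)
  (i' : Y ⟶ (toKaroubi A).obj B') (r' : (toKaroubi A).obj B' ⟶ Y) (h' : i' ≫ r' = 𝟙 Y)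
  (f : X ⟶ Y) (a : B ⟶ B')

/-- Compatibility of `a` with both the inclusions and the projections makes its two off-diagonal
entries vanish, so `a` is block diagonal for the decompositions into retract and complement. -/
lemma retract_map_decomp (hi : f ≫ i' = i ≫ (toKaroubi A).map a)
    (hr : r ≫ f = (toKaroubi A).map a ≫ r') :
    r ≫ f ≫ i' + retractComplπ i r h ≫ (retractComplι i r h ≫ (toKaroubi A).map a ≫
      retractComplπ i' r' h') ≫ retractComplι i' r' h' = (toKaroubi A).map a := by
  have t := retractCompl_total i r h
  have t' := retractCompl_total i' r' h'
  have e1 : retractComplπ i r h ≫ retractComplι i r h = 𝟙 _ - r ≫ i := by rw [← t]; abel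
  have e2 : retractComplπ i' r' h' ≫ retractComplι i' r' h' = 𝟙 _ - r' ≫ i' := by rw [← t']; abel
  simp only [Category.assoc, e2, reassoc_of% e1, Preadditive.comp_sub, Preadditive.sub_comp,
    Category.comp_id, Category.id_comp]
  rw [← hi, ← reassoc_of% hr, reassoc_of% h]
  abel

end CompMap

/-- In an idempotent completion every retract has a complement, and by `retract_map_decomp` the
complements form the second sequence of the direct sum. The retract form involves only compositions
and identities, so it can be transported along functors without mention of biproducts. -/
lemma SeqClass.karoubi_iff {A : Type u} [Category.{v} A] [Preadditive A] (S : SeqClass A)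
    {X Y Z : Karoubi A} (f : X ⟶ Y) (g : Y ⟶ Z) : S.karoubi f g ↔ S.IsRetract f g := by
  constructor
  · rintro ⟨X', Y', Z', f', g', bX, bY, bZ, A₀, A₁, A₂, x, y, a, b, c, -, -, -, hS, h₁, h₂⟩
    refine ⟨A₀, A₁, A₂, x, y, bX.inl ≫ a.hom, a.inv ≫ bX.fst, bY.inl ≫ b.hom, b.inv ≫ bY.fst,
      bZ.inl ≫ c.hom, c.inv ≫ bZ.fst, hS, by simp, by simp, by simp, ?_, ?_, ?_, ?_⟩
    · rw [Category.assoc, ← h₁]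
      simp only [Preadditive.add_comp, Preadditive.comp_add, Category.assoc,
        BinaryBicone.inl_fst_assoc, BinaryBicone.inl_snd_assoc, zero_comp, add_zero]
    · rw [← cancel_epi a.hom, Category.assoc, Iso.hom_inv_id_assoc, ← reassoc_of% h₁]
      simp only [Preadditive.add_comp, Category.assoc, Iso.hom_inv_id_assoc,
        BinaryBicone.inl_fst, BinaryBicone.inr_fst, comp_zero, add_zero, Category.comp_id]
    · rw [Category.assoc, ← h₂]
      simp only [Preadditive.add_comp, Preadditive.comp_add, Category.assoc,
        BinaryBicone.inl_fst_assoc, BinaryBicone.inl_snd_assoc, zero_comp, add_zero]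
    · rw [← cancel_epi b.hom, Category.assoc, Iso.hom_inv_id_assoc, ← reassoc_of% h₂]
      simp only [Preadditive.add_comp, Category.assoc, Iso.hom_inv_id_assoc,
        BinaryBicone.inl_fst, BinaryBicone.inr_fst, comp_zero, add_zero, Category.comp_id]
  · rintro ⟨A₀, A₁, A₂, a, b, i₀, r₀, i₁, r₁, i₂, r₂, hS, h₀, h₁, h₂, e₁, e₂, e₃, e₄⟩
    refine ⟨retractCompl i₀ r₀ h₀, retractCompl i₁ r₁ h₁, retractCompl i₂ r₂ h₂,
      retractComplι i₀ r₀ h₀ ≫ (toKaroubi A).map a ≫ retractComplπ i₁ r₁ h₁,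
      retractComplι i₁ r₁ h₁ ≫ (toKaroubi A).map b ≫ retractComplπ i₂ r₂ h₂,
      retractBicone i₀ r₀ h₀, retractBicone i₁ r₁ h₁, retractBicone i₂ r₂ h₂,
      A₀, A₁, A₂, a, b, Iso.refl _, Iso.refl _, Iso.refl _,
      ⟨isBinaryBilimitOfTotal _ (retractCompl_total _ _ _)⟩,
      ⟨isBinaryBilimitOfTotal _ (retractCompl_total _ _ _)⟩,
      ⟨isBinaryBilimitOfTotal _ (retractCompl_total _ _ _)⟩, hS, ?_, ?_⟩
    · exact (Category.comp_id _).trans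
        ((retract_map_decomp _ _ _ _ _ _ _ _ e₁ e₂).trans (Category.id_comp _).symm)
    · exact (Category.comp_id _).trans
        ((retract_map_decomp _ _ _ _ _ _ _ _ e₃ e₄).trans (Category.id_comp _).symm)

/-- The class is closed under isomorphisms of sequences. -/
def SeqClass.IsoClosed {A : Type u} [Category.{v} A] (S : SeqClass A) : Prop :=
  ∀ ⦃X Y Z X' Y' Z' : A⦄ (f : X ⟶ Y) (g : Y ⟶ Z) (f' : X' ⟶ Y') (g' : Y' ⟶ Z')
    (a : X ≅ X') (b : Y ≅ Y') (c : Z ≅ Z'), f ≫ b.hom = a.hom ≫ f' → g ≫ c.hom = b.hom ≫ g' →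
    S f g → S f' g'

lemma SeqClass.isoClosed_karoubi {A : Type u} [Category.{v} A] [Preadditive A] (S : SeqClass A) :
    S.karoubi.IsoClosed := by
  intro X Y Z X' Y' Z' f g f' g' a b c h h' hS
  rw [SeqClass.karoubi_iff] at hS ⊢
  obtain ⟨A₀, A₁, A₂, x, y, i₀, r₀, i₁, r₁, i₂, r₂, hS, h₀, h₁, h₂, e₁, e₂, e₃, e₄⟩ := hS
  have k : f' = a.inv ≫ f ≫ b.hom := by simp [h]
  have k' : g' = b.inv ≫ g ≫ c.hom := by simp [h']
  refine ⟨A₀, A₁, A₂, x, y, a.inv ≫ i₀, r₀ ≫ a.hom, b.inv ≫ i₁, r₁ ≫ b.hom,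
    c.inv ≫ i₂, r₂ ≫ c.hom, hS, by simp [reassoc_of% h₀], by simp [reassoc_of% h₁],
    by simp [reassoc_of% h₂], ?_, ?_, ?_, ?_⟩
  · simp [k, e₁]
  · simp [k, reassoc_of% e₂]
  · simp [k', e₃]
  · simp [k', reassoc_of% e₄]

/-! ### The contravariant extension of a functor to idempotent completions -/

section KaroubiOp

variable {A : Type u₁} [Category.{w} A] {B : Type u₂} [Category.{v} B] (K : A ⥤ B)

/-- The functor between idempotent completions `(Karoubi A)ᵒᵖ ⥤ Karoubi Bᵒᵖ` induced by `K`. -/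
def karoubiOp : (Karoubi A)ᵒᵖ ⥤ Karoubi Bᵒᵖ where
  obj Y := ⟨op (K.obj Y.unop.X), (K.map Y.unop.p).op, by
    rw [← op_comp, ← K.map_comp, Karoubi.idem]⟩
  map {Y Z} f := ⟨(K.map f.unop.f).op, by
    change (K.map Y.unop.p).op ≫ (K.map f.unop.f).op ≫ (K.map Z.unop.p).op = _
    rw [← op_comp, ← op_comp, ← K.map_comp, ← K.map_comp, Category.assoc, f.unop.comm]⟩
  map_id _ := rfl
  map_comp f g := by
    apply Karoubi.hom_ext
    change (K.map (g.unop.f ≫ f.unop.f)).op = (K.map f.unop.f).op ≫ (K.map g.unop.f).op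
    rw [K.map_comp, op_comp]

lemma karoubiOp_map_f {Y Z : (Karoubi A)ᵒᵖ} (f : Y ⟶ Z) :
    ((karoubiOp K).map f).f = (K.map f.unop.f).op := rfl

lemma karoubiOp_faithful [K.Faithful] : (karoubiOp K).Faithful where
  map_injective {Y Z} f g h := by
    apply Quiver.Hom.unop_inj
    apply Karoubi.hom_ext
    apply K.map_injective
    exact Quiver.Hom.op_inj (congrArg Karoubi.Hom.f h)

lemma karoubiOp_additive [Preadditive A] [Preadditive B] [K.Additive] :
    (karoubiOp K).Additive where
  map_add {Y Z f g} := by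
    apply Karoubi.hom_ext
    exact congrArg Quiver.Hom.op (K.map_add (f := f.unop.f) (g := g.unop.f))

lemma karoubiOp_full [K.Full] [K.Faithful] : (karoubiOp K).Full where
  map_surjective {Y Z} f := by
    obtain ⟨f', hf'⟩ := K.map_surjective f.f.unop
    refine ⟨Quiver.Hom.op (⟨f', ?_⟩ : Z.unop ⟶ Y.unop), ?_⟩
    · apply K.map_injective
      have := congrArg Quiver.Hom.unop f.comm
      change (K.map Z.unop.p ≫ f.f.unop) ≫ K.map Y.unop.p = f.f.unop at this
      rw [K.map_comp, K.map_comp, hf']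
      exact (Category.assoc _ _ _).symm.trans this
    · apply Karoubi.hom_ext
      rw [karoubiOp_map_f]
      exact congrArg Quiver.Hom.op hf'

/-- The functor induced on idempotent completions is compatible with the embeddings. -/
def karoubiOpObjIso (X : A) : (karoubiOp K).obj (op ((toKaroubi A).obj X)) ≅
    (toKaroubi Bᵒᵖ).obj (op (K.obj X)) where
  hom := ⟨𝟙 _, by
    change (K.map (𝟙 X)).op ≫ 𝟙 _ ≫ 𝟙 _ = 𝟙 _
    simp⟩
  inv := ⟨𝟙 _, by
    change 𝟙 _ ≫ 𝟙 _ ≫ (K.map (𝟙 X)).op = 𝟙 _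
    simp⟩
  hom_inv_id := by
    apply Karoubi.hom_ext
    change 𝟙 _ ≫ 𝟙 _ = (K.map (𝟙 X)).op
    simp
  inv_hom_id := by
    apply Karoubi.hom_ext
    change 𝟙 _ ≫ 𝟙 _ = 𝟙 _
    simp

/-- The idempotent is conjugated by an isomorphism from an object in the image of `K` and lifted by
full faithfulness. The comparison maps carry a copy of the idempotent, as maps of the completion
must absorb it. -/
lemma karoubiOp_essSurj [K.IsEquivalence] : (karoubiOp K).EssSurj where
  mem_essImage Y := by
    let e : K.obj (K.objPreimage Y.X.unop) ≅ Y.X.unop := K.objObjPreimageIso _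
    let q := K.preimage (e.hom ≫ Y.p.unop ≫ e.inv)
    have hY : Y.p.unop ≫ Y.p.unop = Y.p.unop := congrArg Quiver.Hom.unop Y.idem
    have hq : K.map q = e.hom ≫ Y.p.unop ≫ e.inv := K.map_preimage _
    refine ⟨op ⟨_, q, ?_⟩, ⟨⟨⟨(Y.p.unop ≫ e.inv).op, ?_⟩, ⟨(e.hom ≫ Y.p.unop).op, ?_⟩, ?_, ?_⟩⟩⟩
    · apply K.map_injective
      rw [K.map_comp, hq]
      simp [reassoc_of% hY]
    · apply Quiver.Hom.unop_inj
      change (Y.p.unop ≫ Y.p.unop ≫ e.inv) ≫ K.map q = Y.p.unop ≫ e.inv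
      simp [hq, reassoc_of% hY]
    · apply Quiver.Hom.unop_inj
      change (K.map q ≫ e.hom ≫ Y.p.unop) ≫ Y.p.unop = e.hom ≫ Y.p.unop
      simp [hq, hY]
    · apply Karoubi.hom_ext
      apply Quiver.Hom.unop_inj
      change (e.hom ≫ Y.p.unop) ≫ Y.p.unop ≫ e.inv = K.map q
      simp [hq, reassoc_of% hY]
    · apply Karoubi.hom_ext
      apply Quiver.Hom.unop_inj
      change (Y.p.unop ≫ e.inv) ≫ e.hom ≫ Y.p.unop = Y.p.unop
      simp [hY]

lemma karoubiOp_isEquivalence [K.IsEquivalence] : (karoubiOp K).IsEquivalence where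
  faithful := karoubiOp_faithful K
  full := karoubiOp_full K
  essSurj := karoubiOp_essSurj K

variable {K}

/-- A retract diagram consists of commutative squares and split identities, so it survives any
functor that preserves the class; contravariance exchanges inclusions with projections and the two
ends of the sequence. -/
lemma isRetract_karoubiOp {S : SeqClass A} {T : SeqClass B} (hK : IsExactFunctor S T K)
    {X Y Z : (Karoubi A)ᵒᵖ} {f : X ⟶ Y} {g : Y ⟶ Z} (h : S.IsRetract g.unop f.unop) :
    T.op.IsRetract ((karoubiOp K).map f) ((karoubiOp K).map g) := by
  obtain ⟨A₀, A₁, A₂, x, y, i₀, r₀, i₁, r₁, i₂, r₂, hS, h₀, h₁, h₂, e₁, e₂, e₃, e₄⟩ := h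
  have t {X₁ X₂ X₃ : A} {a : X₁ ⟶ X₂} {b : X₂ ⟶ X₃} {c : X₁ ⟶ X₃} (h : a ≫ b = c) :
      K.map a ≫ K.map b = K.map c := by rw [← K.map_comp, h]
  have t' {X₁ X₂ X₃ X₂' : A} {a : X₁ ⟶ X₂} {b : X₂ ⟶ X₃} {c : X₁ ⟶ X₂'} {d : X₂' ⟶ X₃}
      (h : a ≫ b = c ≫ d) : K.map a ≫ K.map b = K.map c ≫ K.map d := by
    rw [← K.map_comp, h, K.map_comp]
  have q {X₁ X₂ : Karoubi A} {a b : X₁ ⟶ X₂} (h : a = b) : a.f = b.f := congrArg Karoubi.Hom.f h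
  refine ⟨op (K.obj A₂), op (K.obj A₁), op (K.obj A₀), (K.map y).op, (K.map x).op,
    (karoubiOp K).map r₂.op ≫ (karoubiOpObjIso K _).hom,
    (karoubiOpObjIso K _).inv ≫ (karoubiOp K).map i₂.op,
    (karoubiOp K).map r₁.op ≫ (karoubiOpObjIso K _).hom,
    (karoubiOpObjIso K _).inv ≫ (karoubiOp K).map i₁.op,
    (karoubiOp K).map r₀.op ≫ (karoubiOpObjIso K _).hom,
    (karoubiOpObjIso K _).inv ≫ (karoubiOp K).map i₀.op, hK _ _ hS, ?_, ?_, ?_, ?_, ?_, ?_, ?_⟩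
  · rw [Category.assoc, Iso.hom_inv_id_assoc, ← Functor.map_comp, ← op_comp, h₂, op_id]
    exact (karoubiOp K).map_id _
  · rw [Category.assoc, Iso.hom_inv_id_assoc, ← Functor.map_comp, ← op_comp, h₁, op_id]
    exact (karoubiOp K).map_id _
  · rw [Category.assoc, Iso.hom_inv_id_assoc, ← Functor.map_comp, ← op_comp, h₀, op_id]
    exact (karoubiOp K).map_id _
  all_goals
    apply Karoubi.hom_ext
    apply Quiver.Hom.unop_inj
  · change (𝟙 _ ≫ K.map r₁.f) ≫ K.map f.unop.f = K.map y ≫ 𝟙 _ ≫ K.map r₂.f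
    simpa using t' (q e₄)
  · change K.map f.unop.f ≫ K.map i₂.f ≫ 𝟙 _ = (K.map i₁.f ≫ 𝟙 _) ≫ K.map y
    simpa using t' (q e₃)
  · change (𝟙 _ ≫ K.map r₀.f) ≫ K.map g.unop.f = K.map x ≫ 𝟙 _ ≫ K.map r₁.f
    simpa using t' (q e₂)
  · change K.map g.unop.f ≫ K.map i₁.f ≫ 𝟙 _ = (K.map i₀.f ≫ 𝟙 _) ≫ K.map x
    simpa using t' (q e₁)

/-- The ambient sequence lives in the target, so it is first replaced by an isomorphic one in the
image of `K`; this is where closure of `T` under isomorphisms enters. The rest of the diagram lifts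
because `karoubiOp K` is fully faithful. -/
lemma isRetract_of_karoubiOp [K.IsEquivalence] {S : SeqClass A} {T : SeqClass B}
    (hT : T.IsoClosed)
    (hK : ∀ ⦃X Y Z : A⦄ (f : X ⟶ Y) (g : Y ⟶ Z), T (K.map f) (K.map g) → S f g)
    {X Y Z : (Karoubi A)ᵒᵖ} {f : X ⟶ Y} {g : Y ⟶ Z}
    (h : T.op.IsRetract ((karoubiOp K).map f) ((karoubiOp K).map g)) :
    S.IsRetract g.unop f.unop := by
  have := karoubiOp_faithful K
  have := karoubiOp_full K
  obtain ⟨B₀, B₁, B₂, x, y, i₀, r₀, i₁, r₁, i₂, r₂, hS, h₀, h₁, h₂, e₁, e₂, e₃, e₄⟩ := h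
  have key (D : Bᵒᵖ) : ∃ (D' : A), Nonempty (op (K.obj D') ≅ D) :=
    ⟨K.objPreimage D.unop, ⟨(K.objObjPreimageIso D.unop).symm.op⟩⟩
  obtain ⟨A₀, ⟨a₀⟩⟩ := key B₀
  obtain ⟨A₁, ⟨a₁⟩⟩ := key B₁
  obtain ⟨A₂, ⟨a₂⟩⟩ := key B₂
  obtain ⟨x', hx'⟩ := K.map_surjective (a₀.hom ≫ x ≫ a₁.inv).unop
  obtain ⟨y', hy'⟩ := K.map_surjective (a₁.hom ≫ y ≫ a₂.inv).unop
  have hx : a₀.inv ≫ (K.map x').op ≫ a₁.hom = x := by rw [hx']; simp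
  have hy : a₁.inv ≫ (K.map y').op ≫ a₂.hom = y := by rw [hy']; simp
  let c (D : A) (D' : Bᵒᵖ) (a : op (K.obj D) ≅ D') :
      (karoubiOp K).obj (op ((toKaroubi A).obj D)) ≅ (toKaroubi Bᵒᵖ).obj D' :=
    karoubiOpObjIso K D ≪≫ (toKaroubi _).mapIso a
  have hc {D D' : A} (d : D' ⟶ D) {G G' : Bᵒᵖ} (a : op (K.obj D) ≅ G) (a' : op (K.obj D') ≅ G') :
      (karoubiOp K).map ((toKaroubi A).map d).op ≫ (c _ _ a').hom =
        (c _ _ a).hom ≫ (toKaroubi _).map (a.inv ≫ (K.map d).op ≫ a'.hom) := by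
    apply Karoubi.hom_ext
    change (K.map d).op ≫ 𝟙 _ ≫ a'.hom = (𝟙 _ ≫ a.hom) ≫ a.inv ≫ (K.map d).op ≫ a'.hom
    simp
  have hc' {D D' : A} (d : D' ⟶ D) {G G' : Bᵒᵖ} (a : op (K.obj D) ≅ G) (a' : op (K.obj D') ≅ G') :
      (c _ _ a).inv ≫ (karoubiOp K).map ((toKaroubi A).map d).op =
        (toKaroubi _).map (a.inv ≫ (K.map d).op ≫ a'.hom) ≫ (c _ _ a').inv := by
    rw [Iso.inv_comp_eq, ← Category.assoc, Iso.eq_comp_inv, hc]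
  let P {W W' : (Karoubi A)ᵒᵖ} (m : (karoubiOp K).obj W ⟶ (karoubiOp K).obj W') :
    W ⟶ W' := (karoubiOp K).preimage m
  have hP {W W' : (Karoubi A)ᵒᵖ} (m : (karoubiOp K).obj W ⟶ (karoubiOp K).obj W') :
    (karoubiOp K).map (P m) = m := (karoubiOp K).map_preimage m
  refine ⟨A₂, A₁, A₀, y', x', (P ((c _ _ a₂).hom ≫ r₂)).unop, (P (i₂ ≫ (c _ _ a₂).inv)).unop,
    (P ((c _ _ a₁).hom ≫ r₁)).unop, (P (i₁ ≫ (c _ _ a₁).inv)).unop,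
    (P ((c _ _ a₀).hom ≫ r₀)).unop, (P (i₀ ≫ (c _ _ a₀).inv)).unop, hK _ _ ?_, ?_, ?_, ?_, ?_, ?_,
    ?_, ?_⟩
  · refine hT _ _ _ _ a₂.unop a₁.unop a₀.unop ?_ ?_ hS
    · rw [← hy]
      apply Quiver.Hom.op_inj
      simp
    · rw [← hx]
      apply Quiver.Hom.op_inj
      simp
  all_goals
    apply Quiver.Hom.op_inj
    apply (karoubiOp K).map_injective
    simp only [op_comp, Quiver.Hom.op_unop, op_id, Functor.map_comp, hP]
  · simp [h₂]
  · simp [h₁]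
  · simp [h₀]
  · rw [Category.assoc, e₄, reassoc_of% hc y' a₁ a₂, hy]
  · rw [reassoc_of% e₃, Category.assoc, hc' y' a₁ a₂, hy]
  · rw [Category.assoc, e₂, reassoc_of% hc x' a₀ a₁, hx]
  · rw [reassoc_of% e₁, Category.assoc, hc' x' a₀ a₁, hx]

end KaroubiOp

end KaroubiSeq

/-! ### Pointwise Kan extensions and idempotent completion -/

section KaroubiKan

open Idempotents

variable {C : Type*} [Category* C] {A : Type*} [Category* A] {B : Type*} [Category* B]
  {L : C ⥤ A} {H : C ⥤ B} (K : A ⥤ B) (α : H ⟶ L ⋙ K)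

/-- The extension to idempotent completions, restricted along `L`, maps to `H`. -/
def karoubiOpCounit : (L ⋙ toKaroubi A).op ⋙ karoubiOp K ⟶ H.op ⋙ toKaroubi Bᵒᵖ where
  app c := ⟨(α.app c.unop).op, by
    change (K.map (𝟙 (L.obj c.unop))).op ≫ (α.app c.unop).op ≫ 𝟙 _ = (α.app c.unop).op
    rw [Category.comp_id, ← op_comp, K.map_id]
    exact congrArg Quiver.Hom.op (Category.comp_id _)⟩
  naturality c d g := by
    apply Karoubi.hom_ext
    apply Quiver.Hom.unop_inj
    exact (α.naturality g.unop).symm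

lemma isIso_karoubiOpCounit [IsIso α] : IsIso (karoubiOpCounit K α) := by
  have (c : Cᵒᵖ) : IsIso ((karoubiOpCounit K α).app c) := by
    refine ⟨⟨⟨(inv (α.app c.unop)).op, ?_⟩, ?_, ?_⟩⟩
    · change 𝟙 _ ≫ (inv (α.app c.unop)).op ≫ (K.map (𝟙 (L.obj c.unop))).op = _
      rw [Category.id_comp, ← op_comp, K.map_id]
      exact congrArg Quiver.Hom.op (Category.id_comp _)
    · apply Karoubi.hom_ext
      apply Quiver.Hom.unop_inj
      change inv (α.app c.unop) ≫ α.app c.unop = K.map (𝟙 _)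
      simp
    · apply Karoubi.hom_ext
      apply Quiver.Hom.unop_inj
      exact IsIso.hom_inv_id (α.app c.unop)
  exact NatIso.isIso_of_isIso_app _

variable {K α}

section

variable (h : (Functor.LeftExtension.mk K α).IsPointwiseLeftKanExtension)
  {Y : (Karoubi A)ᵒᵖ} (s : Cone (StructuredArrow.proj Y (L ⋙ toKaroubi A).op ⋙
    H.op ⋙ toKaroubi Bᵒᵖ))

/-- The component of a cone at a morphism to the underlying object. -/
def karoubiConeLeg {c : C} (x : L.obj c ⟶ Y.unop.X) : H.obj c ⟶ s.pt.X.unop :=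
  (s.π.app (StructuredArrow.mk (Y := op c) (Quiver.Hom.op
    (⟨x ≫ Y.unop.p, by
      change 𝟙 _ ≫ (x ≫ Y.unop.p) ≫ Y.unop.p = _
      simp⟩ : (toKaroubi A).obj (L.obj c) ⟶ Y.unop)))).f.unop

/-- An arbitrary `x` is not a map to `Y` in the completion, so the leg is taken at `x` followed by
the idempotent, and a second copy of the idempotent changes nothing. -/
lemma karoubiConeLeg_comp_p {c : C} (x : L.obj c ⟶ Y.unop.X) :
    karoubiConeLeg s (x ≫ Y.unop.p) = karoubiConeLeg s x := by
  dsimp only [karoubiConeLeg]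
  congr 5
  simp

lemma karoubiConeLeg_comp {c : C} (x : L.obj c ⟶ Y.unop.X) :
    karoubiConeLeg s x ≫ s.pt.p.unop = karoubiConeLeg s x :=
  congrArg Quiver.Hom.unop (Karoubi.p_comp (s.π.app (StructuredArrow.mk (Y := op c) _)))

lemma map_comp_karoubiConeLeg {c d : C} (g : c ⟶ d) (x : L.obj d ⟶ Y.unop.X) :
    H.map g ≫ karoubiConeLeg s x = karoubiConeLeg s (L.map g ≫ x) := by
  have := s.w (StructuredArrow.homMk (f := StructuredArrow.mk (S := Y)
    (T := (L ⋙ toKaroubi A).op) (Y := op d) (Quiver.Hom.op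
    (⟨x ≫ Y.unop.p, by
      change 𝟙 _ ≫ (x ≫ Y.unop.p) ≫ Y.unop.p = _
      simp⟩ : (toKaroubi A).obj (L.obj d) ⟶ Y.unop)))
    (f' := StructuredArrow.mk (Y := op c) (Quiver.Hom.op
    (⟨(L.map g ≫ x) ≫ Y.unop.p, by
      change 𝟙 _ ≫ ((L.map g ≫ x) ≫ Y.unop.p) ≫ Y.unop.p = _
      simp⟩ : (toKaroubi A).obj (L.obj c) ⟶ Y.unop))) g.op (by
      apply Quiver.Hom.unop_inj
      apply Karoubi.hom_ext
      exact (Category.assoc _ _ _).symm))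
  exact congrArg (fun t => (Karoubi.Hom.f t).unop) this

/-- The cocone on the underlying objects attached to a cone. -/
def karoubiConeCocone : Cocone (CostructuredArrow.proj L Y.unop.X ⋙ H) where
  pt := s.pt.X.unop
  ι :=
    { app := fun x => karoubiConeLeg s x.hom
      naturality := fun x y g => by
        refine (map_comp_karoubiConeLeg s g.left y.hom).trans ?_
        rw [CostructuredArrow.w]
        exact (Category.comp_id _).symm }

/-- The map to the point of a cone induced by the pointwise Kan extension. -/
def karoubiConeDesc : K.obj Y.unop.X ⟶ s.pt.X.unop := (h Y.unop.X).desc (karoubiConeCocone s)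

lemma karoubiConeDesc_fac {c : C} (x : L.obj c ⟶ Y.unop.X) :
    α.app c ≫ K.map x ≫ karoubiConeDesc h s = karoubiConeLeg s x :=
  (Category.assoc _ _ _).symm.trans
    ((h Y.unop.X).fac (karoubiConeCocone s) (CostructuredArrow.mk x))

lemma karoubiConeDesc_comm :
    K.map Y.unop.p ≫ karoubiConeDesc h s ≫ s.pt.p.unop = karoubiConeDesc h s := by
  refine (h Y.unop.X).hom_ext' fun c x => ?_
  refine Eq.trans ?_ (karoubiConeDesc_fac h s x).symm
  have e := karoubiConeDesc_fac h s (x ≫ Y.unop.p)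
  rw [karoubiConeLeg_comp_p, K.map_comp, Category.assoc] at e
  have e' := e =≫ s.pt.p.unop
  rw [karoubiConeLeg_comp] at e'
  simp only [Category.assoc] at e'
  exact e'

end

variable (K α)

/-- If `K` is a pointwise left Kan extension of `H` along `L`, then the extension of `K` to the
idempotent completions is a pointwise right Kan extension of `Hᵒᵖ` along `Lᵒᵖ`. -/
def isPointwiseRightKanExtension_karoubiOp
    (h : (Functor.LeftExtension.mk K α).IsPointwiseLeftKanExtension) :
    (Functor.RightExtension.mk (karoubiOp K)
      (karoubiOpCounit K α)).IsPointwiseRightKanExtension := fun Y =>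
  { lift := fun s => ⟨(karoubiConeDesc h s).op, congrArg Quiver.Hom.op (by
      have := karoubiConeDesc_comm h s
      rw [← Category.assoc] at this
      exact this)⟩
    fac := fun s j => by
      apply Karoubi.hom_ext
      apply Quiver.Hom.unop_inj
      change (α.app j.right.unop ≫ K.map j.hom.unop.f) ≫ karoubiConeDesc h s = _
      rw [Category.assoc, karoubiConeDesc_fac, karoubiConeLeg]
      congr 3
      conv_rhs => rw [StructuredArrow.eq_mk j]
      congr 1
      apply Quiver.Hom.unop_inj
      apply Karoubi.hom_ext
      exact Karoubi.comp_p _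
    uniq := fun s m hm => by
      apply Karoubi.hom_ext
      apply Quiver.Hom.unop_inj
      refine (h Y.unop.X).hom_ext' fun c x => ?_
      refine Eq.trans ?_ (karoubiConeDesc_fac h s x).symm
      -- The cone only sees maps of the form `x ≫ p`. This is enough, since `m` absorbs `p` and is
      -- therefore determined on every `x`.
      have e := congrArg (fun t => (Karoubi.Hom.f t).unop) (hm (StructuredArrow.mk (Y := op c)
        (Quiver.Hom.op (⟨x ≫ Y.unop.p, by
          change 𝟙 _ ≫ (x ≫ Y.unop.p) ≫ Y.unop.p = _
          simp⟩ : (toKaroubi A).obj (L.obj c) ⟶ Y.unop))))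
      have e' : (α.app c ≫ K.map (x ≫ Y.unop.p)) ≫ m.f.unop = karoubiConeLeg s x := e
      have e'' : K.map Y.unop.p ≫ m.f.unop = m.f.unop :=
        congrArg Quiver.Hom.unop (Karoubi.comp_p m)
      have key (m' : K.obj Y.unop.X ⟶ s.pt.X.unop)
          (h₁ : (α.app c ≫ K.map (x ≫ Y.unop.p)) ≫ m' = karoubiConeLeg s x)
          (h₂ : K.map Y.unop.p ≫ m' = m') : α.app c ≫ K.map x ≫ m' = karoubiConeLeg s x := by
        rw [← h₁, K.map_comp, Category.assoc, Category.assoc, h₂]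
      exact key _ e' e'' }

end KaroubiKan

/-! ### Admissible Ind-objects as filtered unions of representables -/

section Presentation

variable {C : Type u} [Category.{v} C]

/-- Restriction of a section of a presheaf. -/
def res (P : Cᵒᵖ ⥤ AddCommGrpCat.{v}) {U V : C} (a : V ⟶ U) (s : P.obj (op U)) : P.obj (op V) :=
  P.map a.op s

section

variable (P : Cᵒᵖ ⥤ AddCommGrpCat.{v})

@[simp]
lemma res_id {U : C} (s : P.obj (op U)) : res P (𝟙 U) s = s := by
  change P.map (𝟙 (op U)) s = s
  rw [P.map_id]
  rfl

lemma res_comp {U V W : C} (b : W ⟶ V) (a : V ⟶ U) (s : P.obj (op U)) :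
    res P (b ≫ a) s = res P b (res P a s) := by
  change P.map (a.op ≫ b.op) s = _
  rw [P.map_comp]
  rfl

@[simp]
lemma res_add {U V : C} (a : V ⟶ U) (s t : P.obj (op U)) :
    res P a (s + t) = res P a s + res P a t := map_add _ _ _

@[simp]
lemma res_zero {U V : C} (a : V ⟶ U) : res P a (0 : P.obj (op U)) = 0 := map_zero _

lemma app_res {P Q : Cᵒᵖ ⥤ AddCommGrpCat.{v}} (f : P ⟶ Q) {U V : C} (a : V ⟶ U)
    (s : P.obj (op U)) : f.app (op V) (res P a s) = res Q a (f.app (op U) s) :=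
  ConcreteCategory.congr_hom (f.naturality a.op) s

lemma isIso_of_bijective_app {P Q : Cᵒᵖ ⥤ AddCommGrpCat.{v}} (f : P ⟶ Q)
    (h : ∀ U : C, Function.Bijective (f.app (op U))) : IsIso f := by
  have (U : Cᵒᵖ) : IsIso (f.app U) := (ConcreteCategory.isIso_iff_bijective _).2 (h U.unop)
  exact NatIso.isIso_of_isIso_app _

end

variable [Preadditive C]

lemma app_eq_res {P : Cᵒᵖ ⥤ AddCommGrpCat.{v}} {U W : C} (f : preadditiveYoneda.obj U ⟶ P)
    (a : W ⟶ U) : f.app (op W) a = res P a (f.app (op U) (𝟙 U)) := by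
  have := ConcreteCategory.congr_hom (f.naturality a.op) (𝟙 U)
  refine Eq.trans ?_ this
  change _ = f.app (op W) (a ≫ 𝟙 U)
  rw [Category.comp_id]

section

variable (P : Cᵒᵖ ⥤ AddCommGrpCat.{v}) [P.Additive]

lemma add_res {U V : C} (a b : V ⟶ U) (s : P.obj (op U)) :
    res P (a + b) s = res P a s + res P b s := by
  change P.map (a + b).op s = _
  rw [op_add, P.map_add]
  rfl

lemma zero_res {U V : C} (s : P.obj (op U)) : res P (0 : V ⟶ U) s = 0 := by
  change P.map (0 : V ⟶ U).op s = _
  rw [op_zero, P.map_zero]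
  rfl

/-- The map from a representable presheaf given by a section. -/
def ofSection {U : C} (s : P.obj (op U)) : preadditiveYoneda.obj U ⟶ P where
  app W := AddCommGrpCat.ofHom (AddMonoidHom.mk' (fun a : W.unop ⟶ U => res P a s)
    fun a b => add_res P a b s)
  naturality V W f := by
    apply AddCommGrpCat.ext
    intro (a : V.unop ⟶ U)
    exact res_comp P f.unop a s

variable {P}

lemma ofSection_app_id {U : C} (f : preadditiveYoneda.obj U ⟶ P) :
    ofSection P (f.app (op U) (𝟙 U)) = f := by
  apply NatTrans.ext
  funext W
  apply AddCommGrpCat.ext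
  intro (a : W.unop ⟶ U)
  exact (app_eq_res f a).symm

end

/-- A presentation of a presheaf as the filtered union of the presheaves represented by a
diagram. -/
structure IndPres (E : ExactStructure C) (κ : WithTop Cardinal.{v})
    (P : Cᵒᵖ ⥤ AddCommGrpCat.{v}) where
  /-- the index poset -/
  I : Type v
  [order : PartialOrder I]
  /-- the diagram -/
  X : I ⥤ C
  adm : E.IsAdmissibleIndDiagram κ X
  /-- the universal sections -/
  ξ : ∀ i, P.obj (op (X.obj i))
  compat : ∀ {i j : I} (a : i ⟶ j), res P (X.map a) (ξ j) = ξ i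
  surj : ∀ {U : C} (s : P.obj (op U)), ∃ (i : I) (a : U ⟶ X.obj i), s = res P a (ξ i)
  inj : ∀ {U : C} {i : I} (a b : U ⟶ X.obj i), res P a (ξ i) = res P b (ξ i) → a = b
  additive : P.Additive

attribute [instance] IndPres.order

variable {E : ExactStructure C} {κ : WithTop Cardinal.{v}}

lemma ExactStructure.mono_of_admMono (E : ExactStructure C) {X Y : C} {f : X ⟶ Y}
    (h : E.conf.AdmMono f) : Mono f := by
  obtain ⟨Z, g, h⟩ := h
  obtain ⟨w, ⟨h₁⟩, -⟩ := E.isKernelCokernelPair f g h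
  exact mono_of_isLimit_fork h₁

lemma ExactStructure.epi_of_admEpi (E : ExactStructure C) {X Y : C} {f : X ⟶ Y}
    (h : E.conf.AdmEpi f) : Epi f := by
  obtain ⟨Z, g, h⟩ := h
  obtain ⟨w, -, ⟨h₁⟩⟩ := E.isKernelCokernelPair g f h
  exact epi_of_isColimit_cofork h₁

lemma ExactStructure.exists_lift (E : ExactStructure C) {X Y Z W : C} {f : X ⟶ Y} {g : Y ⟶ Z}
    (h : E.conf f g) (k : W ⟶ Y) (hk : k ≫ g = 0) : ∃ l : W ⟶ X, l ≫ f = k := by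
  obtain ⟨w, ⟨h₁⟩, -⟩ := E.isKernelCokernelPair f g h
  obtain ⟨l, hl⟩ := KernelFork.IsLimit.lift' h₁ k hk
  exact ⟨l, hl⟩

lemma ExactStructure.exists_desc (E : ExactStructure C) {X Y Z W : C} {f : X ⟶ Y} {g : Y ⟶ Z}
    (h : E.conf f g) (k : Y ⟶ W) (hk : f ≫ k = 0) : ∃ l : Z ⟶ W, g ≫ l = k := by
  obtain ⟨w, -, ⟨h₁⟩⟩ := E.isKernelCokernelPair f g h
  obtain ⟨l, hl⟩ := CokernelCofork.IsColimit.desc' h₁ k hk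
  exact ⟨l, hl⟩

lemma ExactStructure.conf_comp (E : ExactStructure C) {X Y Z : C} {f : X ⟶ Y} {g : Y ⟶ Z}
    (h : E.conf f g) : f ≫ g = 0 := (E.isKernelCokernelPair f g h).1

namespace IndPres

section

variable {P : Cᵒᵖ ⥤ AddCommGrpCat.{v}} (p : IndPres E κ P)

-- Sections and relations both descend to a stage: a section is a map to some `X i`, and by
-- injectivity it vanishes only if that map does. Left exactness is thus the cokernel property of
-- conflations in `C`.
include p in
lemma isLex : E.IsLex P := by
  have := p.additive
  intro X Y Z f g h
  have hg := E.epi_of_admEpi ⟨_, _, h⟩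
  refine ⟨?_, fun t => ⟨fun ht => ?_, ?_⟩⟩
  · rw [injective_iff_map_eq_zero]
    intro (s : P.obj (op Z)) (hs : res P g s = 0)
    obtain ⟨i, a, rfl⟩ := p.surj s
    have : g ≫ a = 0 := p.inj _ _ (by rw [res_comp, hs, zero_res])
    rw [← comp_zero (f := g), cancel_epi] at this
    rw [this, zero_res]
  · change P.obj (op Y) at t
    change res P f t = 0 at ht
    obtain ⟨i, a, rfl⟩ := p.surj t
    have : f ≫ a = 0 := p.inj _ _ (by rw [res_comp, ht, zero_res])
    obtain ⟨l, hl⟩ := E.exists_desc h a this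
    exact ⟨res P l (p.ξ i), by rw [← hl, res_comp]; rfl⟩
  · rintro ⟨s, rfl⟩
    change P.obj (op Z) at s
    change res P f (res P g s) = 0
    rw [← res_comp, E.conf_comp h, zero_res]

include p in
lemma surj₂ {U V : C} (s : P.obj (op U)) (t : P.obj (op V)) :
    ∃ (i : p.I) (a : U ⟶ p.X.obj i) (b : V ⟶ p.X.obj i), s = res P a (p.ξ i) ∧
      t = res P b (p.ξ i) := by
  obtain ⟨i, a, rfl⟩ := p.surj s
  obtain ⟨j, b, rfl⟩ := p.surj t
  obtain ⟨k, hi, hj⟩ := p.adm.directed.directed i j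
  refine ⟨k, a ≫ p.X.map (homOfLE hi), b ≫ p.X.map (homOfLE hj), ?_, ?_⟩ <;>
  rw [res_comp, p.compat]

lemma surj_ge (i : p.I) {U : C} (s : P.obj (op U)) :
    ∃ (j : p.I) (h : i ⟶ j) (a : U ⟶ p.X.obj j), s = res P a (p.ξ j) := by
  obtain ⟨j, a, rfl⟩ := p.surj s
  obtain ⟨k, hi, hj⟩ := p.adm.directed.directed i j
  exact ⟨k, homOfLE hi, a ≫ p.X.map (homOfLE hj), by rw [res_comp, p.compat]⟩

lemma eq_zero {U : C} {i : p.I} (a : U ⟶ p.X.obj i) (h : res P a (p.ξ i) = 0) : a = 0 :=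
  have := p.additive
  p.inj _ _ (by rw [h, zero_res])

include p in
lemma hom_ext {Q : Cᵒᵖ ⥤ AddCommGrpCat.{v}} {f g : P ⟶ Q}
    (h : ∀ i, f.app _ (p.ξ i) = g.app _ (p.ξ i)) : f = g := by
  apply NatTrans.ext
  funext U
  apply AddCommGrpCat.ext
  intro (s : P.obj (op U.unop))
  obtain ⟨i, a, rfl⟩ := p.surj s
  exact (app_res f a _).trans ((congrArg (res Q a) (h i)).trans (app_res g a _).symm)

/-- Transport of a presentation along an isomorphism. -/
def ofIso {Q : Cᵒᵖ ⥤ AddCommGrpCat.{v}} (e : P ≅ Q) : IndPres E κ Q where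
  I := p.I
  X := p.X
  adm := p.adm
  ξ i := e.hom.app _ (p.ξ i)
  compat a := by rw [← app_res, p.compat]
  surj {U} s := by
    obtain ⟨i, a, ha⟩ := p.surj (e.inv.app (op U) s)
    refine ⟨i, a, ?_⟩
    rw [← app_res, ← ha, ← ConcreteCategory.comp_apply, ← NatTrans.comp_app, e.inv_hom_id]
    rfl
  inj {U i} a b h := by
    refine p.inj a b ?_
    rw [← app_res, ← app_res] at h
    have := congrArg (e.inv.app (op U)) h
    rw [← ConcreteCategory.comp_apply, ← ConcreteCategory.comp_apply, ← NatTrans.comp_app,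
      e.hom_inv_id] at this
    exact this
  additive := ⟨fun {U V a b} => by
    have := p.additive
    have h (x : U ⟶ V) : Q.map x = e.inv.app U ≫ P.map x ≫ e.hom.app V := by simp
    rw [h, h, h, P.map_add]
    simp⟩

/-- The cocone of representable presheaves of a presentation. -/
def cocone : Cocone (p.X ⋙ preadditiveYoneda) :=
  have := p.additive
  {
  pt := P
  ι :=
    { app := fun i => ofSection P (p.ξ i)
      naturality := fun i j a => by
        apply NatTrans.ext
        funext W
        apply AddCommGrpCat.ext
        intro (b : W.unop ⟶ p.X.obj i)
        change res P (b ≫ p.X.map a) (p.ξ j) = res P b (p.ξ i)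
        rw [res_comp, p.compat] } }

end

section OfIsColimit

variable {I : Type v} [PartialOrder I] {X : I ⥤ C} (hX : E.IsAdmissibleIndDiagram κ X)
  {c : Cocone (X ⋙ preadditiveYoneda)} (hc : IsColimit c)

/-- The presentation given by a colimit cocone. -/
def ofIsColimit : IndPres E κ c.pt where
  I := I
  X := X
  adm := hX
  ξ i := (c.ι.app i).app (op (X.obj i)) (𝟙 (X.obj i))
  compat {i j} a := by
    have h := ConcreteCategory.congr_hom (NatTrans.congr_app (c.w a) (op (X.obj i)))
      (𝟙 (X.obj i))
    refine (app_eq_res (U := X.obj j) (c.ι.app j) (X.map a)).symm.trans (Eq.trans ?_ h)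
    exact congrArg ((c.ι.app j).app (op (X.obj i))) (Category.id_comp (X.map a)).symm
  surj {U} s := by
    have := hX.nonempty
    have := hX.directed
    obtain ⟨i, a, ha⟩ := Concrete.isColimit_exists_rep _
      (isColimitOfPreserves ((evaluation _ _).obj (op U)) hc) s
    exact ⟨i, a, ha.symm.trans (app_eq_res (U := X.obj i) (c.ι.app i) a)⟩
  inj {U i} a b h := by
    have := hX.nonempty
    have := hX.directed
    have h' : (c.ι.app i).app (op U) a = (c.ι.app i).app (op U) b :=
      (app_eq_res (U := X.obj i) (c.ι.app i) a).trans
        (h.trans (app_eq_res (U := X.obj i) (c.ι.app i) b).symm)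
    obtain ⟨j, f, g, e⟩ := Concrete.isColimit_exists_of_rep_eq _
      (isColimitOfPreserves ((evaluation _ _).obj (op U)) hc) (i := i) (j := i) a b h'
    obtain rfl : f = g := Subsingleton.elim _ _
    have e' : a ≫ X.map f = b ≫ X.map f := e
    -- Two maps that agree in the colimit agree at a later stage, and the transition map to that
    -- stage is monic.
    have := E.mono_of_admMono (hX.admMono f)
    exact (cancel_mono _).1 e'
  additive := ⟨fun {U V a b} => by
    have := hX.nonempty
    have := hX.directed
    apply AddCommGrpCat.ext
    intro s
    obtain ⟨i, t, rfl⟩ := Concrete.isColimit_exists_rep _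
      (isColimitOfPreserves ((evaluation _ _).obj U) hc) s
    have n (x : U ⟶ V) := ConcreteCategory.congr_hom ((c.ι.app i).naturality x) t
    change c.pt.map (a + b) ((c.ι.app i).app U t) = c.pt.map a ((c.ι.app i).app U t) +
      c.pt.map b ((c.ι.app i).app U t)
    refine (n _).symm.trans (Eq.trans ?_ (congrArg₂ (· + ·) (n a) (n b)))
    refine Eq.trans ?_ (map_add ((c.ι.app i).app V).hom _ _)
    refine congrArg ((c.ι.app i).app V) ?_
    exact Preadditive.add_comp _ _ _ a.unop b.unop (show U.unop ⟶ X.obj i from t)⟩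

end OfIsColimit

variable {P : Cᵒᵖ ⥤ AddCommGrpCat.{v}} (p : IndPres E κ P)

/-- The colimit has a presentation by the same diagram, and the comparison map matches the universal
sections. Since sections and their equality are described by the diagram alone, it is bijective. -/
lemma isIso_desc_cocone {c : Cocone (p.X ⋙ preadditiveYoneda)} (hc : IsColimit c) :
    IsIso (hc.desc p.cocone) := by
  let q : IndPres E κ c.pt := ofIsColimit p.adm hc
  let f : c.pt ⟶ P := hc.desc p.cocone
  have hq (i : p.I) : f.app _ (q.ξ i) = p.ξ i := by
    have := NatTrans.congr_app (hc.fac p.cocone i) (op (p.X.obj i))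
    exact (ConcreteCategory.congr_hom this (𝟙 (p.X.obj i))).trans (res_id P (p.ξ i))
  have hq' (i : p.I) {U : C} (a : U ⟶ p.X.obj i) :
      f.app (op U) (res c.pt a (q.ξ i)) = res P a (p.ξ i) :=
    (app_res f a (q.ξ i)).trans (congrArg (res P a) (hq i))
  refine isIso_of_bijective_app f fun U => ⟨?_, fun s => ?_⟩
  · rw [injective_iff_map_eq_zero]
    intro s hs
    obtain ⟨i, a, rfl⟩ := q.surj s
    have ha : a = 0 := p.eq_zero (i := i) a ((hq' i a).symm.trans hs)
    have := q.additive
    rw [ha, zero_res]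
  · obtain ⟨i, a, rfl⟩ := p.surj s
    exact ⟨_, hq' i a⟩

/-- The presentation exhibits the presheaf as a colimit of representable presheaves. -/
def isColimitCocone : IsColimit p.cocone :=
  have := p.isIso_desc_cocone (colimit.isColimit _)
  IsColimit.ofPointIso (colimit.isColimit _)

include p in
lemma isIndObject : E.IsIndObject κ P :=
  ⟨p.isLex, p.I, p.order, p.X, p.adm,
    ⟨p.isColimitCocone.coconePointUniqueUpToIso (colimit.isColimit _)⟩⟩

end IndPres

lemma nonempty_indPres {P : Cᵒᵖ ⥤ AddCommGrpCat.{v}} (h : E.IsIndObject κ P) :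
    Nonempty (IndPres E κ P) := by
  obtain ⟨-, I, _, X, hX, ⟨e⟩⟩ := h
  exact ⟨(IndPres.ofIsColimit hX (colimit.isColimit _)).ofIso e.symm⟩

lemma isIndObject_colimit {I : Type v} [PartialOrder I] {X : I ⥤ C}
    (hX : E.IsAdmissibleIndDiagram κ X) :
    E.IsIndObject κ (colimit (X ⋙ preadditiveYoneda)) :=
  (IndPres.ofIsColimit hX (colimit.isColimit _)).isIndObject

/-- A chosen presentation of an admissible Ind-object. -/
def Ind.pres (P : Ind E κ) : IndPres E κ P.obj := (nonempty_indPres P.property).some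

instance (P : Ind E κ) : P.obj.Additive := P.pres.additive

end Presentation

/-! ### Consequences of Quillen's axioms -/

section ExactStructureLemmas

variable {C : Type u₁} [Category.{v} C] [Preadditive C] (E : ExactStructure C)

namespace ExactStructure

lemma conf_of_isColimit {X Y Z : C} {f : X ⟶ Y} {g : Y ⟶ Z} (h : E.conf.AdmMono f)
    (w : f ≫ g = 0) (hc : IsColimit (CokernelCofork.ofπ g w)) : E.conf f g := by
  obtain ⟨Z', g', h⟩ := h
  obtain ⟨w', -, ⟨hc'⟩⟩ := E.isKernelCokernelPair f g' h
  refine E.of_iso _ _ _ _ (Iso.refl X) (Iso.refl Y) (hc'.coconePointUniqueUpToIso hc)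
    (by simp) ?_ h
  rw [Iso.refl_hom, Category.id_comp]
  exact hc'.comp_coconePointUniqueUpToIso_hom hc WalkingParallelPair.one

lemma admMono_of_iso {X Y Y' : C} {f : X ⟶ Y} (h : E.conf.AdmMono f) (e : Y ≅ Y') :
    E.conf.AdmMono (f ≫ e.hom) := by
  obtain ⟨Z, g, h⟩ := h
  exact ⟨Z, e.inv ≫ g, E.of_iso _ _ _ _ (Iso.refl X) e (Iso.refl Z) (by simp) (by simp) h⟩

lemma admEpi_of_iso {X X' Y : C} {f : X ⟶ Y} (h : E.conf.AdmEpi f) (e : X' ≅ X) :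
    E.conf.AdmEpi (e.hom ≫ f) := by
  obtain ⟨Z, g, h⟩ := h
  exact ⟨Z, g ≫ e.inv, E.of_iso _ _ _ _ (Iso.refl Z) e.symm (Iso.refl Y) (by simp) (by simp) h⟩

/-- The kernel of an identity is zero; in this way the axioms themselves supply a zero object. -/
lemma exists_conf_id (Y : C) : ∃ (Z : C) (f : Z ⟶ Y), IsZero Z ∧ E.conf f (𝟙 Y) := by
  obtain ⟨Z, f, h⟩ := E.id_admEpi Y
  refine ⟨Z, f, ?_, h⟩
  have h₀ := E.conf_comp h
  rw [Category.comp_id] at h₀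
  have := E.mono_of_admMono ⟨_, _, h⟩
  rw [IsZero.iff_id_eq_zero, ← cancel_mono f, h₀]
  simp

variable [HasBinaryBiproducts C]

/-- The pushout of `0 ⟶ Y` along `0 ⟶ X` is the biproduct, so the inclusion of `X` is a pushout of
an admissible monic. -/
lemma conf_inl_snd (X Y : C) : E.conf (biprod.inl : X ⟶ X ⊞ Y) biprod.snd := by
  obtain ⟨Z, f, hZ, h⟩ := E.exists_conf_id Y
  obtain ⟨Y', a', f', hp, hf'⟩ := E.pushout f (0 : Z ⟶ X) ⟨_, _, h⟩
  let e : Y' ≅ X ⊞ Y :=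
    { hom := hp.desc biprod.inr biprod.inl (hZ.eq_of_src _ _)
      inv := biprod.desc f' a'
      hom_inv_id := by apply hp.hom_ext <;> simp
      inv_hom_id := by ext <;> simp }
  have he : f' ≫ e.hom = biprod.inl := hp.inr_desc _ _ _
  refine E.conf_of_isColimit (he ▸ E.admMono_of_iso hf' e) (by simp) ?_
  exact CokernelCofork.IsColimit.ofπ' _ _ fun {W} k hk => ⟨biprod.inr ≫ k, by
    ext
    · simpa using hk.symm
    · simp⟩

lemma admEpi_fst (X Y : C) : E.conf.AdmEpi (biprod.fst : X ⊞ Y ⟶ X) := by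
  have := E.admEpi_of_iso ⟨_, _, E.conf_inl_snd Y X⟩ (biprod.braiding X Y)
  simpa using this

/-- The pullback of `q` along `(1, -b)` consists of `v` and `(z, y)` with `q v = z - b y`, so it is
`V ⊞ Y` with `z = q v + b y`. The map `(q, b)` is then a pullback of `q` followed by the projection
to `Z`, a composite of admissible epics. -/
lemma admEpi_desc {V Y Z : C} {q : V ⟶ Z} (hq : E.conf.AdmEpi q) (b : Y ⟶ Z) :
    E.conf.AdmEpi (biprod.desc q b) := by
  obtain ⟨P, a', g', hp, hg'⟩ := E.pullback q (biprod.desc (𝟙 Z) (-b)) hq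
  have w : a' ≫ q = g' ≫ biprod.desc (𝟙 Z) (-b) := hp.w
  have w' : g' = biprod.lift (a' ≫ q + g' ≫ biprod.snd ≫ b) (g' ≫ biprod.snd) := by
    rw [w]
    ext
    · simp [biprod.desc_eq]
    · simp
  let e : V ⊞ Y ≅ P :=
    { hom := hp.lift biprod.fst (biprod.lift (biprod.desc q b) biprod.snd) (by
        ext <;> simp)
      inv := biprod.lift a' (g' ≫ biprod.snd)
      hom_inv_id := by
        ext <;> simp
      inv_hom_id := by
        apply hp.hom_ext
        · simp
        · rw [Category.assoc, hp.lift_snd, Category.id_comp]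
          conv_rhs => rw [w']
          ext
          · simp [biprod.lift_desc]
          · simp }
  have := E.admEpi_of_iso (E.comp_admEpi _ _ hg' (E.admEpi_fst Z Y)) e
  have he : e.hom ≫ g' ≫ biprod.fst = biprod.desc q b := by
    rw [← Category.assoc, hp.lift_snd, biprod.lift_fst]
  rwa [he] at this

end ExactStructure

end ExactStructureLemmas

/-! ### Exact functors are additive -/

section ExactFunctor

variable {C : Type u₁} [Category.{v} C] [Preadditive C] [HasBinaryBiproducts C]
  {D : Type u₂} [Category.{w} D] [Preadditive D]
  {EC : ExactStructure C} {ED : ExactStructure D} {G : C ⥤ D}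

lemma IsExactFunctor.map_zero (hG : IsExactFunctor EC.conf ED.conf G) (X Y : C) :
    G.map (0 : X ⟶ Y) = 0 := by
  obtain ⟨Z, f, hZ, h⟩ := EC.exists_conf_id Y
  have hf := ED.conf_comp (hG _ _ h)
  rw [G.map_id, Category.comp_id] at hf
  have : (0 : X ⟶ Y) = (0 : X ⟶ Z) ≫ f := by simp
  rw [this, G.map_comp, hf, comp_zero]

/-- The defect `t` in the identity kills the image of `inl`, so by exactness it factors through the
image of `snd`. That map is split by the image of `inr`, which `t` kills as well. -/
lemma IsExactFunctor.map_total (hG : IsExactFunctor EC.conf ED.conf G) (X Y : C) :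
    G.map biprod.fst ≫ G.map (biprod.inl : X ⟶ X ⊞ Y) +
      G.map biprod.snd ≫ G.map (biprod.inr : Y ⟶ X ⊞ Y) = 𝟙 _ := by
  have hz := hG.map_zero
  have h := hG _ _ (EC.conf_inl_snd X Y)
  let t := 𝟙 (G.obj (X ⊞ Y)) - (G.map biprod.fst ≫ G.map (biprod.inl : X ⟶ X ⊞ Y) +
      G.map biprod.snd ≫ G.map (biprod.inr : Y ⟶ X ⊞ Y))
  have ht : G.map (biprod.inl : X ⟶ X ⊞ Y) ≫ t = 0 := by
    simp only [t, Preadditive.comp_sub, Preadditive.comp_add, ← Category.assoc, ← G.map_comp]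
    simp [hz]
  obtain ⟨l, hl⟩ := ED.exists_desc h t ht
  have hl' : l = 0 := by
    have e : G.map (biprod.inr : Y ⟶ X ⊞ Y) ≫ t = l := by
      rw [← hl, ← Category.assoc, ← G.map_comp]
      simp
    rw [← e]
    simp only [t, Preadditive.comp_sub, Preadditive.comp_add, ← Category.assoc, ← G.map_comp]
    simp [hz]
  rw [hl', comp_zero] at hl
  exact (sub_eq_zero.1 hl.symm).symm

/-- A sum is the composite of `(f, g)` with the codiagonal; inserting the decomposed identity of the
image of `Y ⊞ Y` between the two factors separates the summands. -/
lemma IsExactFunctor.additive (hG : IsExactFunctor EC.conf ED.conf G) : G.Additive where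
  map_add {X Y f g} := by
    have e : f + g = biprod.lift f g ≫ biprod.desc (𝟙 Y) (𝟙 Y) := by simp [biprod.lift_desc]
    rw [e, G.map_comp, ← Category.comp_id (G.map (biprod.lift f g)), ← hG.map_total Y Y]
    simp only [Preadditive.comp_add, Preadditive.add_comp, Category.assoc, ← G.map_comp]
    simp

end ExactFunctor

/-! ### Maps from objects of the category to Ind-objects -/

section IndHom

variable {C : Type u} [Category.{v} C] [Preadditive C] {E : ExactStructure C}
  {κ : WithTop Cardinal.{v}} (hκ : ((Cardinal.aleph0 : Cardinal.{v}) : WithTop Cardinal.{v}) ≤ κ)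

/-- The map from an object given by a section of an admissible Ind-object. -/
def Ind.ofSection (P : Ind E κ) {U : C} (s : P.obj.obj (op U)) : (Ind.incl E κ hκ).obj U ⟶ P :=
  ObjectProperty.homMk (AdmInd.ofSection P.obj s)

/-- The section given by a map from an object to an admissible Ind-object. -/
def Ind.toSection {P : Ind E κ} {U : C} (f : (Ind.incl E κ hκ).obj U ⟶ P) : P.obj.obj (op U) :=
  f.hom.app (op U) (𝟙 U)

@[simp]
lemma Ind.toSection_ofSection (P : Ind E κ) {U : C} (s : P.obj.obj (op U)) :
    Ind.toSection hκ (Ind.ofSection hκ P s) = s := res_id P.obj s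

@[simp]
lemma Ind.ofSection_toSection {P : Ind E κ} {U : C} (f : (Ind.incl E κ hκ).obj U ⟶ P) :
    Ind.ofSection hκ P (Ind.toSection hκ f) = f :=
  ObjectProperty.hom_ext _ (ofSection_app_id (P := P.obj) f.hom)

lemma Ind.toSection_injective {P : Ind E κ} {U : C} {f g : (Ind.incl E κ hκ).obj U ⟶ P}
    (h : Ind.toSection hκ f = Ind.toSection hκ g) : f = g := by
  rw [← Ind.ofSection_toSection hκ f, h, Ind.ofSection_toSection]

lemma Ind.toSection_comp {P Q : Ind E κ} {U : C} (f : (Ind.incl E κ hκ).obj U ⟶ P) (g : P ⟶ Q) :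
    Ind.toSection hκ (f ≫ g) = g.hom.app (op U) (Ind.toSection hκ f) := rfl

lemma Ind.toSection_map_comp {P : Ind E κ} {U V : C} (a : V ⟶ U)
    (f : (Ind.incl E κ hκ).obj U ⟶ P) :
    Ind.toSection hκ ((Ind.incl E κ hκ).map a ≫ f) = res P.obj a (Ind.toSection hκ f) := by
  refine Eq.trans ?_ (app_eq_res (P := P.obj) f.hom a)
  exact congrArg (f.hom.app (op V)) (Category.id_comp a)

lemma Ind.ofSection_comp {P Q : Ind E κ} {U : C} (s : P.obj.obj (op U)) (g : P ⟶ Q) :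
    Ind.ofSection hκ P s ≫ g = Ind.ofSection hκ Q (g.hom.app (op U) s) := by
  apply Ind.toSection_injective
  rw [Ind.toSection_comp, Ind.toSection_ofSection, Ind.toSection_ofSection]

lemma Ind.map_comp_ofSection {P : Ind E κ} {U V : C} (a : V ⟶ U) (s : P.obj.obj (op U)) :
    (Ind.incl E κ hκ).map a ≫ Ind.ofSection hκ P s = Ind.ofSection hκ P (res P.obj a s) := by
  apply Ind.toSection_injective
  rw [Ind.toSection_map_comp, Ind.toSection_ofSection, Ind.toSection_ofSection]

lemma Ind.hom_ext {P Q : Ind E κ} (p : IndPres E κ P.obj) {f g : P ⟶ Q}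
    (h : ∀ i, f.hom.app _ (p.ξ i) = g.hom.app _ (p.ξ i)) : f = g :=
  ObjectProperty.hom_ext _ (p.hom_ext h)

instance : (Ind.incl E κ hκ).Faithful where
  map_injective {U V f g} h := by
    have := congrArg (Ind.toSection hκ) h
    change 𝟙 U ≫ f = 𝟙 U ≫ g at this
    simpa using this

instance : (Ind.incl E κ hκ).Full where
  map_surjective {U V} f := ⟨Ind.toSection hκ f, by
    apply Ind.toSection_injective hκ
    exact Category.id_comp (Ind.toSection hκ f)⟩

variable {P : Ind E κ} (p : IndPres E κ P.obj)

/-- The cocone of objects over an admissible Ind-object given by a presentation. -/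
def IndPres.indCocone : Cocone (p.X ⋙ Ind.incl E κ hκ) where
  pt := P
  ι :=
    { app := fun i => Ind.ofSection hκ P (p.ξ i)
      naturality := fun i j a => by
        refine (Ind.map_comp_ofSection hκ (p.X.map a) (p.ξ j)).trans ?_
        rw [p.compat]
        exact (Category.comp_id _).symm }

/-- An admissible Ind-object is the colimit of its presentation. -/
def IndPres.isColimitIndCocone : IsColimit (p.indCocone hκ) where
  desc s := ObjectProperty.homMk (p.isColimitCocone.desc ((E.IsIndObject κ).ι.mapCocone s))
  fac s i := ObjectProperty.hom_ext _
    (p.isColimitCocone.fac ((E.IsIndObject κ).ι.mapCocone s) i)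
  uniq s m hm := ObjectProperty.hom_ext _
    (p.isColimitCocone.uniq ((E.IsIndObject κ).ι.mapCocone s) m.hom
      fun i => congrArg (fun t => t.hom) (hm i))

/-- The functor from the index poset of a presentation to the category of objects over an
admissible Ind-object. -/
def IndPres.toCostructuredArrow : p.I ⥤ CostructuredArrow (Ind.incl E κ hκ) P where
  obj i := CostructuredArrow.mk (Y := p.X.obj i) (Ind.ofSection hκ P (p.ξ i))
  map {i j} a := CostructuredArrow.homMk (p.X.map a) (by
    refine (Ind.map_comp_ofSection hκ (p.X.map a) (p.ξ j)).trans ?_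
    rw [p.compat]
    rfl)
  map_id i := by
    apply CostructuredArrow.hom_ext
    exact p.X.map_id i
  map_comp f g := by
    apply CostructuredArrow.hom_ext
    exact p.X.map_comp f g

/-- Surjectivity of the presentation provides an arrow from each object over `P` to a stage.
Injectivity makes two arrows to the same stage equal at once, without passing to a later one. -/
lemma IndPres.final_toCostructuredArrow : (p.toCostructuredArrow hκ).Final := by
  have := p.adm.nonempty
  have := p.adm.directed
  apply Functor.final_of_exists_of_isFiltered
  · intro d
    obtain ⟨i, a, ha⟩ := p.surj (Ind.toSection hκ d.hom)
    refine ⟨i, ⟨CostructuredArrow.homMk a ?_⟩⟩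
    apply Ind.toSection_injective
    refine (Ind.toSection_map_comp hκ a _).trans ?_
    rw [ha]
    exact congrArg (res P.obj a) (Ind.toSection_ofSection hκ P (p.ξ i))
  · intro d i s s'
    refine ⟨i, 𝟙 i, ?_⟩
    have : s = s' := by
      apply CostructuredArrow.hom_ext
      have h := (CostructuredArrow.w s).trans (CostructuredArrow.w s').symm
      have h' := congrArg (Ind.toSection hκ) h
      rw [Ind.toSection_map_comp, Ind.toSection_map_comp] at h'
      refine p.inj _ _ ?_
      refine Eq.trans ?_ (h'.trans ?_)
      · exact congrArg (res P.obj s.left) (Ind.toSection_ofSection hκ P (p.ξ i)).symm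
      · exact congrArg (res P.obj s'.left) (Ind.toSection_ofSection hκ P (p.ξ i))
    rw [this]

end IndHom

/-! ### Colimits of admissible diagrams in Ind-objects -/

section IndColimit

variable {C : Type u} [Category.{v} C] [Preadditive C] {E : ExactStructure C}
  {κ : WithTop Cardinal.{v}} (hκ : ((Cardinal.aleph0 : Cardinal.{v}) : WithTop Cardinal.{v}) ≤ κ)
  {I : Type v} [PartialOrder I] {X : I ⥤ C}

/-- The colimit of an admissible Ind-diagram. -/
def indColimit (hX : E.IsAdmissibleIndDiagram κ X) : Ind E κ :=
  ⟨colimit (X ⋙ preadditiveYoneda), isIndObject_colimit hX⟩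

/-- The presentation of the colimit of an admissible Ind-diagram. -/
def indColimitPres (hX : E.IsAdmissibleIndDiagram κ X) : IndPres E κ (indColimit hX).obj :=
  IndPres.ofIsColimit hX (colimit.isColimit _)

lemma hasColimit_comp_incl (hX : E.IsAdmissibleIndDiagram κ X) :
    HasColimit (X ⋙ Ind.incl E κ hκ) :=
  ⟨⟨_, (indColimitPres hX).isColimitIndCocone hκ⟩⟩

variable (hX : E.IsAdmissibleIndDiagram κ X) {c : Cocone (X ⋙ Ind.incl E κ hκ)} (hc : IsColimit c)

/-- The comparison with a colimit cocone of an admissible Ind-diagram. -/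
def indColimitIso : indColimit hX ≅ c.pt :=
  ((indColimitPres hX).isColimitIndCocone hκ).coconePointUniqueUpToIso hc

lemma indColimitIso_app_ξ (i : I) :
    (indColimitIso hκ hX hc).hom.hom.app _ ((indColimitPres hX).ξ i) =
      Ind.toSection hκ (c.ι.app i) := by
  have h := ((indColimitPres hX).isColimitIndCocone hκ).comp_coconePointUniqueUpToIso_hom hc i
  have h' := congrArg (Ind.toSection hκ) h
  refine Eq.trans ?_ h'
  refine (congrArg ((indColimitIso hκ hX hc).hom.hom.app _) ?_)
  exact (Ind.toSection_ofSection hκ (indColimit hX) ((indColimitPres hX).ξ i)).symm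

-- Formulated for an arbitrary colimit cocone in Ind-objects, so that it applies to the cocone of a
-- pointwise Kan extension; the proof transports the presentation of the presheaf colimit.
include hX hc in
lemma exists_eq_res_of_isColimit {U : C} (s : c.pt.obj.obj (op U)) :
    ∃ (i : I) (a : U ⟶ X.obj i), s = res c.pt.obj a (Ind.toSection hκ (c.ι.app i)) := by
  let e := (E.IsIndObject κ).ι.mapIso (indColimitIso hκ hX hc)
  obtain ⟨i, a, ha⟩ := ((indColimitPres hX).ofIso e).surj s
  refine ⟨i, a, ha.trans ?_⟩
  exact congrArg (res c.pt.obj a) (indColimitIso_app_ξ hκ hX hc i)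

include hX hc in
lemma eq_of_res_eq_of_isColimit {U : C} {i : I} (a b : U ⟶ X.obj i)
    (h : res c.pt.obj a (Ind.toSection hκ (c.ι.app i)) =
      res c.pt.obj b (Ind.toSection hκ (c.ι.app i))) : a = b := by
  let e := (E.IsIndObject κ).ι.mapIso (indColimitIso hκ hX hc)
  refine ((indColimitPres hX).ofIso e).inj a b ?_
  have hi := indColimitIso_app_ξ hκ hX hc i
  exact (congrArg (res c.pt.obj a) hi).trans (h.trans (congrArg (res c.pt.obj b) hi).symm)

end IndColimit

/-! ### Kan extension of an exact functor to Ind-objects -/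

section IndKan

variable {C : Type u₁} [Category.{v} C] [Preadditive C] {D : Type u₂} [Category.{v} D]
  [Preadditive D] {EC : ExactStructure C} {ED : ExactStructure D} {G : C ⥤ D}
  {κ : WithTop Cardinal.{v}} (hκ : ((Cardinal.aleph0 : Cardinal.{v}) : WithTop Cardinal.{v}) ≤ κ)

lemma IsExactFunctor.isAdmissibleIndDiagram (hG : IsExactFunctor EC.conf ED.conf G)
    {I : Type v} [PartialOrder I] {X : I ⥤ C} (hX : EC.IsAdmissibleIndDiagram κ X) :
    ED.IsAdmissibleIndDiagram κ (X ⋙ G) where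
  nonempty := hX.nonempty
  directed := hX.directed
  card_le := hX.card_le
  admMono i j a := by
    obtain ⟨Z, g, h⟩ := hX.admMono a
    exact ⟨_, _, hG _ _ h⟩

/-- By finality the colimit over all objects over `P` may be taken along a presentation, where `G`
yields an admissible diagram because it preserves admissible monics. -/
lemma IsExactFunctor.hasPointwiseLeftKanExtension (hG : IsExactFunctor EC.conf ED.conf G) :
    (Ind.incl EC κ hκ).HasPointwiseLeftKanExtension (G ⋙ Ind.incl ED κ hκ) := by
  intro P
  have := P.pres.final_toCostructuredArrow hκ
  have : HasColimit (P.pres.toCostructuredArrow hκ ⋙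
      CostructuredArrow.proj (Ind.incl EC κ hκ) P ⋙ G ⋙ Ind.incl ED κ hκ) :=
    hasColimit_comp_incl hκ (hG.isAdmissibleIndDiagram P.pres.adm)
  exact Functor.Final.hasColimit_of_comp (P.pres.toCostructuredArrow hκ)

variable {K : Ind EC κ ⥤ Ind ED κ} (α : G ⋙ Ind.incl ED κ hκ ⟶ Ind.incl EC κ hκ ⋙ K)

/-- The section of the extension of a functor `G` over `G U` given by a section over `U`. -/
def kanSection (P : Ind EC κ) {U : C} (s : P.obj.obj (op U)) :
    (K.obj P).obj.obj (op (G.obj U)) :=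
  Ind.toSection hκ (α.app U ≫ K.map (Ind.ofSection hκ P s))

lemma kanSection_res (P : Ind EC κ) {U V : C} (a : V ⟶ U) (s : P.obj.obj (op U)) :
    kanSection hκ α P (res P.obj a s) = res (K.obj P).obj (G.map a) (kanSection hκ α P s) := by
  rw [kanSection, ← Ind.map_comp_ofSection, K.map_comp]
  refine Eq.trans ?_ (Ind.toSection_map_comp hκ (G.map a) _)
  refine congrArg (Ind.toSection hκ) ?_
  rw [← Category.assoc, ← Category.assoc]
  congr 1
  exact (α.naturality a).symm

lemma app_kanSection {P Q : Ind EC κ} (f : P ⟶ Q) {U : C} (s : P.obj.obj (op U)) :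
    (K.map f).hom.app (op (G.obj U)) (kanSection hκ α P s) =
      kanSection hκ α Q (f.hom.app (op U) s) := by
  rw [kanSection, kanSection, ← Ind.ofSection_comp, K.map_comp]
  rfl

variable (hG : IsExactFunctor EC.conf ED.conf G)
  (hα : (Functor.LeftExtension.mk K α).IsPointwiseLeftKanExtension)

/-- The colimit cocone over the image of a presentation given by a pointwise Kan extension. -/
def kanCocone {P : Ind EC κ} (p : IndPres EC κ P.obj) :
    Cocone ((p.X ⋙ G) ⋙ Ind.incl ED κ hκ) :=
  ((Functor.LeftExtension.mk K α).coconeAt P).whisker (p.toCostructuredArrow hκ)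

include hα in
lemma nonempty_isColimit_kanCocone {P : Ind EC κ} (p : IndPres EC κ P.obj) :
    Nonempty (IsColimit (kanCocone hκ α p)) := by
  have := p.final_toCostructuredArrow hκ
  exact ⟨(Functor.Final.isColimitWhiskerEquiv (p.toCostructuredArrow hκ) _).symm (hα P)⟩

include hG hα

/-- The image of a presentation under a pointwise Kan extension. -/
def kanPres {P : Ind EC κ} (p : IndPres EC κ P.obj) : IndPres ED κ (K.obj P).obj where
  I := p.I
  X := p.X ⋙ G
  adm := hG.isAdmissibleIndDiagram p.adm
  ξ i := kanSection hκ α P (p.ξ i)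
  compat {i j} a := by
    rw [← p.compat a, kanSection_res]
    rfl
  surj {U} s := by
    obtain ⟨hc⟩ := nonempty_isColimit_kanCocone hκ α hα p
    exact exists_eq_res_of_isColimit hκ (hG.isAdmissibleIndDiagram p.adm) hc s
  inj {U i} a b h := by
    obtain ⟨hc⟩ := nonempty_isColimit_kanCocone hκ α hα p
    exact eq_of_res_eq_of_isColimit hκ (hG.isAdmissibleIndDiagram p.adm) hc a b h
  additive := inferInstance

omit hα hG in
-- Both sections are pulled back from one universal section, so the claim becomes additivity of `G`
-- on maps to that stage.
lemma kanSection_add [G.Additive] {P : Ind EC κ} {U : C} (s t : P.obj.obj (op U)) :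
    kanSection hκ α P (s + t) = kanSection hκ α P s + kanSection hκ α P t := by
  obtain ⟨i, a, b, rfl, rfl⟩ := P.pres.surj₂ s t
  rw [← add_res, kanSection_res, kanSection_res, kanSection_res, G.map_add, add_res]

omit hα hG in
lemma kanSection_zero [G.Additive] {P : Ind EC κ} {U : C} :
    kanSection hκ α P (0 : P.obj.obj (op U)) = 0 := by
  have := kanSection_add hκ α (0 : P.obj.obj (op U)) 0
  rwa [add_zero, left_eq_add] at this

lemma exists_eq_res_kanSection {P : Ind EC κ} (p : IndPres EC κ P.obj) {W : D}
    (t : (K.obj P).obj.obj (op W)) : ∃ (i : p.I) (b : W ⟶ G.obj (p.X.obj i)),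
      t = res (K.obj P).obj b (kanSection hκ α P (p.ξ i)) :=
  (kanPres hκ α hG hα p).surj t

lemma eq_of_res_kanSection {P : Ind EC κ} (p : IndPres EC κ P.obj) {W : D} {i : p.I}
    (a b : W ⟶ G.obj (p.X.obj i)) (h : res (K.obj P).obj a (kanSection hκ α P (p.ξ i)) =
      res (K.obj P).obj b (kanSection hκ α P (p.ξ i))) : a = b :=
  (kanPres hκ α hG hα p).inj a b h

lemma kan_hom_ext {P Q : Ind EC κ} {f g : K.obj P ⟶ K.obj Q} (p : IndPres EC κ P.obj)
    (h : ∀ i, f.hom.app _ (kanSection hκ α P (p.ξ i)) =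
      g.hom.app _ (kanSection hκ α P (p.ξ i))) : f = g :=
  Ind.hom_ext (kanPres hκ α hG hα p) h

lemma kan_faithful [hF : G.Faithful] : K.Faithful where
  map_injective {P Q f g} h := by
    let p := P.pres
    let q := Q.pres
    refine Ind.hom_ext p fun i => ?_
    obtain ⟨j, a, b, ha, hb⟩ := q.surj₂ (f.hom.app _ (p.ξ i)) (g.hom.app _ (p.ξ i))
    have e := congrArg (fun t => t.hom.app _ (kanSection hκ α P (p.ξ i))) h
    dsimp only at e
    rw [app_kanSection, app_kanSection, ha, hb, kanSection_res, kanSection_res] at e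
    rw [ha, hb, G.map_injective (eq_of_res_kanSection hκ α hG hα q _ _ e)]

lemma kanSection_injective [G.Faithful] {P : Ind EC κ} {U : C} {s t : P.obj.obj (op U)}
    (h : kanSection hκ α P s = kanSection hκ α P t) : s = t := by
  obtain ⟨j, a, b, rfl, rfl⟩ := P.pres.surj₂ s t
  rw [kanSection_res, kanSection_res] at h
  rw [G.map_injective (eq_of_res_kanSection hκ α hG hα P.pres _ _ h)]

lemma kanSection_surjective [G.Full] {P : Ind EC κ} {U : C}
    (t : (K.obj P).obj.obj (op (G.obj U))) : ∃ s, t = kanSection hκ α P s := by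
  obtain ⟨j, b, rfl⟩ := exists_eq_res_kanSection hκ α hG hα P.pres t
  obtain ⟨a, rfl⟩ := G.map_surjective b
  exact ⟨_, (kanSection_res hκ α P a _).symm⟩

/-- For fully faithful `G`, sections of `P` over `U` correspond bijectively to sections of `K P`
over `G U`. The values of a map on the universal sections therefore come from sections of `Q`, which
are compatible and glue by the colimit property. -/
lemma kan_full [G.Full] [G.Faithful] : K.Full where
  map_surjective {P Q} f := by
    let p := P.pres
    have key (i : p.I) := kanSection_surjective hκ α hG hα
      (f.hom.app _ (kanSection hκ α P (p.ξ i)))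
    choose s hs using key
    let c : Cocone (p.X ⋙ Ind.incl EC κ hκ) :=
      { pt := Q
        ι :=
          { app := fun i => Ind.ofSection hκ Q (s i)
            naturality := fun i j a => by
              refine (Ind.map_comp_ofSection hκ (p.X.map a) (s j)).trans ?_
              refine Eq.trans ?_ (Category.comp_id _).symm
              refine congrArg (Ind.ofSection hκ Q) (kanSection_injective hκ α hG hα ?_)
              rw [kanSection_res, ← hs, ← hs, ← app_res, ← kanSection_res, p.compat] } }
    let g : P ⟶ Q := (p.isColimitIndCocone hκ).desc c
    have hg (i : p.I) : g.hom.app _ (p.ξ i) = s i := by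
      have := congrArg (Ind.toSection hκ) ((p.isColimitIndCocone hκ).fac c i)
      refine Eq.trans (congrArg (g.hom.app _) ?_) (this.trans ?_)
      · exact (Ind.toSection_ofSection hκ P (p.ξ i)).symm
      · exact Ind.toSection_ofSection hκ Q (s i)
    refine ⟨g, kan_hom_ext hκ α hG hα p fun i => ?_⟩
    rw [app_kanSection, hg, hs]

lemma kan_additive [G.Additive] : K.Additive where
  map_add {P Q f g} := by
    refine kan_hom_ext hκ α hG hα P.pres fun i => ?_
    refine (app_kanSection hκ α (f + g) _).trans ((kanSection_add hκ α _ _).trans ?_)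
    exact (congrArg₂ (· + ·) (app_kanSection hκ α f _) (app_kanSection hκ α g _)).symm

end IndKan

/-! ### The extension to Ind-objects is exact -/

section IndExact

variable {C : Type u₁} [Category.{v} C] [Preadditive C] [HasBinaryBiproducts C]
  {EC : ExactStructure C} {κ : WithTop Cardinal.{v}}

/-- The image of `z` is represented by some `b : U ⟶ X l`, which need not be an admissible epic. The
universal section of that stage lifts to `Q` over an admissible epic `q` from `V`; the lift and `z`
together give a section over `V ⊞ U` whose image is represented by `(q, b)`, an admissible epic by
`admEpi_desc`. -/
lemma indExact.exists_conf {P Q R : Ind EC κ} {f : P ⟶ Q} {g : Q ⟶ R} (h : indExact EC κ f g)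
    (r : IndPres EC κ R.obj) {U : C} (z : Q.obj.obj (op U)) :
    ∃ (l : r.I) (W N : C) (j : U ⟶ W) (k : N ⟶ W) (π : W ⟶ r.X.obj l) (θ : Q.obj.obj (op W)),
      EC.conf k π ∧ res Q.obj j θ = z ∧ g.hom.app (op W) θ = res R.obj π (r.ξ l) := by
  obtain ⟨l, b, hb⟩ := r.surj (g.hom.app _ z)
  obtain ⟨V, q, y, hq, hy⟩ := h.2 _ (r.ξ l)
  change g.hom.app (op V) y = res R.obj q (r.ξ l) at hy
  obtain ⟨N, k, hk⟩ := EC.admEpi_desc hq b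
  refine ⟨l, V ⊞ U, N, biprod.inr, k, biprod.desc q b,
    res Q.obj biprod.fst y + res Q.obj biprod.snd z, hk, ?_, ?_⟩
  · rw [res_add, ← res_comp, ← res_comp]
    simp [zero_res]
  · rw [map_add, app_res, app_res, hy, hb, ← res_comp, ← res_comp, ← add_res, biprod.desc_eq]

variable {D : Type u₂} [Category.{v} D] [Preadditive D] {ED : ExactStructure D} {G : C ⥤ D}
  (hκ : ((Cardinal.aleph0 : Cardinal.{v}) : WithTop Cardinal.{v}) ≤ κ)
  {K : Ind EC κ ⥤ Ind ED κ} (α : G ⋙ Ind.incl ED κ hκ ⟶ Ind.incl EC κ hκ ⋙ K)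
  (hG : IsExactFunctor EC.conf ED.conf G)
  (hα : (Functor.LeftExtension.mk K α).IsPointwiseLeftKanExtension)

include hG hα

/-- The map `a` representing `f` between two stages need not be an admissible monic, so `c ≫ G.map a
= 0` does not give `c = 0` directly. The conflation `N ⟶ W ⟶ X l` repairs this: `a ≫ e` factors as
`m ≫ k`, and the section over `N` comes from a later stage of `P`, so `m` followed by a map `n` is a
transition map of `P`. Now `G` keeps both `k` and the transition map monic. -/
lemma indExact.kan_injective {P Q R : Ind EC κ} {f : P ⟶ Q} {g : Q ⟶ R} (h : indExact EC κ f g)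
    {U : D} : Function.Injective ((K.map f).hom.app (op U)) := by
  have := hG.additive
  rw [injective_iff_map_eq_zero]
  intro t ht
  let p := P.pres
  let q := Q.pres
  let r := R.pres
  obtain ⟨i, c, rfl⟩ := exists_eq_res_kanSection hκ α hG hα p t
  obtain ⟨j, a, ha⟩ := q.surj (f.hom.app _ (p.ξ i))
  rw [app_res, app_kanSection, ha, kanSection_res, ← res_comp] at ht
  have hca : c ≫ G.map a = 0 := (kanPres hκ α hG hα q).eq_zero _ ht
  obtain ⟨l, W, N, e, k, π, θ, hc, hθ, hπ⟩ := h.exists_conf r (q.ξ j)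
  have h₀ : a ≫ e ≫ π = 0 := by
    apply r.eq_zero
    rw [res_comp, res_comp, ← hπ, ← app_res, hθ, ← app_res, ← ha]
    exact ((h.1 _).2 _).2 ⟨_, rfl⟩
  obtain ⟨m, hm⟩ := EC.exists_lift hc (a ≫ e) (by rw [Category.assoc, h₀])
  obtain ⟨s, hs⟩ := ((h.1 N).2 (res Q.obj k θ)).1 (by
    rw [app_res, hπ, ← res_comp, EC.conf_comp hc, zero_res])
  obtain ⟨i', u, n, hn⟩ := p.surj_ge i s
  -- Both maps represent the same section of `P`, as is seen after applying `f`, which is injective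
  -- on sections.
  have hmn : m ≫ n = p.X.map u := by
    apply p.inj
    rw [p.compat, res_comp, ← hn]
    apply (h.1 _).1
    rw [app_res]
    have hs' : f.hom.app (op N) s = res Q.obj k θ := hs
    rw [hs', ← res_comp, hm, res_comp, hθ, ha]
  have hk := ED.mono_of_admMono ⟨_, _, hG _ _ hc⟩
  have hu : Mono (G.map (p.X.map u)) := by
    obtain ⟨_, _, hu⟩ := p.adm.admMono u
    exact ED.mono_of_admMono ⟨_, _, hG _ _ hu⟩
  have h₁ : c ≫ G.map m = 0 := by
    rw [← cancel_mono (G.map k), Category.assoc, ← G.map_comp, hm, G.map_comp,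
      ← Category.assoc, hca, zero_comp, zero_comp]
  have h₂ : c = 0 := by
    rw [← cancel_mono (G.map (p.X.map u)), ← hmn, G.map_comp, ← Category.assoc, h₁]
    simp
  rw [h₂, zero_res]

/-- After enlarging the stage of `Q` to `W`, being killed by `K.map g` means being killed by the
admissible epic `G.map π`. The section then factors through `G.obj N`, and over `N` the section `θ`
comes from `P`. -/
lemma indExact.kan_exact {P Q R : Ind EC κ} {f : P ⟶ Q} {g : Q ⟶ R} (h : indExact EC κ f g)
    {U : D} : Function.Exact ((K.map f).hom.app (op U)) ((K.map g).hom.app (op U)) := by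
  have := hG.additive
  let p := P.pres
  let q := Q.pres
  let r := R.pres
  intro t
  constructor
  · intro ht
    obtain ⟨j, c, rfl⟩ := exists_eq_res_kanSection hκ α hG hα q t
    obtain ⟨l, W, N, e, k, π, θ, hc, hθ, hπ⟩ := h.exists_conf r (q.ξ j)
    rw [app_res, app_kanSection, ← hθ, app_res, hπ, ← res_comp, kanSection_res,
      ← res_comp] at ht
    have h₀ : (c ≫ G.map e) ≫ G.map π = 0 := by
      rw [Category.assoc, ← G.map_comp]
      exact (kanPres hκ α hG hα r).eq_zero _ ht
    obtain ⟨b, hb⟩ := ED.exists_lift (hG _ _ hc) _ h₀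
    obtain ⟨s, hs⟩ := ((h.1 N).2 (res Q.obj k θ)).1 (by
      rw [app_res, hπ, ← res_comp, EC.conf_comp hc, zero_res])
    refine ⟨res (K.obj P).obj b (kanSection hκ α P s), ?_⟩
    have hs' : f.hom.app (op N) s = res Q.obj k θ := hs
    rw [app_res, app_kanSection, hs', kanSection_res, ← res_comp, hb, res_comp,
      ← kanSection_res, hθ]
  · rintro ⟨s, rfl⟩
    obtain ⟨i, c, rfl⟩ := exists_eq_res_kanSection hκ α hG hα p s
    rw [app_res, app_kanSection, app_res, app_kanSection]
    have : g.hom.app _ (f.hom.app _ (p.ξ i)) = 0 := ((h.1 _).2 _).2 ⟨_, rfl⟩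
    rw [this, kanSection_zero, res_zero]

/-- The extension of an exact functor to admissible Ind-objects is exact. -/
lemma isExactFunctor_kan : IsExactFunctor (indExact EC κ) (indExact ED κ) K := by
  intro P Q R f g h
  refine ⟨fun U => ⟨h.kan_injective hκ α hG hα, h.kan_exact hκ α hG hα⟩, fun U t => ?_⟩
  obtain ⟨l, c, rfl⟩ := exists_eq_res_kanSection hκ α hG hα R.pres t
  obtain ⟨V, q, y, ⟨X, x, hq⟩, hy⟩ := h.2 _ (R.pres.ξ l)
  change g.hom.app (op V) y = res R.obj q (R.pres.ξ l) at hy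
  -- The universal section lifts over `q`; pulling back the admissible epic `G.map q` along `c`
  -- provides the cover on which `t` lifts.
  obtain ⟨V', a, q', hp, hq'⟩ := ED.pullback (G.map q) c ⟨_, _, hG _ _ hq⟩
  refine ⟨V', q', res (K.obj Q).obj a (kanSection hκ α Q y), hq', ?_⟩
  change _ = res (K.obj R).obj q' _
  rw [app_res, app_kanSection, hy, kanSection_res, ← res_comp, ← res_comp, hp.w]

end IndExact

/-! ### Equivalences extend to equivalences that reflect exactness -/

section IndEquivalence

variable {C : Type u₁} [Category.{v} C] [Preadditive C]
  {EC : ExactStructure C} {κ : WithTop Cardinal.{v}}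
  {D : Type u₂} [Category.{v} D] [Preadditive D] {ED : ExactStructure D} {G : C ⥤ D}
  (hG : IsExactEquivalence EC.conf ED.conf G)

include hG

lemma IsExactEquivalence.isExactFunctor : IsExactFunctor EC.conf ED.conf G :=
  fun _ _ _ _ _ h => (hG.2 _ _).1 h

lemma IsExactEquivalence.isExactFunctor_inv :
    have := hG.1
    IsExactFunctor ED.conf EC.conf G.inv := by
  have := hG.1
  intro _ X Y Z f g h
  rw [hG.2]
  exact ED.of_iso f g _ _ (G.asEquivalence.counitIso.symm.app X)
    (G.asEquivalence.counitIso.symm.app Y) (G.asEquivalence.counitIso.symm.app Z)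
    (G.asEquivalence.counitIso.symm.hom.naturality f)
    (G.asEquivalence.counitIso.symm.hom.naturality g) h

lemma IsExactEquivalence.exists_admEpi {U : C} {V : D} (q : V ⟶ G.obj U) (h : ED.conf.AdmEpi q) :
    ∃ (V' : C) (q' : V' ⟶ U) (e : G.obj V' ≅ V), EC.conf.AdmEpi q' ∧ e.hom ≫ q = G.map q' := by
  have := hG.1
  let e : G.obj (G.objPreimage V) ≅ V := G.objObjPreimageIso V
  obtain ⟨X, x, h⟩ := h
  let e' : G.obj (G.objPreimage X) ≅ X := G.objObjPreimageIso X
  refine ⟨_, G.preimage (e.hom ≫ q), e, ⟨_, G.preimage (e'.hom ≫ x ≫ e.inv), ?_⟩, by simp⟩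
  rw [hG.2]
  exact ED.of_iso _ _ _ _ e'.symm e.symm (Iso.refl _) (by simp) (by simp) h

variable (hκ : ((Cardinal.aleph0 : Cardinal.{v}) : WithTop Cardinal.{v}) ≤ κ)
  {K : Ind EC κ ⥤ Ind ED κ} (α : G ⋙ Ind.incl ED κ hκ ⟶ Ind.incl EC κ hκ ⋙ K)
  (hα : (Functor.LeftExtension.mk K α).IsPointwiseLeftKanExtension)

include hα

/-- The quasi-inverse is exact, so it carries a presentation of `Q` to an admissible diagram in `C`;
`K` sends the colimit of that diagram to `Q`. -/
lemma IsExactEquivalence.kan_essSurj : K.EssSurj where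
  mem_essImage Q := by
    have := hG.1
    let q := Q.pres
    have hX := hG.isExactFunctor_inv.isAdmissibleIndDiagram q.adm
    obtain ⟨hc⟩ := nonempty_isColimit_kanCocone hκ α hα (indColimitPres hX)
    let i : ((q.X ⋙ G.inv) ⋙ G) ⋙ Ind.incl ED κ hκ ≅ q.X ⋙ Ind.incl ED κ hκ :=
      Functor.isoWhiskerRight (Functor.associator _ _ _ ≪≫
        Functor.isoWhiskerLeft q.X G.asEquivalence.counitIso ≪≫ Functor.rightUnitor _) _
    exact ⟨_, ⟨hc.coconePointsIsoOfNatIso (q.isColimitIndCocone hκ) i⟩⟩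

lemma IsExactEquivalence.kan_isEquivalence : K.IsEquivalence :=
  have := hG.1
  { faithful := kan_faithful hκ α hG.isExactFunctor hα
    full := kan_full hκ α hG.isExactFunctor hα
    essSurj := hG.kan_essSurj hκ α hα }

/-- Evaluating at `G U` recovers the sections over `U`, and every admissible epic onto `G U` is
isomorphic to the image of one onto `U`, so local lifts can be brought back. -/
lemma IsExactEquivalence.indExact_of_kan [HasBinaryBiproducts C] {P Q R : Ind EC κ} {f : P ⟶ Q}
    {g : Q ⟶ R} (h : indExact ED κ (K.map f) (K.map g)) : indExact EC κ f g := by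
  have := hG.1
  have hG' := hG.isExactFunctor
  have := hG'.additive
  refine ⟨fun U => ⟨?_, fun t => ⟨fun ht => ?_, ?_⟩⟩, fun U z => ?_⟩
  · rw [injective_iff_map_eq_zero]
    intro s hs
    apply kanSection_injective hκ α hG' hα
    apply (h.1 (G.obj U)).1
    rw [app_kanSection, app_kanSection, hs, map_zero]
  · obtain ⟨s, hs⟩ := ((h.1 (G.obj U)).2 (kanSection hκ α Q t)).1 (by
      rw [app_kanSection, ht, kanSection_zero])
    obtain ⟨s', rfl⟩ := kanSection_surjective hκ α hG' hα s
    refine ⟨s', kanSection_injective hκ α hG' hα ?_⟩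
    rw [← app_kanSection, hs]
  · rintro ⟨s, rfl⟩
    apply kanSection_injective hκ α hG' hα
    rw [← app_kanSection, ← app_kanSection, kanSection_zero]
    exact ((h.1 (G.obj U)).2 _).2 ⟨_, rfl⟩
  · obtain ⟨V, q, y, hq, hy⟩ := h.2 (G.obj U) (kanSection hκ α R z)
    change (K.map g).hom.app (op V) y = res (K.obj R).obj q _ at hy
    obtain ⟨V', q', e, hq', he⟩ := hG.exists_admEpi q hq
    obtain ⟨y', hy'⟩ := kanSection_surjective hκ α hG' hα (res (K.obj Q).obj e.hom y)
    refine ⟨V', q', y', hq', kanSection_injective hκ α hG' hα ?_⟩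
    change _ = kanSection hκ α R (res R.obj q' z)
    rw [← app_kanSection, ← hy', app_res, hy, ← res_comp, he, kanSection_res]

end IndEquivalence

lemma isoClosed_indExact {C : Type u} [Category.{v} C] [Preadditive C] (E : ExactStructure C)
    (κ : WithTop Cardinal.{v}) : (indExact E κ).IsoClosed := by
  intro X Y Z X' Y' Z' f g f' g' a b c h h' hS
  have ha {U : C} (s : X.obj.obj (op U)) : f'.hom.app (op U) (a.hom.hom.app (op U) s) =
      b.hom.hom.app (op U) (f.hom.app (op U) s) :=
    ConcreteCategory.congr_hom (NatTrans.congr_app (congrArg (fun t => t.hom) h.symm) (op U)) s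
  have hb {U : C} (s : Y.obj.obj (op U)) : g'.hom.app (op U) (b.hom.hom.app (op U) s) =
      c.hom.hom.app (op U) (g.hom.app (op U) s) :=
    ConcreteCategory.congr_hom (NatTrans.congr_app (congrArg (fun t => t.hom) h'.symm) (op U)) s
  have bij {A B : Ind E κ} (e : A ≅ B) (U : C) : Function.Bijective (e.hom.hom.app (op U)) :=
    (ConcreteCategory.isIso_iff_bijective _).1
      (((evaluation _ _).obj (op U)).mapIso ((E.IsIndObject κ).ι.mapIso e)).isIso_hom
  refine ⟨fun U => ⟨?_, fun t => ⟨fun ht => ?_, ?_⟩⟩, fun U z => ?_⟩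
  · rw [injective_iff_map_eq_zero]
    intro s hs
    obtain ⟨s, rfl⟩ := (bij a U).2 s
    rw [ha, map_eq_zero_iff _ (bij b U).1] at hs
    rw [(map_eq_zero_iff _ (hS.1 U).1).1 hs, map_zero]
  · obtain ⟨t, rfl⟩ := (bij b U).2 t
    rw [hb, map_eq_zero_iff _ (bij c U).1] at ht
    obtain ⟨s, rfl⟩ := ((hS.1 U).2 t).1 ht
    exact ⟨_, ha s⟩
  · rintro ⟨s, rfl⟩
    obtain ⟨s, rfl⟩ := (bij a U).2 s
    rw [ha, hb, ((hS.1 U).2 _).2 ⟨_, rfl⟩, map_zero]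
  · obtain ⟨z, rfl⟩ := (bij c U).2 z
    obtain ⟨V, q, y, hq, hy⟩ := hS.2 U z
    refine ⟨V, q, b.hom.hom.app (op V) y, hq, ?_⟩
    rw [hb, hy]
    exact app_res c.hom.hom q z

/-! ### The first part of the proposition -/

section Extension

variable {κ : WithTop Cardinal.{v}}
  (hκ : ((Cardinal.aleph0 : Cardinal.{v}) : WithTop Cardinal.{v}) ≤ κ)
  {C : Type u₁} [Category.{v} C] [Preadditive C] [HasFiniteBiproducts C]
  {D : Type u₂} [Category.{v} D] [Preadditive D]
  {EC : ExactStructure C} {ED : ExactStructure D} {F : Cᵒᵖ ⥤ D}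

/-- The covariant form of an exact contravariant functor is exact. -/
lemma IsExactFunctor.rightOp (hF : IsExactFunctor EC.conf.op ED.conf F) :
    IsExactFunctor EC.conf ED.op.conf F.rightOp :=
  fun _ _ _ f g h => hF g.op f.op h

lemma IsExactEquivalence.rightOp (hF : IsExactEquivalence EC.conf.op ED.conf F) :
    IsExactEquivalence EC.conf ED.op.conf F.rightOp :=
  have := hF.1
  ⟨inferInstance, fun _ _ _ f g => hF.2 g.op f.op⟩

/-- The extension of an exact contravariant functor to flat Mittag-Leffler objects. -/
theorem exists_extension (hF : IsExactFunctor EC.conf.op ED.conf F) :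
    ∃ (Ft : (FM EC κ)ᵒᵖ ⥤ FMDual ED κ)
      (e : (FM.incl EC κ hκ).op ⋙ Ft ≅ F ⋙ FMDual.incl ED κ hκ),
      Nonempty (Functor.RightExtension.mk Ft e.hom).IsPointwiseRightKanExtension ∧
      IsExactFunctor (fmExact EC κ).op (fmDualExact ED κ) Ft ∧
      (F.Faithful → Ft.Faithful) ∧
      (F.Full → F.Faithful → Ft.Full ∧ Ft.Faithful) ∧
      (IsExactEquivalence EC.conf.op ED.conf F →
        IsExactEquivalence (fmExact EC κ).op (fmDualExact ED κ) Ft) ∧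
      Ft.Additive := by
  have := hasBinaryBiproducts_of_finite_biproducts C
  have hG := hF.rightOp
  have := hG.hasPointwiseLeftKanExtension hκ
  let K := (Ind.incl EC κ hκ).pointwiseLeftKanExtension (F.rightOp ⋙ Ind.incl ED.op κ hκ)
  let α : F.rightOp ⋙ Ind.incl ED.op κ hκ ⟶ Ind.incl EC κ hκ ⋙ K :=
    (Ind.incl EC κ hκ).pointwiseLeftKanExtensionUnit (F.rightOp ⋙ Ind.incl ED.op κ hκ)
  have hα : (Functor.LeftExtension.mk K α).IsPointwiseLeftKanExtension :=
    Functor.pointwiseLeftKanExtensionIsPointwiseLeftKanExtension _ _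
  -- The embedding into Ind-objects is fully faithful, so a pointwise Kan extension along it
  -- restricts to the given functor.
  have : IsIso α := hα.isIso_hom
  have := isIso_karoubiOpCounit K α
  let e := asIso (karoubiOpCounit K α)
  refine ⟨karoubiOp K, e,
    ⟨isPointwiseRightKanExtension_karoubiOp K α hα⟩, ?_, ?_, ?_, ?_, ?_⟩
  · intro X Y Z f g h
    exact ((proExact ED κ).karoubi_iff _ _).2
      (isRetract_karoubiOp (isExactFunctor_kan hκ α hG hα)
        (((indExact EC κ).karoubi_iff _ _).1 h))
  · intro _
    have := kan_faithful hκ α hG hα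
    exact karoubiOp_faithful K
  · intro _ _
    have := kan_faithful hκ α hG hα
    have := kan_full hκ α hG hα
    exact ⟨karoubiOp_full K, karoubiOp_faithful K⟩
  · intro hF'
    have hG' := hF'.rightOp
    have := hG'.kan_isEquivalence hκ α hα
    refine ⟨karoubiOp_isEquivalence K, fun X Y Z f g => ⟨fun h => ?_, fun h => ?_⟩⟩
    · exact ((proExact ED κ).karoubi_iff _ _).2
        (isRetract_karoubiOp (isExactFunctor_kan hκ α hG hα)
          (((indExact EC κ).karoubi_iff _ _).1 h))
    · exact ((indExact EC κ).karoubi_iff _ _).2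
        (isRetract_of_karoubiOp (isoClosed_indExact ED.op κ)
          (fun _ _ _ _ _ h => hG'.indExact_of_kan hκ α hα h)
          (((proExact ED κ).karoubi_iff _ _).1 h))
  · have := hG.additive
    have := kan_additive hκ α hG hα
    exact karoubiOp_additive K

end Extension

/-! ### Locally split maps into stabilized flat Mittag-Leffler modules -/

section FlatML

variable {A : Type w} [Ring A]

instance (X : Pf A) : Module.Finite A X.obj := X.property.1

instance (X : Pf A) : Module.Projective A X.obj := X.property.2

/-- A finitely generated projective module, as an object of `Pf A`. -/
abbrev Pf.of (X : Type w) [AddCommGroup X] [Module A X] [Module.Finite A X] [Module.Projective A X] :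
    Pf A := ⟨ModuleCat.of A X, ⟨inferInstance, inferInstance⟩⟩

lemma Pf.exists_retract_pi (X : Pf A) : ∃ (n : ℕ) (i : X.obj →ₗ[A] (Fin n → A))
    (p : (Fin n → A) →ₗ[A] X.obj), p ∘ₗ i = LinearMap.id := by
  obtain ⟨n, f, g, -, -, h⟩ := Module.Finite.exists_comp_eq_id_of_projective A X.obj
  exact ⟨n, g, f, h⟩

/-- An intrinsic characterization of flat Mittag-Leffler modules: a map from a finitely generated
projective module that kills an element factors through a map of such modules that kills it, and
every map from a finitely generated projective module has a factorization that is dominated by all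
the others. -/
structure IsFlatML (M : Type w) [AddCommGroup M] [Module A M] : Prop where
  exists_kill : ∀ (X : Pf A) (x : X.obj →ₗ[A] M) (r : X.obj), x r = 0 →
    ∃ (Y : Pf A) (a : X.obj →ₗ[A] Y.obj) (y : Y.obj →ₗ[A] M), y ∘ₗ a = x ∧ a r = 0
  exists_dominated : ∀ (X : Pf A) (x : X.obj →ₗ[A] M),
    ∃ (Y : Pf A) (a : X.obj →ₗ[A] Y.obj) (y : Y.obj →ₗ[A] M), y ∘ₗ a = x ∧
      ∀ (Z : Pf A) (b : X.obj →ₗ[A] Z.obj) (z : Z.obj →ₗ[A] M), z ∘ₗ b = x →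
        ∃ c : Z.obj →ₗ[A] Y.obj, c ∘ₗ b = a

section

variable {M N : Type w} [AddCommGroup M] [Module A M] [AddCommGroup N] [Module A N]

lemma IsFlatML.of_retract (hM : IsFlatML (A := A) M) (i : N →ₗ[A] M) (r : M →ₗ[A] N)
    (h : r ∘ₗ i = LinearMap.id) : IsFlatML (A := A) N where
  exists_kill X x e hx := by
    obtain ⟨Y, a, y, rfl', ha⟩ := hM.exists_kill X (i ∘ₗ x) e (by simp [hx])
    exact ⟨Y, a, r ∘ₗ y, by rw [LinearMap.comp_assoc, rfl', ← LinearMap.comp_assoc, h,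
      LinearMap.id_comp], ha⟩
  exists_dominated X x := by
    obtain ⟨Y, a, y, hy, ha⟩ := hM.exists_dominated X (i ∘ₗ x)
    refine ⟨Y, a, r ∘ₗ y, by rw [LinearMap.comp_assoc, hy, ← LinearMap.comp_assoc, h,
      LinearMap.id_comp], fun Z b z hz => ha Z b (i ∘ₗ z) ?_⟩
    rw [LinearMap.comp_assoc, hz]

lemma IsFlatML.exists_kill_finset (hM : IsFlatML (A := A) M) (X : Pf A) (x : X.obj →ₗ[A] M)
    (s : Finset X.obj) (hs : ∀ r ∈ s, x r = 0) :
    ∃ (Y : Pf A) (a : X.obj →ₗ[A] Y.obj) (y : Y.obj →ₗ[A] M), y ∘ₗ a = x ∧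
      ∀ r ∈ s, a r = 0 := by
  classical
  induction s using Finset.induction_on with
  | empty => exact ⟨X, LinearMap.id, x, rfl, by simp⟩
  | insert r s hr ih =>
    obtain ⟨Y, a, y, rfl, ha⟩ := ih fun t ht => hs t (Finset.mem_insert_of_mem ht)
    obtain ⟨Z, b, z, rfl, hb⟩ := hM.exists_kill Y y (a r) (hs r (Finset.mem_insert_self _ _))
    refine ⟨Z, b ∘ₗ a, z, rfl, fun t ht => ?_⟩
    rcases Finset.mem_insert.1 ht with rfl | ht
    · exact hb
    · simp [ha t ht]

/-- The inclusion of `Fin n → A` as the coordinates `o, …, o + n - 1`. -/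
def coordIncl (A : Type w) [Ring A] (o n : ℕ) : (Fin n → A) →ₗ[A] (ℕ →₀ A) :=
  ∑ j : Fin n, Finsupp.lsingle (o + j) ∘ₗ LinearMap.proj j

/-- The projection to the coordinates `o, …, o + n - 1`. -/
def coordProj (A : Type w) [Ring A] (o n : ℕ) : (ℕ →₀ A) →ₗ[A] (Fin n → A) :=
  LinearMap.pi fun j => Finsupp.lapply (o + j)

lemma coordIncl_apply (o n : ℕ) (v : Fin n → A) (k : ℕ) :
    coordIncl A o n v k = ∑ j : Fin n, if o + (j : ℕ) = k then v j else 0 := by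
  simp [coordIncl, Finsupp.single_apply]

lemma coordProj_coordIncl (o n : ℕ) : coordProj A o n ∘ₗ coordIncl A o n = LinearMap.id := by
  apply LinearMap.ext
  intro v
  funext k
  change coordIncl A o n v (o + k) = v k
  rw [coordIncl_apply, Finset.sum_eq_single k]
  · simp
  · intro j _ hj
    rw [if_neg]
    intro h
    exact hj (Fin.ext (by omega))
  · simp

lemma coordProj_coordIncl_of_le {o n o' n' : ℕ} (h : o + n ≤ o') :
    coordProj A o n ∘ₗ coordIncl A o' n' = 0 := by
  apply LinearMap.ext
  intro v
  funext k
  change coordIncl A o' n' v (o + k) = 0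
  rw [coordIncl_apply]
  exact Finset.sum_eq_zero fun j _ => if_neg (by omega)

lemma coordProj_coordIncl_of_ge {o n o' n' : ℕ} (h : o' + n' ≤ o) :
    coordProj A o n ∘ₗ coordIncl A o' n' = 0 := by
  apply LinearMap.ext
  intro v
  funext k
  change coordIncl A o' n' v (o + k) = 0
  rw [coordIncl_apply]
  exact Finset.sum_eq_zero fun j _ => if_neg (by omega)

lemma exists_coordIncl_coordProj (X : Pf A) (x : X.obj →ₗ[A] (ℕ →₀ A)) :
    ∃ n : ℕ, coordIncl A 0 n ∘ₗ coordProj A 0 n ∘ₗ x = x := by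
  obtain ⟨s, hs⟩ := Module.Finite.fg_top (R := A) (M := X.obj)
  classical
  obtain ⟨n, hn⟩ : ∃ n, ∀ r ∈ s, ∀ k, x r k ≠ 0 → k < n := by
    refine ⟨(s.biUnion fun r => (x r).support).sup id + 1, fun r hr k hk => ?_⟩
    refine Nat.lt_succ_of_le (Finset.le_sup (f := id) ?_)
    exact Finset.mem_biUnion.2 ⟨r, hr, Finsupp.mem_support_iff.2 hk⟩
  refine ⟨n, LinearMap.ext_on hs fun r hr => ?_⟩
  ext k
  change coordIncl A 0 n (fun j => x r (0 + j)) k = x r k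
  rw [coordIncl_apply]
  by_cases hk : k < n
  · rw [Finset.sum_eq_single ⟨k, hk⟩]
    · simp
    · intro j _ hj
      rw [if_neg]
      intro h
      exact hj (Fin.ext (by simpa using h))
    · simp
  · rw [Finset.sum_eq_zero]
    · by_contra h
      exact hk (hn r hr k fun h' => h h'.symm)
    · intro j _
      exact if_neg (by omega)

/-- An injective map from a finitely generated projective module that becomes split in every
factorization through a finitely generated projective module. -/
structure IsLocallySplit {N : Type w} [AddCommGroup N] [Module A N] (Y : Pf A)
    (y : Y.obj →ₗ[A] N) : Prop where
  injective : Function.Injective y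
  exists_retraction : ∀ (Z : Pf A) (b : Y.obj →ₗ[A] Z.obj) (z : Z.obj →ₗ[A] N), z ∘ₗ b = y →
    ∃ c : Z.obj →ₗ[A] Y.obj, c ∘ₗ b = LinearMap.id

/-- After adding a free module of countable rank to a flat Mittag-Leffler module, every map from a
finitely generated projective module factors through a locally split one. -/
lemma IsFlatML.exists_isLocallySplit (hM : IsFlatML (A := A) M) (X : Pf A)
    (x : X.obj →ₗ[A] M × (ℕ →₀ A)) :
    ∃ (Y : Pf A) (a : X.obj →ₗ[A] Y.obj) (y : Y.obj →ₗ[A] M × (ℕ →₀ A)),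
      y ∘ₗ a = x ∧ IsLocallySplit Y y := by
  -- Two successive dominated factorizations are taken. The composite `a₁ ∘ₗ a₀` is another
  -- factorization of the first component of `x`, so domination yields `c` with `c ∘ₗ a₁ ∘ₗ a₀ =
  -- a₀`.
  obtain ⟨Y₁, a₀, y₁, h₁, dom₀⟩ := hM.exists_dominated X (LinearMap.fst A M (ℕ →₀ A) ∘ₗ x)
  obtain ⟨Y₂, a₁, y₂, h₂, dom₁⟩ := hM.exists_dominated Y₁ y₁
  obtain ⟨c, hc⟩ := dom₀ Y₂ (a₁ ∘ₗ a₀) y₂ (by rw [← LinearMap.comp_assoc, h₂, h₁])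
  obtain ⟨m, i, p, hp⟩ := Y₁.exists_retract_pi
  obtain ⟨n, hn⟩ := exists_coordIncl_coordProj X (LinearMap.snd A M (ℕ →₀ A) ∘ₗ x)
  -- The failure of `c` to be a retraction of `a₁`. It vanishes on the image of `a₀`, so storing it
  -- in the coordinates from `n` on, which `x` does not use, leaves the composite with `X`
  -- unchanged.
  let g : Y₁.obj →ₗ[A] Y₁.obj := LinearMap.id - c ∘ₗ a₁
  have hg : g ∘ₗ a₀ = 0 := by
    rw [LinearMap.sub_comp, LinearMap.id_comp, LinearMap.comp_assoc, hc, sub_self]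
  let y : Y₁.obj × (Fin n → A) →ₗ[A] M × (ℕ →₀ A) :=
    LinearMap.prod (y₁ ∘ₗ LinearMap.fst A _ _)
      (LinearMap.coprod (coordIncl A n m ∘ₗ i ∘ₗ g) (coordIncl A 0 n))
  have e₁ : coordProj A n m ∘ₗ coordIncl A n m = LinearMap.id := coordProj_coordIncl _ _
  have e₂ : coordProj A 0 n ∘ₗ coordIncl A 0 n = LinearMap.id := coordProj_coordIncl _ _
  have e₃ : coordProj A 0 n ∘ₗ coordIncl A n m = 0 := coordProj_coordIncl_of_le (by simp)
  have e₄ : coordProj A n m ∘ₗ coordIncl A 0 n = 0 := coordProj_coordIncl_of_ge (by simp)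
  replace e₁ v := LinearMap.congr_fun e₁ v
  replace e₂ v := LinearMap.congr_fun e₂ v
  replace e₃ v := LinearMap.congr_fun e₃ v
  replace e₄ v := LinearMap.congr_fun e₄ v
  replace hp v := LinearMap.congr_fun hp v
  dsimp at e₁ e₂ e₃ e₄ hp
  have py (v : Y₁.obj × (Fin n → A)) : p (coordProj A n m (y v).2) = g v.1 := by
    change p (coordProj A n m (coordIncl A n m (i (g v.1)) + coordIncl A 0 n v.2)) = _
    rw [map_add, e₁, e₄, add_zero, hp]
  have qy (v : Y₁.obj × (Fin n → A)) : coordProj A 0 n (y v).2 = v.2 := by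
    change coordProj A 0 n (coordIncl A n m (i (g v.1)) + coordIncl A 0 n v.2) = _
    rw [map_add, e₂, e₃, zero_add]
  have inj : Function.Injective y := by
    rw [injective_iff_map_eq_zero]
    intro v hv
    have k₁ := py v
    have k₂ := qy v
    rw [hv] at k₁ k₂
    have k₃ : y₁ v.1 = 0 := congrArg Prod.fst hv
    -- Since `a₁` factors through every factorization of `y₁`, in particular through one that kills
    -- `v.1`, it kills `v.1` itself. With `g v.1 = 0` this leaves `v.1 = 0`.
    obtain ⟨Z, b, z, hz, hb⟩ := hM.exists_kill Y₁ y₁ v.1 k₃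
    obtain ⟨d, hd⟩ := dom₁ Z b z hz
    have k₄ : a₁ v.1 = 0 := by rw [← hd]; simp [hb]
    refine Prod.ext ?_ (by simpa using k₂.symm)
    have k₅ : v.1 - c (a₁ v.1) = 0 := k₁.symm.trans (by simp)
    rw [k₄, map_zero, sub_zero] at k₅
    exact k₅
  refine ⟨Pf.of (Y₁.obj × (Fin n → A)),
    LinearMap.prod a₀ (coordProj A 0 n ∘ₗ LinearMap.snd A M (ℕ →₀ A) ∘ₗ x), y, ?_, ?_, ?_⟩
  · apply LinearMap.ext
    intro v
    refine Prod.ext ?_ ?_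
    · exact LinearMap.congr_fun h₁ v
    · change coordIncl A n m (i ((g ∘ₗ a₀) v)) +
        (coordIncl A 0 n ∘ₗ coordProj A 0 n ∘ₗ LinearMap.snd A M (ℕ →₀ A) ∘ₗ x) v = (x v).2
      rw [hn, hg]
      simp
  · exact inj
  · intro Z b z hz
    -- The retraction is assembled from two pieces: `d` recovers `a₁` on the first summand, hence `c
    -- ∘ₗ a₁`, and the stored coordinates recover `g`; their sum is the identity. The contribution
    -- of the free summand to `d` is subtracted by means of `c₂`.
    obtain ⟨d, hd⟩ := dom₁ Z (b ∘ₗ LinearMap.inl A Y₁.obj (Fin n → A))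
      (LinearMap.fst A M (ℕ →₀ A) ∘ₗ z) (by
        apply LinearMap.ext
        intro v
        change (z (b (v, 0))).1 = y₁ v
        exact congrArg Prod.fst (LinearMap.congr_fun hz (v, 0)))
    let c₂ : Z.obj →ₗ[A] (Fin n → A) := coordProj A 0 n ∘ₗ LinearMap.snd A M (ℕ →₀ A) ∘ₗ z
    let c₁ : Z.obj →ₗ[A] Y₁.obj := c ∘ₗ (d - d ∘ₗ b ∘ₗ LinearMap.inr A Y₁.obj (Fin n → A) ∘ₗ c₂) +
      p ∘ₗ coordProj A n m ∘ₗ LinearMap.snd A M (ℕ →₀ A) ∘ₗ z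
    refine ⟨LinearMap.prod c₁ c₂, ?_⟩
    apply LinearMap.ext
    intro (v : Y₁.obj × (Fin n → A))
    have hzv : z (b v) = y v := LinearMap.congr_fun hz v
    have k₂ : c₂ (b v) = v.2 := by
      change coordProj A 0 n (z (b v)).2 = v.2
      rw [hzv, qy]
    refine Prod.ext ?_ k₂
    change c (d (b v) - d (b (0, c₂ (b v)))) + p (coordProj A n m (z (b v)).2) = v.1
    have k₃ : d (b v) = a₁ v.1 + d (b (0, v.2)) := by
      let b' : Y₁.obj × (Fin n → A) →ₗ[A] Z.obj := b
      have h' : b' v = b' (v.1, 0) + b' (0, v.2) := by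
        rw [← map_add]
        simp
      refine (congrArg d h').trans ?_
      rw [map_add]
      congr 1
      exact LinearMap.congr_fun hd v.1
    rw [k₂, hzv, py, k₃, add_sub_cancel_right]
    simp [g]

lemma IsLocallySplit.exists_of_fg (hM : IsFlatML (A := A) M) (W : Submodule A (M × (ℕ →₀ A)))
    (hW : W.FG) : ∃ (Y : Pf A) (y : Y.obj →ₗ[A] M × (ℕ →₀ A)), IsLocallySplit Y y ∧
      W ≤ LinearMap.range y := by
  have : Module.Finite A W := Module.Finite.iff_fg.2 hW
  obtain ⟨n, f, hf⟩ := Module.Finite.exists_fin' A W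
  obtain ⟨Y, a, y, h, hy⟩ := hM.exists_isLocallySplit (Pf.of (Fin n → A)) (W.subtype ∘ₗ f)
  refine ⟨Y, y, hy, fun u hu => ?_⟩
  obtain ⟨v, hv⟩ := hf ⟨u, hu⟩
  refine ⟨a v, ?_⟩
  have := LinearMap.congr_fun h v
  refine this.trans ?_
  change ((f v : W) : M × (ℕ →₀ A)) = u
  rw [hv]

end

end FlatML

/-! ### The intrinsic characterization of flat Mittag-Leffler modules -/

section DirectedColimit

variable {A : Type w} [Ring A] {I : Type w} [PartialOrder I] {X : I ⥤ Pf A}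
  {M : Type w} [AddCommGroup M] [Module A M] {ι : ∀ i, (X.obj i).obj →ₗ[A] M}

/-- `M` is the colimit, with coprojections `ι i`, of a diagram of finitely generated projective
modules that is indexed by a directed poset. -/
structure IsDirectedColimit (X : I ⥤ Pf A) (M : Type w) [AddCommGroup M] [Module A M]
    (ι : ∀ i, (X.obj i).obj →ₗ[A] M) : Prop where
  nonempty : Nonempty I
  directed : IsDirectedOrder I
  compat : ∀ ⦃i j : I⦄ (a : i ⟶ j), ι j ∘ₗ (X.map a).hom.hom = ι i
  exists_rep : ∀ m : M, ∃ (i : I) (x : (X.obj i).obj), ι i x = m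
  exists_map_eq_zero : ∀ (i : I) (x : (X.obj i).obj), ι i x = 0 →
    ∃ (j : I) (a : i ⟶ j), (X.map a).hom.hom x = 0

lemma isDirectedColimit_of_isColimit [Nonempty I] [IsDirectedOrder I]
    {c : Cocone (X ⋙ (IsPf A).ι)} (hc : IsColimit c) :
    IsDirectedColimit X c.pt (fun i => show (X.obj i).obj →ₗ[A] c.pt from (c.ι.app i).hom) where
  nonempty := inferInstance
  directed := inferInstance
  compat i j a := congrArg ModuleCat.Hom.hom (c.w a)
  exists_rep m := Concrete.isColimit_exists_rep _ hc m
  exists_map_eq_zero i x hx := by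
    obtain ⟨k, f, g, h⟩ := Concrete.isColimit_exists_of_rep_eq _ hc x (0 : (X.obj i).obj)
      (hx.trans (map_zero _).symm)
    exact ⟨k, f, h.trans (map_zero (X.map g).hom.hom)⟩

namespace IsDirectedColimit

variable (h : IsDirectedColimit X M ι)

include h

lemma compat_apply {i j : I} (a : i ⟶ j) (x : (X.obj i).obj) :
    ι j ((X.map a).hom.hom x) = ι i x :=
  LinearMap.congr_fun (h.compat a) x

/-- The corresponding colimit cocone. -/
lemma exists_isColimit : ∃ c : Cocone (X ⋙ (IsPf A).ι), Nonempty (IsColimit c) ∧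
    Nonempty (ModuleCat.of A M ≅ c.pt) := by
  have := h.nonempty
  have := h.directed
  let c : Cocone (X ⋙ (IsPf A).ι) :=
    { pt := ModuleCat.of A M
      ι := { app := fun i => ModuleCat.ofHom (ι i)
             naturality := fun i j a => by
              apply ModuleCat.hom_ext
              exact h.compat a } }
  let P := colimit.isColimit (X ⋙ (IsPf A).ι)
  have hP := isDirectedColimit_of_isColimit P
  have fac (i : I) (x : (X.obj i).obj) :
      (P.desc c).hom (((colimit.cocone (X ⋙ (IsPf A).ι)).ι.app i).hom x) = ι i x :=
    LinearMap.congr_fun (congrArg ModuleCat.Hom.hom (P.fac c i)) x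
  have : IsIso (P.desc c) := by
    rw [ConcreteCategory.isIso_iff_bijective]
    refine ⟨(injective_iff_map_eq_zero (P.desc c).hom).2 fun z hz => ?_, fun m => ?_⟩
    · obtain ⟨i, x, rfl⟩ := hP.exists_rep z
      rw [fac] at hz
      obtain ⟨j, a, hj⟩ := h.exists_map_eq_zero i x hz
      rw [← hP.compat_apply a, hj, map_zero]
    · obtain ⟨i, x, rfl⟩ := h.exists_rep m
      exact ⟨_, fac i x⟩
  exact ⟨c, ⟨IsColimit.ofPointIso P⟩, ⟨Iso.refl _⟩⟩

lemma exists_ge₂ (i j : I) : ∃ (k : I) (_ : i ⟶ k) (_ : j ⟶ k), True := by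
  have := h.directed
  obtain ⟨k, hi, hj⟩ := exists_ge_ge i j
  exact ⟨k, homOfLE hi, homOfLE hj, trivial⟩

lemma exists_finset_ge (S : Finset I) : ∃ k : I, ∀ i ∈ S, i ≤ k := by
  have := h.directed
  have := h.nonempty
  exact S.exists_le

lemma exists_lift_pi (n : ℕ) (y : (Fin n → A) →ₗ[A] M) :
    ∃ (i : I) (y' : (Fin n → A) →ₗ[A] (X.obj i).obj), ι i ∘ₗ y' = y := by
  classical
  choose i x hx using fun k : Fin n => h.exists_rep (y (Pi.single k 1))
  obtain ⟨j, hj⟩ := h.exists_finset_ge (Finset.univ.image i)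
  let a (k : Fin n) : i k ⟶ j := homOfLE (hj _ (Finset.mem_image_of_mem _ (Finset.mem_univ k)))
  refine ⟨j, (Pi.basisFun A (Fin n)).constr ℕ fun k => (X.map (a k)).hom.hom (x k), ?_⟩
  refine (Pi.basisFun A (Fin n)).ext fun k => ?_
  rw [LinearMap.comp_apply, Module.Basis.constr_basis, h.compat_apply, hx, Pi.basisFun_apply]

lemma exists_lift (Y : Pf A) (y : Y.obj →ₗ[A] M) :
    ∃ (i : I) (y' : Y.obj →ₗ[A] (X.obj i).obj), ι i ∘ₗ y' = y := by
  obtain ⟨n, e, p, hp⟩ := Y.exists_retract_pi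
  obtain ⟨i, y', hy⟩ := h.exists_lift_pi n (y ∘ₗ p)
  exact ⟨i, y' ∘ₗ e, by rw [← LinearMap.comp_assoc, hy, LinearMap.comp_assoc, hp,
    LinearMap.comp_id]⟩

lemma exists_map_comp_eq_zero (Y : Pf A) (i : I) (a : Y.obj →ₗ[A] (X.obj i).obj)
    (ha : ι i ∘ₗ a = 0) : ∃ (j : I) (b : i ⟶ j), (X.map b).hom.hom ∘ₗ a = 0 := by
  classical
  obtain ⟨s, hs⟩ := Module.Finite.fg_top (R := A) (M := Y.obj)
  choose j b hb using fun r : Y.obj => h.exists_map_eq_zero i (a r) (LinearMap.congr_fun ha r)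
  obtain ⟨k, hk⟩ := h.exists_finset_ge (insert i (s.image j))
  refine ⟨k, homOfLE (hk _ (Finset.mem_insert_self _ _)), LinearMap.ext_on hs fun r hr => ?_⟩
  let hjk : j r ⟶ k := homOfLE (hk _ (Finset.mem_insert_of_mem (Finset.mem_image_of_mem _ hr)))
  have e : homOfLE (hk i (Finset.mem_insert_self i _)) = b r ≫ hjk := Subsingleton.elim _ _
  rw [e, X.map_comp]
  change (X.map hjk).hom.hom ((X.map (b r)).hom.hom (a r)) = 0
  rw [hb, map_zero]

lemma exists_map_comp_eq (Y : Pf A) {i j : I} (a : Y.obj →ₗ[A] (X.obj i).obj)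
    (b : Y.obj →ₗ[A] (X.obj j).obj) (hab : ι i ∘ₗ a = ι j ∘ₗ b) :
    ∃ (k : I) (f : i ⟶ k) (g : j ⟶ k), (X.map f).hom.hom ∘ₗ a = (X.map g).hom.hom ∘ₗ b := by
  obtain ⟨k, f, g, -⟩ := h.exists_ge₂ i j
  obtain ⟨l, t, ht⟩ := h.exists_map_comp_eq_zero Y k
    ((X.map f).hom.hom ∘ₗ a - (X.map g).hom.hom ∘ₗ b) (by
      rw [LinearMap.comp_sub, ← LinearMap.comp_assoc, ← LinearMap.comp_assoc, h.compat, h.compat,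
        hab, sub_self])
  refine ⟨l, f ≫ t, g ≫ t, ?_⟩
  rw [LinearMap.comp_sub, sub_eq_zero] at ht
  rw [X.map_comp, X.map_comp]
  exact ht

/-- The dominated factorization goes through the index `j` where the dual images are stable. Any
other factorization maps to a later stage `k`; embedding `X j` in a free module turns the transition
map to `X j` into finitely many functionals on `X i`, and by stability these extend to `X k`. -/
lemma isFlatML (hML : ∀ i : I, ∃ (j : I) (a : i ⟶ j), ∀ (k : I) (b : j ⟶ k),
      Set.range (fun φ : (X.obj k).obj →ₗ[A] A => φ ∘ₗ (X.map (a ≫ b)).hom.hom) =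
        Set.range (fun φ : (X.obj j).obj →ₗ[A] A => φ ∘ₗ (X.map a).hom.hom)) :
    IsFlatML (A := A) M where
  exists_kill Y y r hr := by
    obtain ⟨i, y', rfl⟩ := h.exists_lift Y y
    obtain ⟨j, a, ha⟩ := h.exists_map_eq_zero i (y' r) hr
    exact ⟨X.obj j, (X.map a).hom.hom ∘ₗ y', ι j, by rw [← LinearMap.comp_assoc, h.compat], ha⟩
  exists_dominated Y y := by
    obtain ⟨i, y', rfl⟩ := h.exists_lift Y y
    obtain ⟨j, a, ha⟩ := hML i
    refine ⟨X.obj j, (X.map a).hom.hom ∘ₗ y', ι j, by rw [← LinearMap.comp_assoc, h.compat],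
      fun Z b z hz => ?_⟩
    obtain ⟨k₀, z', rfl⟩ := h.exists_lift Z z
    obtain ⟨k, f, g, hfg⟩ := h.exists_map_comp_eq Y ((X.map a).hom.hom ∘ₗ y') (z' ∘ₗ b) (by
      rw [← LinearMap.comp_assoc, h.compat, ← hz, LinearMap.comp_assoc])
    obtain ⟨m, e, p, hp⟩ := (X.obj j).exists_retract_pi
    choose φ hφ using fun l : Fin m => (Set.ext_iff.1 (ha k f) ((LinearMap.proj l ∘ₗ e) ∘ₗ
      (X.map a).hom.hom)).2 ⟨_, rfl⟩
    refine ⟨p ∘ₗ LinearMap.pi φ ∘ₗ (X.map g).hom.hom ∘ₗ z', ?_⟩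
    have key : LinearMap.pi φ ∘ₗ (X.map (a ≫ f)).hom.hom = e ∘ₗ (X.map a).hom.hom := by
      apply LinearMap.ext
      intro v
      funext l
      exact LinearMap.congr_fun (hφ l) v
    calc (p ∘ₗ LinearMap.pi φ ∘ₗ (X.map g).hom.hom ∘ₗ z') ∘ₗ b
        = p ∘ₗ LinearMap.pi φ ∘ₗ ((X.map g).hom.hom ∘ₗ z' ∘ₗ b) := rfl
      _ = p ∘ₗ (LinearMap.pi φ ∘ₗ (X.map (a ≫ f)).hom.hom) ∘ₗ y' := by
        rw [← hfg, X.map_comp]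
        rfl
      _ = (p ∘ₗ e) ∘ₗ (X.map a).hom.hom ∘ₗ y' := by
        rw [key]
        rfl
      _ = _ := by rw [hp, LinearMap.id_comp]

end IsDirectedColimit

lemma IsFlatMittagLeffler.isFlatML {M : ModuleCat.{w} A} (hM : IsFlatMittagLeffler M) :
    IsFlatML (A := A) M := by
  obtain ⟨I, _, X, c, _, _, ⟨hc⟩, ⟨e⟩, hML⟩ := hM
  refine ((isDirectedColimit_of_isColimit hc).isFlatML hML).of_retract e.hom.hom e.inv.hom ?_
  exact congrArg ModuleCat.Hom.hom e.hom_inv_id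

/-- The category of finitely generated free modules over `M`. -/
structure FreeOver (A : Type w) [Ring A] (M : Type w) [AddCommGroup M] [Module A M] :
    Type w where
  /-- the rank -/
  rank : ℕ
  /-- the structure map -/
  map : (Fin rank → A) →ₗ[A] M

instance : SmallCategory (FreeOver A M) where
  Hom x y := { a : (Fin x.rank → A) →ₗ[A] (Fin y.rank → A) // y.map ∘ₗ a = x.map }
  id x := ⟨LinearMap.id, rfl⟩
  comp a b := ⟨b.1 ∘ₗ a.1, by rw [← LinearMap.comp_assoc, b.2, a.2]⟩

namespace FreeOver

/-- The underlying free modules. -/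
def forget (A : Type w) [Ring A] (M : Type w) [AddCommGroup M] [Module A M] :
    FreeOver A M ⥤ Pf A where
  obj x := Pf.of (Fin x.rank → A)
  map a := ObjectProperty.homMk (ModuleCat.ofHom a.1)

/-- Factorizations through finitely generated projective modules become arrows of the small category
of free modules over `M`: the middle term is embedded as a summand of a free one. -/
lemma exists_hom_of_comp (x : FreeOver A M) (Y : Pf A) (a : (Fin x.rank → A) →ₗ[A] Y.obj)
    (y : Y.obj →ₗ[A] M) (h : y ∘ₗ a = x.map) :
    ∃ (z : FreeOver A M) (b : x ⟶ z) (e : Y.obj →ₗ[A] (Fin z.rank → A))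
      (p : (Fin z.rank → A) →ₗ[A] Y.obj), b.1 = e ∘ₗ a ∧ p ∘ₗ e = LinearMap.id ∧
        z.map = y ∘ₗ p := by
  obtain ⟨n, e, p, hp⟩ := Y.exists_retract_pi
  refine ⟨⟨n, y ∘ₗ p⟩, ⟨e ∘ₗ a, ?_⟩, e, p, rfl, hp, rfl⟩
  change (y ∘ₗ p) ∘ₗ e ∘ₗ a = _
  rw [← h, LinearMap.comp_assoc, ← LinearMap.comp_assoc a, hp, LinearMap.id_comp]

lemma isFiltered (hM : IsFlatML (A := A) M) : IsFiltered (FreeOver A M) where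
  nonempty := ⟨⟨0, 0⟩⟩
  cocone_objs x y := by
    obtain ⟨z, b, e, p, hb, hp, hz⟩ := exists_hom_of_comp x
      (Pf.of ((Fin x.rank → A) × (Fin y.rank → A))) (LinearMap.inl A _ _)
      (LinearMap.coprod x.map y.map) (LinearMap.coprod_inl _ _)
    refine ⟨z, b, ⟨e ∘ₗ LinearMap.inr A _ _, ?_⟩, trivial⟩
    rw [hz]
    change (LinearMap.coprod x.map y.map) ∘ₗ (p ∘ₗ e) ∘ₗ LinearMap.inr A _ _ = _
    rw [hp]
    exact LinearMap.coprod_inr _ _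
  cocone_maps x y f g := by
    classical
    obtain ⟨Z, c, z, hz, hc⟩ := hM.exists_kill_finset (Pf.of (Fin y.rank → A)) y.map
      (Finset.univ.image fun k => (f.1 - g.1) (Pi.single k 1)) (by
        intro r hr
        obtain ⟨k, -, rfl⟩ := Finset.mem_image.1 hr
        rw [LinearMap.sub_apply, map_sub, sub_eq_zero]
        exact (LinearMap.congr_fun f.2 _).trans (LinearMap.congr_fun g.2 _).symm)
    obtain ⟨u, b, e, p, hb, hp, hu⟩ := exists_hom_of_comp y Z c z hz
    refine ⟨u, b, Subtype.ext ?_⟩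
    change b.1 ∘ₗ f.1 = b.1 ∘ₗ g.1
    refine (Pi.basisFun A _).ext fun k => ?_
    have := hc _ (Finset.mem_image_of_mem _ (Finset.mem_univ k))
    rw [LinearMap.sub_apply, map_sub, sub_eq_zero] at this
    rw [hb, Pi.basisFun_apply]
    exact congrArg e this

end FreeOver

/-- Killing of relations makes the small category of free modules over `M` filtered with colimit
`M`, so a directed poset is final in it; dominated factorizations give the stabilization of dual
images. -/
lemma IsFlatML.isFlatMittagLeffler (hM : IsFlatML (A := A) M) :
    IsFlatMittagLeffler (ModuleCat.of A M) := by
  have := FreeOver.isFiltered hM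
  obtain ⟨I, _, _, _, F, hF⟩ := IsFiltered.exists_directed (FreeOver A M)
  rw [Functor.final_iff_of_isFiltered] at hF
  obtain ⟨hF₁, hF₂⟩ := hF
  have h : IsDirectedColimit (F ⋙ FreeOver.forget A M) M (fun i => (F.obj i).map) :=
    { nonempty := inferInstance
      directed := inferInstance
      compat := fun i j a => (F.map a).2
      exists_rep := fun m => by
        obtain ⟨i, ⟨a⟩⟩ := hF₁ ⟨1, LinearMap.toSpanSingleton A M m ∘ₗ LinearMap.proj 0⟩
        refine ⟨i, a.1 (fun _ => 1), (LinearMap.congr_fun a.2 _).trans ?_⟩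
        simp
      exists_map_eq_zero := fun i x hx => by
        obtain ⟨Y, a, y, h₁, h₂⟩ := hM.exists_kill (Pf.of (Fin (F.obj i).rank → A)) _ x hx
        obtain ⟨z, b, e, p, hb, hp, hz⟩ := FreeOver.exists_hom_of_comp (F.obj i) Y a y h₁
        obtain ⟨k₀, ⟨c⟩⟩ := hF₁ z
        obtain ⟨k, hi, hk⟩ := exists_ge_ge i k₀
        -- The transition map and the route through `z` are parallel maps over `M`; finality makes
        -- them agree one step later.
        obtain ⟨j, t, ht⟩ := hF₂ (F.map (homOfLE hi)) (b ≫ c ≫ F.map (homOfLE hk))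
        refine ⟨j, homOfLE hi ≫ t, ?_⟩
        have e₁ : F.map (homOfLE hi ≫ t) = (b ≫ c ≫ F.map (homOfLE hk)) ≫ F.map t := by
          rw [F.map_comp, ht]
        change (F.map (homOfLE hi ≫ t)).1 x = 0
        rw [e₁]
        change (F.map t).1 ((F.map (homOfLE hk)).1 (c.1 (b.1 x))) = 0
        have e₂ : b.1 x = 0 := (LinearMap.congr_fun hb x).trans ((congrArg e h₂).trans (map_zero e))
        rw [e₂, map_zero, map_zero, map_zero] }
  obtain ⟨c, hc, hM'⟩ := h.exists_isColimit
  refine ⟨I, _, _, c, inferInstance, inferInstance, hc, hM', fun i => ?_⟩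
  obtain ⟨Y, a, y, h₁, h₂⟩ := hM.exists_dominated (Pf.of (Fin (F.obj i).rank → A)) (F.obj i).map
  obtain ⟨z, b, e, p, hb, hp, hz⟩ := FreeOver.exists_hom_of_comp (F.obj i) Y a y h₁
  obtain ⟨k₀, ⟨c⟩⟩ := hF₁ z
  obtain ⟨k, hi, hk⟩ := exists_ge_ge i k₀
  obtain ⟨j, t, ht⟩ := hF₂ (F.map (homOfLE hi)) (b ≫ c ≫ F.map (homOfLE hk))
  have e₁ : F.map (homOfLE hi ≫ t) = b ≫ (c ≫ F.map (homOfLE hk) ≫ F.map t) := by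
    rw [F.map_comp, ht]
    simp only [Category.assoc]
  refine ⟨j, homOfLE hi ≫ t, fun l s => Set.Subset.antisymm ?_ ?_⟩
  · rintro _ ⟨φ, rfl⟩
    refine ⟨φ ∘ₗ ((F ⋙ FreeOver.forget A M).map s).hom.hom, ?_⟩
    dsimp only
    rw [Functor.map_comp _ _ s]
    rfl
  -- The transition map from `i` to `j` factors through the dominated map `a`, and `a` factors
  -- through the transition map from `i` to `l`; so functionals pulled back from `j` are pulled back
  -- from `l`.
  · rintro _ ⟨φ, rfl⟩
    obtain ⟨d, hd⟩ := h₂ (Pf.of (Fin (F.obj l).rank → A)) (F.map ((homOfLE hi ≫ t) ≫ s)).1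
      (F.obj l).map (F.map ((homOfLE hi ≫ t) ≫ s)).2
    refine ⟨φ ∘ₗ (c ≫ F.map (homOfLE hk) ≫ F.map t).1 ∘ₗ e ∘ₗ d, ?_⟩
    have e₂ : ((F ⋙ FreeOver.forget A M).map (homOfLE hi ≫ t)).hom.hom =
      (c ≫ F.map (homOfLE hk) ≫ F.map t).1 ∘ₗ e ∘ₗ a := by
      refine (congrArg Subtype.val e₁).trans ?_
      change (c ≫ F.map (homOfLE hk) ≫ F.map t).1 ∘ₗ b.1 = _
      rw [hb]
    dsimp only
    rw [e₂, ← hd]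
    rfl

end DirectedColimit

/-! ### Splittings of finitely generated projective modules -/

section PfSplit

variable {A : Type w} [Ring A]

lemma Pf.exists_split_idem (Y : Pf A) (e : Y ⟶ Y) (he : e ≫ e = e) :
    ∃ (Z : Pf A) (p : Y ⟶ Z) (s : Z ⟶ Y), s ≫ p = 𝟙 Z ∧ p ≫ s = e := by
  let q : Y.obj →ₗ[A] Y.obj := e.hom.hom
  have hq (y : Y.obj) : q (q y) = q y := LinearMap.congr_fun
    (congrArg (fun t : Y ⟶ Y => t.hom.hom) he) y
  let p : Y.obj →ₗ[A] LinearMap.range q := q.rangeRestrict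
  have hp : p ∘ₗ (LinearMap.range q).subtype = LinearMap.id := by
    apply LinearMap.ext
    rintro ⟨_, y, rfl⟩
    exact Subtype.ext (hq y)
  have : Module.Finite A (LinearMap.range q) :=
    Module.Finite.of_surjective p q.surjective_rangeRestrict
  have : Module.Projective A (LinearMap.range q) := Module.Projective.of_split _ p hp
  refine ⟨Pf.of (LinearMap.range q), ObjectProperty.homMk (ModuleCat.ofHom p),
    ObjectProperty.homMk (ModuleCat.ofHom (LinearMap.range q).subtype), ?_, rfl⟩
  apply ObjectProperty.hom_ext
  apply ModuleCat.hom_ext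
  exact hp

lemma Pf.admMono_of_retraction {X Y : Pf A} {f : X ⟶ Y} {r : Y ⟶ X} (h : f ≫ r = 𝟙 X) :
    (Pf.exactStructure A).conf.AdmMono f := by
  obtain ⟨Z, p, s, h₁, h₂⟩ := Y.exists_split_idem (𝟙 Y - r ≫ f) (by
    simp [Preadditive.sub_comp, Preadditive.comp_sub, reassoc_of% h])
  refine ⟨Z, p, ?_, r, s, h, h₁, ?_, ?_⟩
  · rw [← Category.comp_id p, ← h₁, reassoc_of% h₂]
    simp [Preadditive.sub_comp, Preadditive.comp_sub, reassoc_of% h]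
  · have e : s = s ≫ p ≫ s := by rw [reassoc_of% h₁]
    rw [e, h₂]
    simp [Preadditive.sub_comp, Preadditive.comp_sub, h]
  · rw [h₂]
    abel

end PfSplit

/-! ### Stabilized flat Mittag-Leffler modules as admissible Ind-objects -/

section Stabilization

variable {A : Type w} [Ring A]

/-- A finitely generated projective submodule whose inclusion becomes split in every factorization
through a finitely generated projective module. -/
structure IsLocallySplitSubmodule {N : Type w} [AddCommGroup N] [Module A N]
    (W : Submodule A N) : Prop where
  finite : Module.Finite A W
  projective : Module.Projective A W
  exists_retraction : ∀ (Z : Pf A) (b : W →ₗ[A] Z.obj) (z : Z.obj →ₗ[A] N),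
    z ∘ₗ b = W.subtype → ∃ c : Z.obj →ₗ[A] W, c ∘ₗ b = LinearMap.id

variable {M N : Type w} [AddCommGroup M] [Module A M] [AddCommGroup N] [Module A N]

lemma IsLocallySplit.range {Y : Pf A} {y : Y.obj →ₗ[A] N} (h : IsLocallySplit Y y) :
    IsLocallySplitSubmodule (LinearMap.range y) := by
  let e := LinearEquiv.ofInjective y h.injective
  refine ⟨Module.Finite.equiv e, Module.Projective.of_equiv e, fun Z b z hz => ?_⟩
  obtain ⟨c, hc⟩ := h.exists_retraction Z (b ∘ₗ e.toLinearMap) z (by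
    rw [← LinearMap.comp_assoc, hz]
    rfl)
  refine ⟨e.toLinearMap ∘ₗ c, LinearMap.ext fun v => ?_⟩
  obtain ⟨u, rfl⟩ := e.surjective v
  exact congrArg e (LinearMap.congr_fun hc u)

/-- The diagram given by a monotone family of finitely generated projective submodules. -/
def submoduleDiagram {I : Type w} [PartialOrder I] (W : I → Submodule A N) (hW : Monotone W)
    (h : ∀ i, IsLocallySplitSubmodule (W i)) : I ⥤ Pf A where
  obj i := ⟨ModuleCat.of A (W i), (h i).finite, (h i).projective⟩
  map {i j} a := ObjectProperty.homMk (ModuleCat.ofHom (Submodule.inclusion (hW (leOfHom a))))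

lemma isDirectedColimit_submoduleDiagram {I : Type w} [PartialOrder I] [Nonempty I]
    [IsDirectedOrder I] (W : I → Submodule A N) (hW : Monotone W)
    (h : ∀ i, IsLocallySplitSubmodule (W i)) (hN : ∀ n : N, ∃ i, n ∈ W i) :
    IsDirectedColimit (submoduleDiagram W hW h) N (fun i => (W i).subtype) where
  nonempty := inferInstance
  directed := inferInstance
  compat i j a := rfl
  exists_rep n := by
    obtain ⟨i, hi⟩ := hN n
    exact ⟨i, ⟨n, hi⟩, rfl⟩
  exists_map_eq_zero i x hx := by
    obtain rfl : x = (0 : W i) := Subtype.ext hx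
    exact ⟨i, 𝟙 i, map_zero _⟩

/-- The index set consists of the finite sets of generators of `M × (ℕ →₀ A)`, whose number is
bounded by `κ`. Each is assigned a locally split submodule containing it, in a monotone way. -/
lemma IsFlatML.exists_isDirectedColimit (hM : IsFlatML (A := A) M) {κ : WithTop Cardinal.{w}}
    (hκ : ((Cardinal.aleph0 : Cardinal.{w}) : WithTop Cardinal.{w}) ≤ κ) {s : Set M}
    (hs : ((Cardinal.mk s : Cardinal.{w}) : WithTop Cardinal.{w}) ≤ κ)
    (hsM : Submodule.span A s = ⊤) :
    ∃ (I : Type w) (_ : PartialOrder I) (X : I ⥤ Pf A)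
      (ι : ∀ i, (X.obj i).obj →ₗ[A] M × (ℕ →₀ A)), IsDirectedColimit X (M × (ℕ →₀ A)) ι ∧
      (Pf.exactStructure A).IsAdmissibleIndDiagram κ X := by
  classical
  -- The hull is made a total function; on submodules that are not finitely generated its value is
  -- irrelevant, and a hull of `⊥` is used.
  have hg (V : Submodule A (M × (ℕ →₀ A))) : ∃ W : Submodule A (M × (ℕ →₀ A)),
      IsLocallySplitSubmodule W ∧ (V.FG → V ≤ W) := by
    by_cases hV : V.FG
    · obtain ⟨Y, y, hy, h⟩ := IsLocallySplit.exists_of_fg hM V hV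
      exact ⟨_, hy.range, fun _ => h⟩
    · obtain ⟨Y, y, hy, h⟩ := IsLocallySplit.exists_of_fg hM (⊥ : Submodule A (M × (ℕ →₀ A)))
        Submodule.fg_bot
      exact ⟨_, hy.range, fun h => (hV h).elim⟩
  choose g hg hg' using hg
  let T : Type w := s ⊕ ULift.{w} ℕ
  let t : T → M × (ℕ →₀ A) := Sum.elim (fun m => (m, 0)) (fun n => (0, Finsupp.single n.down 1))
  -- Independently chosen hulls would not be nested, so the hull of `S` is also required to contain
  -- those of its finitely many proper subsets.
  let P : Finset T → Submodule A (M × (ℕ →₀ A)) :=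
    Finset.strongInduction fun S ih => g (Submodule.span A (S.image t) ⊔
      S.ssubsets.attach.sup fun S' => ih S'.1 (Finset.mem_ssubsets.1 S'.2))
  have hP (S : Finset T) : P S = g (Submodule.span A (S.image t) ⊔
      S.ssubsets.attach.sup fun S' => P S'.1) := Finset.strongInduction_eq _ S
  have split (S : Finset T) : IsLocallySplitSubmodule (P S) := by
    rw [hP]
    exact hg _
  have fg (S : Finset T) : (P S).FG := Module.Finite.iff_fg.1 (split S).finite
  have le (S : Finset T) : Submodule.span A (S.image t) ⊔
      (S.ssubsets.attach.sup fun S' => P S'.1) ≤ P S := by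
    conv_rhs => rw [hP]
    exact hg' _ ((Submodule.fg_span (Finset.finite_toSet _)).sup
      (Submodule.fg_finset_sup _ _ fun S' _ => fg S'.1))
  have mono : Monotone P := by
    intro S S' h
    rcases eq_or_ne S S' with rfl | hne
    · rfl
    · refine le_trans ?_ (le_sup_right.trans (le S'))
      exact Finset.le_sup (f := fun S'' : S'.ssubsets => P S''.1)
        (Finset.mem_attach _ ⟨S, Finset.mem_ssubsets.2 (Finset.ssubset_iff_subset_ne.2 ⟨h, hne⟩)⟩)
  have mem (S : Finset T) (x : T) (hx : x ∈ S) : t x ∈ P S :=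
    (le_sup_left.trans (le S)) (Submodule.subset_span (Finset.mem_image_of_mem t hx))
  have cover (n : M × (ℕ →₀ A)) : ∃ S, n ∈ P S := by
    let V : Submodule A (M × (ℕ →₀ A)) := ⨆ S, P S
    have hV (n) : n ∈ V ↔ ∃ S, n ∈ P S := Submodule.mem_iSup_of_directed P mono.directed_le
    have ht (x : T) : t x ∈ V := (hV _).2 ⟨{x}, mem _ _ (Finset.mem_singleton_self x)⟩
    have h₁ : ⊤ ≤ V.comap (LinearMap.inl A M (ℕ →₀ A)) := by
      rw [← hsM, Submodule.span_le]
      intro m hm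
      exact ht (Sum.inl ⟨m, hm⟩)
    have h₂ : ⊤ ≤ V.comap (LinearMap.inr A M (ℕ →₀ A)) := by
      intro f _
      induction f using Finsupp.induction_linear with
      | zero => exact zero_mem _
      | add f f' hf hf' => exact add_mem (hf trivial) (hf' trivial)
      | single n a =>
        rw [← mul_one a, ← smul_eq_mul, ← Finsupp.smul_single]
        exact Submodule.smul_mem _ a (ht (Sum.inr ⟨n⟩))
    rw [← hV]
    have := V.add_mem (h₁ (Submodule.mem_top (x := n.1))) (h₂ (Submodule.mem_top (x := n.2)))
    simpa using this
  refine ⟨Finset T, inferInstance, submoduleDiagram P mono split, _,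
    isDirectedColimit_submoduleDiagram P mono split cover, inferInstance, inferInstance, ?_, ?_⟩
  · have : Infinite T := inferInstance
    rw [Cardinal.mk_finset_of_infinite]
    cases κ with
    | top => exact le_top
    | coe c =>
      rw [WithTop.coe_le_coe] at hs hκ ⊢
      simp only [T, Cardinal.mk_sum, Cardinal.lift_id, Cardinal.mk_uLift, Cardinal.mk_nat,
        Cardinal.lift_aleph0]
      exact Cardinal.add_le_of_le hκ hs hκ
  · intro S S' a
    have := (split S').finite
    have := (split S').projective
    -- The larger submodule is itself a finitely generated projective module through which the
    -- inclusion of the smaller one factors, so local splitness applies to it.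
    obtain ⟨c, hc⟩ := (split S).exists_retraction (Pf.of (P S'))
      (Submodule.inclusion (mono (leOfHom a))) (P S').subtype rfl
    refine Pf.admMono_of_retraction (r := ObjectProperty.homMk (ModuleCat.ofHom c)) ?_
    apply ObjectProperty.hom_ext
    apply ModuleCat.hom_ext
    exact hc

end Stabilization

/-! ### Modules as presheaves on finitely generated projectives -/

section HomPresheaf

variable {A : Type w} [Ring A]

/-- The presheaf `Hom(-, M)` on finitely generated projective modules. -/
def homPresheaf (A : Type w) [Ring A] : ModuleCat.{w} A ⥤ ((Pf A)ᵒᵖ ⥤ AddCommGrpCat.{w}) where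
  obj M :=
    { obj := fun U => AddCommGrpCat.of (U.unop.obj →ₗ[A] M)
      map := fun f => AddCommGrpCat.ofHom (AddMonoidHom.mk' (fun φ => φ ∘ₗ f.unop.hom.hom)
        fun _ _ => rfl) }
  map f := { app := fun U => AddCommGrpCat.ofHom (AddMonoidHom.mk' (fun φ => f.hom ∘ₗ φ)
    fun _ _ => LinearMap.comp_add _ _ _) }

instance (M : ModuleCat.{w} A) : ((homPresheaf A).obj M).Additive where
  map_add {U V f g} := by
    apply AddCommGrpCat.ext
    intro (x : U.unop.obj →ₗ[A] M)
    exact LinearMap.comp_add _ _ x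

instance : (homPresheaf A).Additive where
  map_add {M N f g} := by
    apply NatTrans.ext
    funext U
    apply AddCommGrpCat.ext
    intro (x : U.unop.obj →ₗ[A] M)
    exact LinearMap.add_comp x _ _

instance : (homPresheaf A).Faithful where
  map_injective {M N f g} h := by
    apply ModuleCat.hom_ext
    apply LinearMap.ext
    intro m
    have h₁ := ConcreteCategory.congr_hom (NatTrans.congr_app h (op (Pf.of A)))
      (LinearMap.toSpanSingleton A M m)
    have h₂ : f.hom ∘ₗ LinearMap.toSpanSingleton A M m =
      g.hom ∘ₗ LinearMap.toSpanSingleton A M m := h₁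
    simpa using LinearMap.congr_fun h₂ 1

/-- The value at the free module of rank one is the module itself. Naturality for endomorphisms of
`A` gives linearity, and naturality along maps from `A` to `U` recovers the transformation. -/
instance : (homPresheaf A).Full where
  map_surjective {M N} φ := by
    let F (U : Pf A) (s : U.obj →ₗ[A] M) : U.obj →ₗ[A] N := φ.app (op U) s
    have nat {U V : Pf A} (a : V.obj →ₗ[A] U.obj) (s : U.obj →ₗ[A] M) :
        F V (s ∘ₗ a) = F U s ∘ₗ a :=
      app_res φ (U := U) (V := V) (ObjectProperty.homMk (ModuleCat.ofHom a)) s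
    have add (s s' : A →ₗ[A] M) : F (Pf.of A) (s + s') = F (Pf.of A) s + F (Pf.of A) s' :=
      map_add (φ.app (op (Pf.of A))).hom s s'
    let f : M →ₗ[A] N :=
      { toFun := fun m => F (Pf.of A) (LinearMap.toSpanSingleton A M m) (1 : A)
        map_add' := fun m m' => by
          rw [LinearMap.toSpanSingleton_add, add]
          rfl
        map_smul' := fun a m => by
          have : LinearMap.toSpanSingleton A M (a • m) =
              LinearMap.toSpanSingleton A M m ∘ₗ LinearMap.toSpanSingleton A A a := by
            ext
            simp
          rw [this, nat (U := Pf.of A) (V := Pf.of A)]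
          change F (Pf.of A) (LinearMap.toSpanSingleton A M m) ((1 : A) • a) = _
          rw [one_smul, RingHom.id_apply, ← map_smul, smul_eq_mul, mul_one] }
    refine ⟨ModuleCat.ofHom f, ?_⟩
    apply NatTrans.ext
    funext U
    apply AddCommGrpCat.ext
    intro (s : U.unop.obj →ₗ[A] M)
    apply LinearMap.ext
    intro u
    change F (Pf.of A) (LinearMap.toSpanSingleton A M (s u)) (1 : A) = F U.unop s u
    have : LinearMap.toSpanSingleton A M (s u) =
        s ∘ₗ LinearMap.toSpanSingleton A U.unop.obj u := by
      ext
      simp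
    rw [this, nat (U := U.unop) (V := Pf.of A)]
    simp

/-- On finitely generated projective modules, `homPresheaf` is the Yoneda embedding. -/
def ιCompHomPresheaf (A : Type w) [Ring A] :
    (IsPf A).ι ⋙ homPresheaf A ≅ preadditiveYoneda :=
  NatIso.ofComponents (fun X => NatIso.ofComponents (fun U =>
    { hom := AddCommGrpCat.ofHom (AddMonoidHom.mk' (fun s : U.unop.obj →ₗ[A] X.obj =>
        (ObjectProperty.homMk (ModuleCat.ofHom s) : U.unop ⟶ X)) fun _ _ => rfl)
      inv := AddCommGrpCat.ofHom (AddMonoidHom.mk' (fun s : U.unop ⟶ X => s.hom.hom)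
        fun _ _ => rfl)
      hom_inv_id := rfl
      inv_hom_id := rfl }) fun _ => rfl) fun _ => rfl

variable {κ : WithTop Cardinal.{w}} {I : Type w} [PartialOrder I] {X : I ⥤ Pf A}
  {M : Type w} [AddCommGroup M] [Module A M] {ι : ∀ i, (X.obj i).obj →ₗ[A] M}

/-- The presentation of `Hom(-, M)` given by a presentation of `M`. -/
def IsDirectedColimit.indPres (h : IsDirectedColimit X M ι)
    (hX : (Pf.exactStructure A).IsAdmissibleIndDiagram κ X) :
    IndPres (Pf.exactStructure A) κ ((homPresheaf A).obj (ModuleCat.of A M)) where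
  I := I
  X := X
  adm := hX
  ξ i := ι i
  compat a := h.compat a
  surj {U} s := by
    obtain ⟨i, a, ha⟩ := h.exists_lift U s
    exact ⟨i, ObjectProperty.homMk (ModuleCat.ofHom a), ha.symm⟩
  inj {U i} a b hab := by
    obtain ⟨j, c, hc⟩ := h.exists_map_comp_eq_zero U i (a.hom.hom - b.hom.hom) (by
      rw [LinearMap.comp_sub, sub_eq_zero]
      exact hab)
    have := (Pf.exactStructure A).mono_of_admMono (hX.admMono c)
    rw [← cancel_mono (X.map c)]
    apply ObjectProperty.hom_ext
    apply ModuleCat.hom_ext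
    rw [LinearMap.comp_sub, sub_eq_zero] at hc
    exact hc
  additive := inferInstance

lemma Pf.exists_retraction_of_admMono {X Y : Pf A} {f : X ⟶ Y}
    (h : (Pf.exactStructure A).conf.AdmMono f) : ∃ r : Y ⟶ X, f ≫ r = 𝟙 X := by
  obtain ⟨Z, g, -, r, s, h, -⟩ := h
  exact ⟨r, h⟩

lemma Pf.exists_section_of_admEpi {Y Z : Pf A} {g : Y ⟶ Z}
    (h : (Pf.exactStructure A).conf.AdmEpi g) : ∃ s : Z ⟶ Y, s ≫ g = 𝟙 Z := by
  obtain ⟨X, f, -, r, s, -, h, -⟩ := h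
  exact ⟨s, h⟩

/-- Admissible monics are split, so every functional on a stage extends to all later stages and the
dual images are stable from the start. -/
lemma IsDirectedColimit.isFlatML_of_isAdmissible (h : IsDirectedColimit X M ι)
    (hX : (Pf.exactStructure A).IsAdmissibleIndDiagram κ X) : IsFlatML (A := A) M := by
  refine h.isFlatML fun i => ⟨i, 𝟙 i, fun k b => ?_⟩
  obtain ⟨r, hr⟩ := Pf.exists_retraction_of_admMono (hX.admMono b)
  have hr' : r.hom.hom ∘ₗ (X.map b).hom.hom = LinearMap.id :=
    congrArg (fun t : X.obj i ⟶ X.obj i => t.hom.hom) hr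
  rw [X.map_id, Category.id_comp]
  refine Set.Subset.antisymm ?_ ?_
  · rintro _ ⟨φ, rfl⟩
    exact ⟨φ ∘ₗ (X.map b).hom.hom, rfl⟩
  · rintro _ ⟨φ, rfl⟩
    refine ⟨φ ∘ₗ r.hom.hom, ?_⟩
    exact (congrArg (fun t => φ ∘ₗ t) hr')

lemma IsDirectedColimit.exists_generators (h : IsDirectedColimit X M ι)
    (hκ : ((Cardinal.aleph0 : Cardinal.{w}) : WithTop Cardinal.{w}) ≤ κ)
    (hI : ((Cardinal.mk I : Cardinal.{w}) : WithTop Cardinal.{w}) ≤ κ) :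
    ∃ s : Set M, ((Cardinal.mk s : Cardinal.{w}) : WithTop Cardinal.{w}) ≤ κ ∧
      Submodule.span A s = ⊤ := by
  choose g hg using fun i => Module.Finite.fg_top (R := A) (M := (X.obj i).obj)
  refine ⟨⋃ i, ι i '' g i, ?_, ?_⟩
  · have h₁ : Cardinal.mk (⋃ i, ι i '' g i) ≤ Cardinal.mk I * Cardinal.aleph0 := by
      refine (Cardinal.mk_iUnion_le _).trans ?_
      gcongr
      refine ciSup_le' fun i => ?_
      exact ((g i).finite_toSet.image _).countable.le_aleph0
    cases κ with
    | top => exact le_top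
    | coe c =>
      rw [WithTop.coe_le_coe] at hI hκ ⊢
      exact h₁.trans (Cardinal.mul_le_of_le hκ hI hκ)
  · rw [eq_top_iff]
    rintro m -
    obtain ⟨i, x, rfl⟩ := h.exists_rep m
    have hx : x ∈ Submodule.span A (g i : Set (X.obj i).obj) := by
      rw [hg]
      trivial
    have := Submodule.mem_map_of_mem (f := ι i) hx
    rw [Submodule.map_span] at this
    refine Submodule.span_mono ?_ this
    rintro _ ⟨y, hy, rfl⟩
    exact Set.mem_iUnion.2 ⟨i, y, hy, rfl⟩

lemma IsFMModule.isIndObject {M : ModuleCat.{w} A} (hM : IsFMModule A κ M)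
    (hκ : ((Cardinal.aleph0 : Cardinal.{w}) : WithTop Cardinal.{w}) ≤ κ) :
    (Pf.exactStructure A).IsIndObject κ
      ((homPresheaf A).obj (ModuleCat.of A (M × (ℕ →₀ A)))) := by
  obtain ⟨hM, s, hs, hs'⟩ := hM
  obtain ⟨I, _, X, ι, h, hX⟩ := hM.isFlatML.exists_isDirectedColimit hκ hs hs'
  exact (h.indPres hX).isIndObject

/-- The module is the colimit of the presenting diagram. Its presheaf is presented by the same
diagram, hence is a colimit of the same representables. -/
lemma IndPres.exists_homPresheaf_iso {P : (Pf A)ᵒᵖ ⥤ AddCommGrpCat.{w}}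
    (p : IndPres (Pf.exactStructure A) κ P)
    (hκ : ((Cardinal.aleph0 : Cardinal.{w}) : WithTop Cardinal.{w}) ≤ κ) :
    ∃ M : ModuleCat.{w} A, IsFMModule A κ M ∧ Nonempty (P ≅ (homPresheaf A).obj M) := by
  have := p.adm.nonempty
  have := p.adm.directed
  have h := isDirectedColimit_of_isColimit (colimit.isColimit (p.X ⋙ (IsPf A).ι))
  let q := h.indPres p.adm
  let c : Cocone (p.X ⋙ preadditiveYoneda) := q.cocone
  have hc : IsColimit c := q.isColimitCocone
  refine ⟨ModuleCat.of A (colimit (p.X ⋙ (IsPf A).ι) : ModuleCat.{w} A), ⟨?_, ?_⟩,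
    ⟨p.isColimitCocone.coconePointUniqueUpToIso hc⟩⟩
  · exact (h.isFlatML_of_isAdmissible p.adm).isFlatMittagLeffler
  · exact h.exists_generators hκ p.adm.card_le

end HomPresheaf

/-! ### Flat Mittag-Leffler modules as the idempotent completion -/

section ModuleRealization

/-- An isomorphism in the idempotent completion, from two maps whose composites are the given
idempotents. -/
def karoubiIso {B : Type u} [Category.{v} B] {X Y : Idempotents.Karoubi B} (a : X.X ⟶ Y.X)
    (b : Y.X ⟶ X.X) (h : a ≫ b = X.p) (h' : b ≫ a = Y.p) : X ≅ Y where
  hom := ⟨X.p ≫ a, by rw [← h', ← h]; simp [reassoc_of% h]⟩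
  inv := ⟨b ≫ X.p, by rw [← h', ← h]; simp [reassoc_of% h']⟩
  hom_inv_id := by
    apply Idempotents.Karoubi.hom_ext
    change (X.p ≫ a) ≫ b ≫ X.p = X.p
    simp only [Category.assoc, reassoc_of% h, X.idem]
  inv_hom_id := by
    apply Idempotents.Karoubi.hom_ext
    change (b ≫ X.p) ≫ X.p ≫ a = Y.p
    rw [← h]
    simp only [Category.assoc, reassoc_of% h', h', Y.idem]

variable {A : Type w} [Ring A] {κ : WithTop Cardinal.{w}}
  (hκ : ((Cardinal.aleph0 : Cardinal.{w}) : WithTop Cardinal.{w}) ≤ κ)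

/-- The map of stabilizations that is `f` on the given summands and zero on the free ones. -/
def stabMap {M N : Type w} [AddCommGroup M] [Module A M] [AddCommGroup N] [Module A N]
    (f : M →ₗ[A] N) : M × (ℕ →₀ A) →ₗ[A] N × (ℕ →₀ A) :=
  LinearMap.inl A _ _ ∘ₗ f ∘ₗ LinearMap.fst A _ _

lemma prodMap_comp_stabMap_id {M N : Type w} [AddCommGroup M] [Module A M] [AddCommGroup N]
    [Module A N] (f : M →ₗ[A] N) (i : (ℕ →₀ A) →ₗ[A] (ℕ →₀ A)) :
    LinearMap.prodMap f i ∘ₗ stabMap LinearMap.id = stabMap LinearMap.id ∘ₗ stabMap f :=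
  LinearMap.ext fun _ => Prod.ext rfl (map_zero i)

/-- The stabilization of a flat Mittag-Leffler module, as an admissible Ind-object. -/
def FMMod.stab (M : FMMod A κ) : Ind (Pf.exactStructure A) κ :=
  ⟨(homPresheaf A).obj (ModuleCat.of A (M.obj × (ℕ →₀ A))), M.property.isIndObject hκ⟩

/-- The map of stabilizations given by a linear map. -/
def FMMod.stabHom {M N : FMMod A κ}
    (f : M.obj × (ℕ →₀ A) →ₗ[A] N.obj × (ℕ →₀ A)) : M.stab hκ ⟶ N.stab hκ :=
  ObjectProperty.homMk ((homPresheaf A).map (ModuleCat.ofHom f))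

lemma FMMod.stabHom_injective {M N : FMMod A κ}
    {f g : M.obj × (ℕ →₀ A) →ₗ[A] N.obj × (ℕ →₀ A)}
    (h : FMMod.stabHom hκ f = FMMod.stabHom hκ g) : f = g := by
  have := (homPresheaf A).map_injective (congrArg (fun t => t.hom) h)
  exact congrArg ModuleCat.Hom.hom this

lemma FMMod.stabHom_surjective {M N : FMMod A κ} (φ : M.stab hκ ⟶ N.stab hκ) :
    ∃ f, FMMod.stabHom hκ f = φ := by
  obtain ⟨f, hf⟩ := (homPresheaf A).map_surjective φ.hom
  exact ⟨f.hom, ObjectProperty.hom_ext _ hf⟩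

/-- Flat Mittag-Leffler modules as flat Mittag-Leffler objects of the category of finitely generated
projective modules. -/
def FMMod.toFM : FMMod A κ ⥤ FM (Pf.exactStructure A) κ where
  obj M := ⟨M.stab hκ, FMMod.stabHom hκ (stabMap LinearMap.id), rfl⟩
  map {M N} f := ⟨FMMod.stabHom hκ (stabMap f.hom.hom), rfl⟩
  map_id _ := rfl
  map_comp _ _ := rfl

instance : (FMMod.toFM (A := A) hκ).Faithful where
  map_injective {M N f g} h := by
    have h' := FMMod.stabHom_injective hκ (congrArg (fun t => t.f) h)
    apply ObjectProperty.hom_ext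
    apply ModuleCat.hom_ext
    apply LinearMap.ext
    intro m
    exact congrArg Prod.fst (LinearMap.congr_fun h' (m, 0))

/-- A map of the completion absorbs the idempotents that kill the free summands, so only its
component from `M` to `N` survives. -/
instance : (FMMod.toFM (A := A) hκ).Full where
  map_surjective {M N} φ := by
    obtain ⟨g, hg⟩ := FMMod.stabHom_surjective hκ φ.f
    refine ⟨ObjectProperty.homMk (ModuleCat.ofHom
      (LinearMap.fst A _ _ ∘ₗ g ∘ₗ LinearMap.inl A _ _)), ?_⟩
    apply Idempotents.Karoubi.hom_ext
    refine Eq.trans ?_ φ.comm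
    rw [← hg]
    rfl

instance : (FMMod.toFM (A := A) hκ).Additive where
  map_add {M N f g} := by
    apply Idempotents.Karoubi.hom_ext
    apply ObjectProperty.hom_ext
    change (homPresheaf A).map (ModuleCat.ofHom (stabMap (f.hom.hom + g.hom.hom))) =
      (homPresheaf A).map (ModuleCat.ofHom (stabMap f.hom.hom)) +
        (homPresheaf A).map (ModuleCat.ofHom (stabMap g.hom.hom))
    rw [← (homPresheaf A).map_add]
    congr 1
    apply ModuleCat.hom_ext
    simp only [stabMap, LinearMap.add_comp, LinearMap.comp_add, ModuleCat.hom_add,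
      ModuleCat.hom_ofHom]

lemma IsFMModule.of_retract {M N : ModuleCat.{w} A} (hM : IsFMModule A κ M) (i : N →ₗ[A] M)
    (r : M →ₗ[A] N) (h : r ∘ₗ i = LinearMap.id) : IsFMModule A κ N := by
  obtain ⟨hM, s, hs, hs'⟩ := hM
  refine ⟨(hM.isFlatML.of_retract i r h).isFlatMittagLeffler, r '' s, ?_, ?_⟩
  · refine le_trans ?_ hs
    rw [WithTop.coe_le_coe]
    exact Cardinal.mk_image_le
  · rw [← Submodule.map_span, hs', Submodule.map_top, LinearMap.range_eq_top]
    exact fun n => ⟨i n, LinearMap.congr_fun h n⟩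

/-- The underlying Ind-object is `Hom(-, N)` for a module `N`, and full faithfulness turns the
idempotent into one of `N`. Its image is a retract of `N`, hence again flat Mittag-Leffler, and
represents `Y`. -/
instance : (FMMod.toFM (A := A) hκ).EssSurj where
  mem_essImage Y := by
    obtain ⟨N, hN, ⟨θ⟩⟩ := (Ind.pres Y.X).exists_homPresheaf_iso hκ
    obtain ⟨ε, hε⟩ := (homPresheaf A).map_surjective (θ.inv ≫ Y.p.hom ≫ θ.hom)
    have idem : Y.p.hom ≫ Y.p.hom = Y.p.hom := congrArg (fun t => t.hom) Y.idem
    have hε' : ε ≫ ε = ε := by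
      apply (homPresheaf A).map_injective
      rw [Functor.map_comp, hε]
      simp [reassoc_of% idem]
    let q : N →ₗ[A] N := ε.hom
    have hq (y : N) : q (q y) = q y := LinearMap.congr_fun (congrArg ModuleCat.Hom.hom hε') y
    have hp : q.rangeRestrict ∘ₗ (LinearMap.range q).subtype = LinearMap.id := by
      apply LinearMap.ext
      rintro ⟨_, y, rfl⟩
      exact Subtype.ext (hq y)
    let M : FMMod A κ := ⟨ModuleCat.of A (LinearMap.range q),
      hN.of_retract (LinearMap.range q).subtype q.rangeRestrict hp⟩
    let a : ModuleCat.of A (M.obj × (ℕ →₀ A)) ⟶ N :=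
      ModuleCat.ofHom ((LinearMap.range q).subtype ∘ₗ LinearMap.fst A _ _)
    let b : N ⟶ ModuleCat.of A (M.obj × (ℕ →₀ A)) :=
      ModuleCat.ofHom (LinearMap.inl A _ _ ∘ₗ q.rangeRestrict)
    have hab : a ≫ b = ModuleCat.ofHom (stabMap LinearMap.id) := by
      apply ModuleCat.hom_ext
      apply LinearMap.ext
      intro v
      exact congrArg (fun t => (t, (0 : ℕ →₀ A))) (LinearMap.congr_fun hp v.1)
    have hba : b ≫ a = ε := rfl
    refine ⟨M, ⟨karoubiIso (X := (FMMod.toFM hκ).obj M)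
      (ObjectProperty.homMk ((homPresheaf A).map a ≫ θ.inv))
      (ObjectProperty.homMk (θ.hom ≫ (homPresheaf A).map b)) ?_ ?_⟩⟩
    · apply ObjectProperty.hom_ext
      change ((homPresheaf A).map a ≫ θ.inv) ≫ θ.hom ≫ (homPresheaf A).map b =
        (homPresheaf A).map (ModuleCat.ofHom (stabMap LinearMap.id))
      rw [Category.assoc, Iso.inv_hom_id_assoc, ← Functor.map_comp, hab]
    · apply ObjectProperty.hom_ext
      change (θ.hom ≫ (homPresheaf A).map b) ≫ (homPresheaf A).map a ≫ θ.inv = Y.p.hom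
      rw [Category.assoc, ← Functor.map_comp_assoc, hba, hε]
      simp

instance : (FMMod.toFM (A := A) hκ).IsEquivalence where

/-- Finitely generated projective modules are sent to themselves. -/
def toFMModCompToFM : Pf.toFMMod A κ hκ ⋙ FMMod.toFM hκ ≅ FM.incl (Pf.exactStructure A) κ hκ :=
  NatIso.ofComponents (fun X => karoubiIso
    (X := (FMMod.toFM hκ).obj ((Pf.toFMMod A κ hκ).obj X))
    (Y := (FM.incl (Pf.exactStructure A) κ hκ).obj X)
    (ObjectProperty.homMk ((homPresheaf A).map (ModuleCat.ofHom (LinearMap.fst A _ _)) ≫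
      (ιCompHomPresheaf A).hom.app X))
    (ObjectProperty.homMk ((ιCompHomPresheaf A).inv.app X ≫
      (homPresheaf A).map (ModuleCat.ofHom (LinearMap.inl A _ _))))
    (by
      apply ObjectProperty.hom_ext
      rfl)
    (by
      apply ObjectProperty.hom_ext
      rfl))
    (fun f => by
      apply Idempotents.Karoubi.hom_ext
      apply ObjectProperty.hom_ext
      rfl)

/-- The test objects are projective modules, so sections lift along a surjection globally and the
identity serves as cover. -/
lemma indExact_homPresheaf {L M N : Type w} [AddCommGroup L] [Module A L] [AddCommGroup M]
    [Module A M] [AddCommGroup N] [Module A N] {f : L →ₗ[A] M} {g : M →ₗ[A] N}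
    (hf : Function.Injective f) (hfg : Function.Exact f g) (hg : Function.Surjective g)
    (hL : (Pf.exactStructure A).IsIndObject κ ((homPresheaf A).obj (ModuleCat.of A L)))
    (hM : (Pf.exactStructure A).IsIndObject κ ((homPresheaf A).obj (ModuleCat.of A M)))
    (hN : (Pf.exactStructure A).IsIndObject κ ((homPresheaf A).obj (ModuleCat.of A N))) :
    indExact (Pf.exactStructure A) κ (X := ⟨_, hL⟩) (Y := ⟨_, hM⟩) (Z := ⟨_, hN⟩)
      (ObjectProperty.homMk ((homPresheaf A).map (ModuleCat.ofHom f)))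
      (ObjectProperty.homMk ((homPresheaf A).map (ModuleCat.ofHom g))) := by
  refine ⟨fun U => ⟨fun s t h => ?_, fun t => ⟨fun h => ?_, ?_⟩⟩, fun U z => ?_⟩
  · change U.obj →ₗ[A] L at s t
    replace h : f ∘ₗ s = f ∘ₗ t := h
    exact LinearMap.ext fun u => hf (LinearMap.congr_fun h u)
  · change U.obj →ₗ[A] M at t
    replace h : g ∘ₗ t = 0 := h
    have ht (u : U.obj) : t u ∈ LinearMap.range f := (hfg _).1 (LinearMap.congr_fun h u)
    refine ⟨(LinearEquiv.ofInjective f hf).symm.toLinearMap ∘ₗ t.codRestrict _ ht, ?_⟩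
    apply LinearMap.ext
    intro u
    exact congrArg Subtype.val ((LinearEquiv.ofInjective f hf).apply_symm_apply ⟨t u, ht u⟩)
  · rintro ⟨s, rfl⟩
    change U.obj →ₗ[A] L at s
    apply LinearMap.ext
    intro u
    exact hfg.apply_apply_eq_zero (s u)
  · obtain ⟨y, hy⟩ := Module.projective_lifting_property g (show U.obj →ₗ[A] N from z) hg
    exact ⟨U, 𝟙 U, y, ExactStructure.id_admEpi _ _, hy⟩

/-- All stabilizations use the same free module, so its three copies must themselves fit into a
short exact sequence; a bijection of `ℕ` with two copies of `ℕ` provides one. -/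
lemma exists_exact_finsupp (A : Type w) [Ring A] : ∃ (i p : (ℕ →₀ A) →ₗ[A] (ℕ →₀ A)),
    Function.Injective i ∧ Function.Exact i p ∧ Function.Surjective p := by
  let e : (ℕ →₀ A) ≃ₗ[A] (ℕ →₀ A) × (ℕ →₀ A) :=
    Finsupp.domLCongr Equiv.natSumNatEquivNat.symm ≪≫ₗ
      Finsupp.sumFinsuppLEquivProdFinsupp A
  refine ⟨e.symm.toLinearMap ∘ₗ LinearMap.inl A _ _, LinearMap.snd A _ _ ∘ₗ e.toLinearMap,
    e.symm.injective.comp (LinearMap.inl_injective (R := A)), fun y => ⟨fun h => ?_, ?_⟩,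
    (LinearMap.snd_surjective (R := A)).comp e.surjective⟩
  · refine ⟨(e y).1, e.injective ?_⟩
    refine (e.apply_symm_apply _).trans (Prod.ext rfl ?_)
    exact Eq.symm h
  · rintro ⟨x, rfl⟩
    exact congrArg Prod.snd (e.apply_symm_apply (x, 0))

lemma fmExact_toFM {L M N : FMMod A κ} {f : L ⟶ M} {g : M ⟶ N} (h : fmModExact A κ f g) :
    fmExact (Pf.exactStructure A) κ ((FMMod.toFM hκ).map f) ((FMMod.toFM hκ).map g) := by
  obtain ⟨hf, hfg, hg⟩ := h
  obtain ⟨i, p, hi, hip, hp⟩ := exists_exact_finsupp A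
  refine (SeqClass.karoubi_iff _ _ _).2 ⟨L.stab hκ, M.stab hκ, N.stab hκ,
    FMMod.stabHom hκ (LinearMap.prodMap f.hom.hom i),
    FMMod.stabHom hκ (LinearMap.prodMap g.hom.hom p),
    Idempotents.Karoubi.decompId_i ((FMMod.toFM hκ).obj L),
    Idempotents.Karoubi.decompId_p ((FMMod.toFM hκ).obj L),
    Idempotents.Karoubi.decompId_i ((FMMod.toFM hκ).obj M),
    Idempotents.Karoubi.decompId_p ((FMMod.toFM hκ).obj M),
    Idempotents.Karoubi.decompId_i ((FMMod.toFM hκ).obj N),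
    Idempotents.Karoubi.decompId_p ((FMMod.toFM hκ).obj N), ?_,
    (Idempotents.Karoubi.decompId _).symm, (Idempotents.Karoubi.decompId _).symm,
    (Idempotents.Karoubi.decompId _).symm, ?_, ?_, ?_, ?_⟩
  · refine indExact_homPresheaf (hf.prodMap hi) (fun y => ⟨fun h => ?_, ?_⟩) (hg.prodMap hp) _ _ _
    · obtain ⟨u, hu⟩ := (hfg y.1).1 (congrArg Prod.fst h)
      obtain ⟨v, hv⟩ := (hip y.2).1 (congrArg Prod.snd h)
      exact ⟨(u, v), Prod.ext hu hv⟩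
    · rintro ⟨u, rfl⟩
      exact Prod.ext (hfg.apply_apply_eq_zero u.1) (hip.apply_apply_eq_zero u.2)
  · apply Idempotents.Karoubi.hom_ext
    exact congrArg (FMMod.stabHom hκ (M := L) (N := M)) (prodMap_comp_stabMap_id f.hom.hom i).symm
  · apply Idempotents.Karoubi.hom_ext
    rfl
  · apply Idempotents.Karoubi.hom_ext
    exact congrArg (FMMod.stabHom hκ (M := M) (N := N)) (prodMap_comp_stabMap_id g.hom.hom p).symm
  · apply Idempotents.Karoubi.hom_ext
    rfl

/-- The action of a map of flat Mittag-Leffler objects on sections. -/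
def FM.act {C : Type u} [Category.{v} C] [Preadditive C] {E : ExactStructure C}
    {κ : WithTop Cardinal.{v}} {X Y : FM E κ} (φ : X ⟶ Y) (U : C) :
    X.X.obj.obj (op U) →+ Y.X.obj.obj (op U) := (φ.f.hom.app (op U)).hom

lemma FM.act_act {C : Type u} [Category.{v} C] [Preadditive C] {E : ExactStructure C}
    {κ : WithTop Cardinal.{v}} {X Y Z W : FM E κ} {φ : X ⟶ Y} {ψ : Y ⟶ Z} {φ' : X ⟶ W}
    {ψ' : W ⟶ Z} (h : φ ≫ ψ = φ' ≫ ψ') {U : C} (s : X.X.obj.obj (op U)) :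
    FM.act ψ U (FM.act φ U s) = FM.act ψ' U (FM.act φ' U s) :=
  congrArg (fun t => FM.act t U s) h

/-- Sections over `A` recover the modules, and each exactness condition passes from the ambient
sequence of Ind-objects to its retract by a diagram chase. -/
lemma fmModExact_of_toFM {L M N : FMMod A κ} {f : L ⟶ M} {g : M ⟶ N}
    (h : fmExact (Pf.exactStructure A) κ ((FMMod.toFM hκ).map f) ((FMMod.toFM hκ).map g)) :
    fmModExact A κ f g := by
  obtain ⟨A₀, A₁, A₂, a, b, i₀, r₀, i₁, r₁, i₂, r₂, S, e₀, e₁, e₂, k₁, k₂, k₃, k₄⟩ :=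
    (SeqClass.karoubi_iff _ _ _).1 h
  let V : Pf A := Pf.of A
  -- An element of `M` is viewed as a section over `A` of the stabilization with zero free
  -- component; `π` forgets the free component.
  let σ {M : FMMod A κ} (m : M.obj) : ((FMMod.toFM hκ).obj M).X.obj.obj (op V) :=
    LinearMap.inl A M.obj (ℕ →₀ A) ∘ₗ LinearMap.toSpanSingleton A M.obj m
  let π {M : FMMod A κ} (s : ((FMMod.toFM hκ).obj M).X.obj.obj (op V)) : M.obj :=
    ((show V.obj →ₗ[A] M.obj × (ℕ →₀ A) from s) (1 : A)).1
  have πσ {M : FMMod A κ} (m : M.obj) : π (σ m) = m := one_smul A m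
  have σ₀ {M : FMMod A κ} : σ (0 : M.obj) = 0 := by
    apply LinearMap.ext
    intro v
    exact Prod.ext (smul_zero v) rfl
  have π₀ {M : FMMod A κ} : π (0 : ((FMMod.toFM hκ).obj M).X.obj.obj (op V)) = 0 := rfl
  have actσ {M N : FMMod A κ} (f : M ⟶ N) (m : M.obj) :
      FM.act ((FMMod.toFM hκ).map f) V (σ m) = σ (f.hom.hom m) := by
    apply LinearMap.ext
    intro (v : A)
    exact Prod.ext (map_smul f.hom.hom v m) rfl
  have πact {M N : FMMod A κ} (f : M ⟶ N) (s : ((FMMod.toFM hκ).obj M).X.obj.obj (op V)) :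
      π (FM.act ((FMMod.toFM hκ).map f) V s) = f.hom.hom (π s) := rfl
  have ret {M : FMMod A κ} {B : Ind (Pf.exactStructure A) κ}
      {i : (FMMod.toFM hκ).obj M ⟶ (Idempotents.toKaroubi _).obj B}
      {r : (Idempotents.toKaroubi _).obj B ⟶ (FMMod.toFM hκ).obj M} (h : i ≫ r = 𝟙 _)
      (m : M.obj) : π (FM.act r V (FM.act i V (σ m))) = m :=
    (congrArg (fun t => π (FM.act t V (σ m))) h).trans (πσ m)
  refine ⟨?_, fun m => ⟨fun hm => ?_, ?_⟩, fun n => ?_⟩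
  · rw [injective_iff_map_eq_zero]
    intro l hl
    have h₁ := FM.act_act k₁ (σ l)
    rw [actσ, hl, σ₀, map_zero] at h₁
    have h₂ : FM.act i₀ V (σ l) = 0 := (S.1 V).1 (h₁.symm.trans (map_zero _).symm)
    rw [← ret e₀ l, h₂, map_zero]
    exact π₀
  · have h₁ := FM.act_act k₃ (σ m)
    rw [actσ, hm, σ₀, map_zero] at h₁
    obtain ⟨y, hy⟩ := ((S.1 V).2 (FM.act i₁ V (σ m))).1 h₁.symm
    refine ⟨π (FM.act r₀ V y), ?_⟩
    have h₂ := FM.act_act k₂ y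
    rw [← πact, h₂, ← ret e₁ m]
    exact congrArg (fun t => π (FM.act r₁ V t)) hy
  · rintro ⟨l, rfl⟩
    have h₁ := FM.act_act k₃ (σ (f.hom.hom l))
    rw [actσ, ← actσ f, FM.act_act k₁] at h₁
    have h₂ : FM.act ((Idempotents.toKaroubi _).map b) V
        (FM.act ((Idempotents.toKaroubi _).map a) V (FM.act i₀ V (σ l))) = 0 :=
      ((S.1 V).2 _).2 ⟨_, rfl⟩
    rw [h₂] at h₁
    rw [← ret e₂ (g.hom.hom (f.hom.hom l)), h₁, map_zero]
    exact π₀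
  · obtain ⟨W, q, y, hq, hy⟩ := S.2 V (FM.act i₂ V (σ n))
    -- In the split exact structure a cover has a section, so the local lift restricts to a lift
    -- over `A`.
    obtain ⟨s, hs⟩ := Pf.exists_section_of_admEpi hq
    let y' := res A₁.obj s y
    have hy' : FM.act ((Idempotents.toKaroubi _).map b) V y' = FM.act i₂ V (σ n) := by
      refine (app_res b.hom s y).trans ((congrArg (res A₂.obj s) hy).trans ?_)
      change res A₂.obj s (res A₂.obj q _) = _
      rw [← res_comp, hs, res_id]
    refine ⟨π (FM.act r₁ V y'), ?_⟩
    have h₂ := FM.act_act k₄ y'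
    rw [← πact, h₂, hy', ret e₂]

lemma isExactEquivalence_toFM :
    IsExactEquivalence (fmModExact A κ) (fmExact (Pf.exactStructure A) κ) (FMMod.toFM hκ) :=
  ⟨inferInstance, fun _ _ _ _ _ => ⟨fmExact_toFM hκ, fmModExact_of_toFM hκ⟩⟩

end ModuleRealization

/-! ### Contravariant functors and split exact sequences -/

section SplitFunctor

variable {C : Type u₁} [Category.{v} C] [Preadditive C] [HasZeroObject C]
  [HasBinaryBiproducts C] {D : Type u₂} [Category.{w} D] [Preadditive D] [HasZeroObject D]
  [HasBinaryBiproducts D]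

/-- A fully faithful additive functor preserves and reflects split exact sequences. -/
lemma split_conf_iff (F : Cᵒᵖ ⥤ D) [F.Additive] [F.Full] [F.Faithful] {X Y Z : Cᵒᵖ}
    (f : X ⟶ Y) (g : Y ⟶ Z) :
    (ExactStructure.split C).conf.op f g ↔ (ExactStructure.split D).conf (F.map f) (F.map g) := by
  constructor
  · rintro ⟨w, r, s, h₁, h₂, h₃, h₄⟩
    have h (x : Y.unop ⟶ Y.unop) (y : Y.unop ⟶ Y.unop) : F.map (x + y).op =
      F.map x.op + F.map y.op := by rw [op_add, F.map_add]
    have hw : F.map (g.unop ≫ f.unop).op = F.map f ≫ F.map g := F.map_comp f g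
    refine ⟨?_, F.map s.op, F.map r.op, ?_, ?_, ?_, ?_⟩
    · rw [← hw, w, op_zero, F.map_zero]
    · exact (F.map_comp f s.op).symm.trans ((congrArg (fun t => F.map t.op) h₂).trans (F.map_id X))
    · exact (F.map_comp r.op g).symm.trans ((congrArg (fun t => F.map t.op) h₁).trans (F.map_id Z))
    · exact (F.map_comp r.op s.op).symm.trans ((congrArg (fun t => F.map t.op) h₃).trans
        (F.map_zero Z X))
    · have h₅ := congrArg (fun t => F.map t.op) h₄
      rw [h, add_comm] at h₅
      refine Eq.trans ?_ (h₅.trans (F.map_id Y))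
      exact congrArg₂ (· + ·) (F.map_comp s.op f).symm (F.map_comp g r.op).symm
  · rintro ⟨w, r, s, h₁, h₂, h₃, h₄⟩
    obtain ⟨r, rfl⟩ := F.map_surjective r
    obtain ⟨s, rfl⟩ := F.map_surjective s
    refine ⟨?_, s.unop, r.unop, ?_, ?_, ?_, ?_⟩ <;> apply Quiver.Hom.op_inj <;>
      apply F.map_injective
    · exact (F.map_comp f g).trans (w.trans (F.map_zero _ _).symm)
    · exact (F.map_comp s g).trans (h₂.trans (F.map_id _).symm)
    · exact (F.map_comp f r).trans (h₁.trans (F.map_id _).symm)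
    · exact (F.map_comp s r).trans (h₃.trans (F.map_zero _ _).symm)
    · rw [op_add, F.map_add, add_comm]
      refine Eq.trans ?_ (h₄.trans (F.map_id _).symm)
      exact congrArg₂ (· + ·) (F.map_comp r f) (F.map_comp g s)

end SplitFunctor

/-- A retract of an object in the image of a fully faithful functor is in its essential image if
idempotents split in the source. -/
lemma mem_essImage_of_retract {C : Type u₁} [Category.{v} C] {D : Type u₂} [Category.{w} D]
    (F : Cᵒᵖ ⥤ D) [F.Full] [F.Faithful]
    (hC : ∀ (Y : C) (e : Y ⟶ Y), e ≫ e = e → ∃ (Z : C) (p : Y ⟶ Z) (s : Z ⟶ Y),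
      s ≫ p = 𝟙 Z ∧ p ≫ s = e) {P : D} {X : C} (i : P ⟶ F.obj (op X)) (p : F.obj (op X) ⟶ P)
    (h : i ≫ p = 𝟙 P) : F.essImage P := by
  obtain ⟨ε, hε⟩ := F.map_surjective (p ≫ i)
  have hε' : ε.unop ≫ ε.unop = ε.unop := by
    apply Quiver.Hom.op_inj
    apply F.map_injective
    refine (F.map_comp ε ε).trans (Eq.trans ?_ hε.symm)
    rw [hε, Category.assoc, reassoc_of% h]
  obtain ⟨Z, q, s, h₁, h₂⟩ := hC X ε.unop hε'
  have k₁ : F.map q.op ≫ F.map s.op = 𝟙 _ :=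
    (F.map_comp q.op s.op).symm.trans
      ((congrArg (fun t => F.map t.op) h₁).trans (F.map_id _))
  have k₂ : F.map s.op ≫ F.map q.op = p ≫ i :=
    (F.map_comp s.op q.op).symm.trans
      ((congrArg (fun t => F.map t.op) h₂).trans hε)
  refine ⟨op Z, ⟨⟨F.map q.op ≫ p, i ≫ F.map s.op, ?_, ?_⟩⟩⟩
  · rw [Category.assoc, ← reassoc_of% k₂, k₁, Category.comp_id, k₁]
  · rw [Category.assoc, reassoc_of% k₂, h, Category.comp_id, h]

/-! ### Duality of finitely generated projective modules -/

section PfDual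

variable (R : Type w) [Ring R]

instance (A : Type w) [Ring A] : HasFiniteBiproducts (Pf A) := by
  have : HasFiniteProducts (Pf A) := hasFiniteProducts_of_has_binary_and_terminal
  exact HasFiniteBiproducts.of_hasFiniteProducts

instance : (Pf.dual R).Additive where
  map_add {M N f g} := by
    apply ObjectProperty.hom_ext
    apply ModuleCat.hom_ext
    apply LinearMap.ext
    intro (φ : M.unop.obj →ₗ[Rᵐᵒᵖ] R)
    exact LinearMap.comp_add _ _ φ

/-- The identification of the right module `R` with the ring `Rᵐᵒᵖ`. -/
def opSelf : R ≃ₗ[Rᵐᵒᵖ] Rᵐᵒᵖ where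
  toFun := MulOpposite.op
  invFun := MulOpposite.unop
  left_inv _ := rfl
  right_inv _ := rfl
  map_add' _ _ := rfl
  map_smul' _ _ := rfl

/-- A dual basis of a finitely generated projective right module. -/
lemma Pf.exists_dual_basis (N : Pf Rᵐᵒᵖ) : ∃ (n : ℕ) (b : Fin n → N.obj)
    (φ : Fin n → (N.obj →ₗ[Rᵐᵒᵖ] R)), ∀ y, ∑ k, MulOpposite.op (φ k y) • b k = y := by
  obtain ⟨n, e, p, hp⟩ := N.exists_retract_pi
  refine ⟨n, fun k => p (Pi.single k 1), fun k => (opSelf R).symm.toLinearMap ∘ₗ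
    LinearMap.proj k ∘ₗ e, fun y => ?_⟩
  have h₁ : p (e y) = y := LinearMap.congr_fun hp y
  conv_rhs => rw [← h₁, pi_eq_sum_univ' (e y), map_sum]
  refine Finset.sum_congr rfl fun k _ => ?_
  rw [map_smul]
  congr 2

instance : (Pf.dual R).Faithful where
  map_injective {M N f g} h := by
    apply Quiver.Hom.unop_inj
    apply ObjectProperty.hom_ext
    apply ModuleCat.hom_ext
    apply LinearMap.ext
    intro x
    obtain ⟨n, b, φ, hb⟩ := Pf.exists_dual_basis R M.unop
    rw [← hb (f.unop.hom.hom x), ← hb (g.unop.hom.hom x)]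
    refine Finset.sum_congr rfl fun k _ => ?_
    have h' : φ k ∘ₗ f.unop.hom.hom = φ k ∘ₗ g.unop.hom.hom :=
      LinearMap.congr_fun (congrArg (fun t => t.hom.hom) h) (φ k)
    congr 2
    exact LinearMap.congr_fun h' x

/-- With a dual basis `b`, `φ` of `N`, the required map sends `m` to the combination of the `b k`
with coefficients `α (φ k) m`. It induces `α` because every functional `ψ` is the combination of the
`φ k` with coefficients `ψ (b k)`. -/
instance : (Pf.dual R).Full where
  map_surjective {N M} α := by
    obtain ⟨n, b, φ, hb⟩ := Pf.exists_dual_basis R N.unop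
    let α' : (N.unop.obj →ₗ[Rᵐᵒᵖ] R) →ₗ[R] (M.unop.obj →ₗ[Rᵐᵒᵖ] R) := α.hom.hom
    let f : M.unop.obj →ₗ[Rᵐᵒᵖ] N.unop.obj :=
      ∑ k, LinearMap.toSpanSingleton Rᵐᵒᵖ N.unop.obj (b k) ∘ₗ (opSelf R).toLinearMap ∘ₗ α' (φ k)
    have hf (m) : f m = ∑ k, MulOpposite.op (α' (φ k) m) • b k := by
      simp only [f, LinearMap.sum_apply]
      rfl
    refine ⟨Quiver.Hom.op (ObjectProperty.homMk (ModuleCat.ofHom f)), ?_⟩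
    apply ObjectProperty.hom_ext
    apply ModuleCat.hom_ext
    apply LinearMap.ext
    intro (ψ : N.unop.obj →ₗ[Rᵐᵒᵖ] R)
    apply LinearMap.ext
    intro (m : M.unop.obj)
    change ψ (f m) = α' ψ m
    have hψ : ψ = ∑ k, ψ (b k) • φ k := by
      apply LinearMap.ext
      intro y
      conv_lhs => rw [← hb y, map_sum]
      rw [LinearMap.sum_apply]
      refine Finset.sum_congr rfl fun k _ => ?_
      rw [map_smul]
      rfl
    conv_rhs => rw [hψ, map_sum, LinearMap.sum_apply]
    rw [hf, map_sum]
    refine Finset.sum_congr rfl fun k _ => ?_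
    rw [map_smul, map_smul]
    rfl

/-- A finite free left module is the dual of the finite free right module of the same rank.
Essential surjectivity follows by splitting the idempotent on the other side. -/
lemma Pf.exists_retract_dual (P : Pf R) : ∃ (X : Pf Rᵐᵒᵖ) (i : P ⟶ (Pf.dual R).obj (op X))
    (p : (Pf.dual R).obj (op X) ⟶ P), i ≫ p = 𝟙 P := by
  obtain ⟨n, i, p, hp⟩ := P.exists_retract_pi
  let e : (Fin n → R) ≃ₗ[R] ((Fin n → Rᵐᵒᵖ) →ₗ[Rᵐᵒᵖ] R) :=
    (LinearEquiv.piCongrRight fun _ => (LinearMap.ringLmapEquivSelf Rᵐᵒᵖ R R).symm) ≪≫ₗ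
      LinearMap.lsum Rᵐᵒᵖ (fun _ : Fin n => Rᵐᵒᵖ) R
  have he : (p ∘ₗ e.symm.toLinearMap) ∘ₗ (e.toLinearMap ∘ₗ i) = LinearMap.id := by
    apply LinearMap.ext
    intro x
    refine Eq.trans ?_ (LinearMap.congr_fun hp x)
    exact congrArg p (e.symm_apply_apply (i x))
  refine ⟨Pf.of (Fin n → Rᵐᵒᵖ), ObjectProperty.homMk (ModuleCat.ofHom (e.toLinearMap ∘ₗ i)),
    ObjectProperty.homMk (ModuleCat.ofHom (p ∘ₗ e.symm.toLinearMap)), ?_⟩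
  apply ObjectProperty.hom_ext
  apply ModuleCat.hom_ext
  exact he

instance : (Pf.dual R).EssSurj where
  mem_essImage P := by
    obtain ⟨X, i, p, h⟩ := Pf.exists_retract_dual R P
    exact mem_essImage_of_retract _ Pf.exists_split_idem i p h

lemma isExactEquivalence_dual : IsExactEquivalence (Pf.exactStructure Rᵐᵒᵖ).conf.op
    (Pf.exactStructure R).conf (Pf.dual R) :=
  ⟨{ }, fun _ _ _ f g => split_conf_iff (Pf.dual R) f g⟩

end PfDual

/-! ### The duality for modules and its inverse -/

section Final

section KanComp

variable {C : Type*} {D : Type*} {D' : Type*} {H : Type*}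
  [Category* C] [Category* D] [Category* D'] [Category* H] {L : C ⥤ D} {L' : C ⥤ D'}
  (J : D' ⥤ D) [J.Full] [J.Faithful] (θ : L' ⋙ J ≅ L) {F : C ⥤ H} {G : D ⥤ H}

/-- The cone over the objects under `J.obj Y` given by a cone over the objects under `Y`. -/
def coneOfFullyFaithful {Y : D'} (s : Cone (StructuredArrow.proj Y L' ⋙ F)) :
    Cone (StructuredArrow.proj (J.obj Y) L ⋙ F) where
  pt := s.pt
  π :=
    { app := fun g => s.π.app (StructuredArrow.mk (Y := g.right)
        (J.preimage (g.hom ≫ θ.inv.app g.right)))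
      naturality := fun g g' a => by
        refine s.π.naturality (StructuredArrow.homMk (f := StructuredArrow.mk (Y := g.right)
          (J.preimage (g.hom ≫ θ.inv.app g.right))) (f' := StructuredArrow.mk (Y := g'.right)
          (J.preimage (g'.hom ≫ θ.inv.app g'.right))) a.right ?_)
        apply J.map_injective
        have w := StructuredArrow.w a
        have n := θ.inv.naturality a.right
        dsimp at n ⊢
        rw [J.map_comp, J.map_preimage, J.map_preimage, ← w, Category.assoc,
          Category.assoc, n] }

/-- Restriction of a pointwise right Kan extension along a fully faithful functor. -/
def isPointwiseRightKanExtensionComp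
    {α : L ⋙ G ⟶ F} (h : (Functor.RightExtension.mk G α).IsPointwiseRightKanExtension)
    (β : L' ⋙ J ⋙ G ⟶ F) (hβ : ∀ X, β.app X = G.map (θ.hom.app X) ≫ α.app X) :
    (Functor.RightExtension.mk (J ⋙ G) β).IsPointwiseRightKanExtension := fun Y =>
  { lift := fun s => (h (J.obj Y)).lift (coneOfFullyFaithful J θ s)
    fac := fun s g => by
      have hf := (h (J.obj Y)).fac (coneOfFullyFaithful J θ s) (StructuredArrow.mk (Y := g.right)
        (J.map g.hom ≫ θ.hom.app g.right))
      have e₁ : s.π.app (StructuredArrow.mk (Y := g.right)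
          (J.preimage ((J.map g.hom ≫ θ.hom.app g.right) ≫ θ.inv.app g.right))) = s.π.app g := by
        have : J.preimage ((J.map g.hom ≫ θ.hom.app g.right) ≫ θ.inv.app g.right) = g.hom := by
          apply J.map_injective
          simp
        rw [this]
        rfl
      refine Eq.trans ?_ (hf.trans e₁)
      change _ ≫ G.map (J.map g.hom) ≫ β.app g.right =
        _ ≫ G.map (J.map g.hom ≫ θ.hom.app g.right) ≫ α.app g.right
      rw [hβ, G.map_comp, Category.assoc]
    uniq := fun s m hm => by
      refine (h (J.obj Y)).uniq (coneOfFullyFaithful J θ s) m fun j => ?_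
      refine Eq.trans ?_ (hm (StructuredArrow.mk (Y := j.right)
        (J.preimage (j.hom ≫ θ.inv.app j.right))))
      have e₁ : (j.hom ≫ θ.inv.app j.right) ≫ θ.hom.app j.right = j.hom := by simp
      have e₂ : G.map j.hom ≫ α.app j.right =
          G.map (J.map (J.preimage (j.hom ≫ θ.inv.app j.right))) ≫ β.app j.right := by
        conv_lhs => rw [← e₁, G.map_comp]
        rw [hβ, J.map_preimage, Category.assoc]
      exact congrArg (fun t => m ≫ t) e₂ }

end KanComp

variable (R : Type v) [Ring R] {κ : WithTop Cardinal.{v}}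
  (hκ : ((Cardinal.aleph0 : Cardinal.{v}) : WithTop Cardinal.{v}) ≤ κ)

/-- The map from the ring given by an element of a module. -/
def FMMod.ofElement {A : Type w} [Ring A] {κ : WithTop Cardinal.{w}}
    (hκ : ((Cardinal.aleph0 : Cardinal.{w}) : WithTop Cardinal.{w}) ≤ κ) {M : FMMod A κ}
    (m : M.obj) : (Pf.toFMMod A κ hκ).obj (Pf.of A) ⟶ M :=
  ObjectProperty.homMk (ModuleCat.ofHom (LinearMap.toSpanSingleton A M.obj m))

lemma FMMod.ofElement_bijective {A : Type w} [Ring A] {κ : WithTop Cardinal.{w}}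
    (hκ : ((Cardinal.aleph0 : Cardinal.{w}) : WithTop Cardinal.{w}) ≤ κ) (M : FMMod A κ) :
    Function.Bijective (FMMod.ofElement hκ (M := M)) := by
  refine ⟨fun m m' h => ?_, fun f => ⟨f.hom.hom (1 : A), ?_⟩⟩
  · have h' : LinearMap.toSpanSingleton A M.obj m = LinearMap.toSpanSingleton A M.obj m' :=
      congrArg (fun t => t.hom.hom) h
    simpa using LinearMap.congr_fun h' 1
  · apply ObjectProperty.hom_ext
    apply ModuleCat.hom_ext
    apply LinearMap.ext
    intro (a : A)
    change a • f.hom.hom (1 : A) = f.hom.hom a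
    exact (map_smul f.hom.hom a (1 : A)).symm.trans (congrArg f.hom.hom (mul_one a))

/-- The dual of the right module `R` is the left module `R`. -/
def Pf.dualSelf : (Pf.dual R).obj (op (Pf.of Rᵐᵒᵖ)) ≅ Pf.self R :=
  (IsPf R).isoMk (LinearMap.ringLmapEquivSelf Rᵐᵒᵖ R R).toModuleIso

lemma Pf.dual_map_dualSelf (r : Rᵐᵒᵖ) :
    (Pf.dual R).map (Quiver.Hom.op (X := Pf.of Rᵐᵒᵖ) (Y := Pf.of Rᵐᵒᵖ)
      (ObjectProperty.homMk (ModuleCat.ofHom (LinearMap.toSpanSingleton Rᵐᵒᵖ Rᵐᵒᵖ r)))) ≫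
      (Pf.dualSelf R).hom = (Pf.dualSelf R).hom ≫ Pf.mulRight R r := by
  apply ObjectProperty.hom_ext
  apply ModuleCat.hom_ext
  apply LinearMap.ext
  intro (φ : Rᵐᵒᵖ →ₗ[Rᵐᵒᵖ] R)
  change φ ((1 : Rᵐᵒᵖ) • r) = r • φ 1
  rw [one_smul, ← map_smul, smul_eq_mul, mul_one]

variable {G : (FMMod Rᵐᵒᵖ κ)ᵒᵖ ⥤ FMDual (Pf.exactStructure R) κ}
  (e : (Pf.toFMMod Rᵐᵒᵖ κ hκ).op ⋙ G ≅ Pf.dual R ⋙ FMDual.incl (Pf.exactStructure R) κ hκ)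

/-- The functional on the dual object given by an element of a module. -/
def evalHom (M : FMMod Rᵐᵒᵖ κ) (m : M.obj) :
    G.obj (op M) ⟶ (FMDual.incl (Pf.exactStructure R) κ hκ).obj (Pf.self R) :=
  G.map (FMMod.ofElement hκ m).op ≫ e.hom.app (op (Pf.of Rᵐᵒᵖ)) ≫
    (FMDual.incl (Pf.exactStructure R) κ hκ).map (Pf.dualSelf R).hom

/-- Elements of `M` are maps from the right module `R` to `M`; full faithfulness turns these into
maps from the dual of `M` to the dual of `R`, which is the left module `R`. -/
lemma evalHom_bijective [G.Full] [G.Faithful] (M : FMMod Rᵐᵒᵖ κ) :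
    Function.Bijective (evalHom R hκ e M) := by
  let i : G.obj (op ((Pf.toFMMod Rᵐᵒᵖ κ hκ).obj (Pf.of Rᵐᵒᵖ))) ≅
    (FMDual.incl (Pf.exactStructure R) κ hκ).obj (Pf.self R) :=
    e.app (op (Pf.of Rᵐᵒᵖ)) ≪≫ (FMDual.incl (Pf.exactStructure R) κ hκ).mapIso (Pf.dualSelf R)
  refine ⟨fun m m' h => ?_, fun φ => ?_⟩
  · have h' : G.map (FMMod.ofElement hκ m).op = G.map (FMMod.ofElement hκ m').op :=
      (cancel_mono i.hom).1 h
    exact (FMMod.ofElement_bijective hκ M).1 (Quiver.Hom.op_inj (G.map_injective h'))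
  · obtain ⟨f, hf⟩ := G.map_surjective (φ ≫ i.inv)
    obtain ⟨m, hm⟩ := (FMMod.ofElement_bijective hκ M).2 f.unop
    refine ⟨m, ?_⟩
    change G.map (FMMod.ofElement hκ m).op ≫ i.hom = φ
    rw [hm, Quiver.Hom.op_unop, hf, Category.assoc, Iso.inv_hom_id, Category.comp_id]

lemma evalHom_add [G.Additive] (M : FMMod Rᵐᵒᵖ κ) (m m' : M.obj) :
    evalHom R hκ e M (m + m') = evalHom R hκ e M m + evalHom R hκ e M m' := by
  have h : FMMod.ofElement hκ (m + m') = FMMod.ofElement hκ m + FMMod.ofElement hκ m' := by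
    apply ObjectProperty.hom_ext
    apply ModuleCat.hom_ext
    exact LinearMap.toSpanSingleton_add m m'
  rw [evalHom, h, op_add, G.map_add, Preadditive.add_comp]
  rfl

/-- Scaling `m` amounts to precomposing its map with an endomorphism of the right module `R`, whose
dual is right multiplication on `R`. -/
lemma evalHom_smul (M : FMMod Rᵐᵒᵖ κ) (r : Rᵐᵒᵖ) (m : M.obj) :
    evalHom R hκ e M (r • m) = evalHom R hκ e M m ≫
      (FMDual.incl (Pf.exactStructure R) κ hκ).map (Pf.mulRight R r) := by
  let ρ : Pf.of Rᵐᵒᵖ ⟶ Pf.of Rᵐᵒᵖ :=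
    ObjectProperty.homMk (ModuleCat.ofHom (LinearMap.toSpanSingleton Rᵐᵒᵖ Rᵐᵒᵖ r))
  have h : FMMod.ofElement hκ (r • m) =
      (Pf.toFMMod Rᵐᵒᵖ κ hκ).map ρ ≫ FMMod.ofElement hκ m := by
    apply ObjectProperty.hom_ext
    apply ModuleCat.hom_ext
    apply LinearMap.ext
    intro (a : Rᵐᵒᵖ)
    exact smul_smul a r m
  have n := e.hom.naturality ρ.op
  have d := congrArg (FMDual.incl (Pf.exactStructure R) κ hκ).map (Pf.dual_map_dualSelf R r)
  rw [Functor.map_comp, Functor.map_comp] at d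
  have n' : G.map ((Pf.toFMMod Rᵐᵒᵖ κ hκ).map ρ).op ≫ e.hom.app (op (Pf.of Rᵐᵒᵖ)) =
    e.hom.app (op (Pf.of Rᵐᵒᵖ)) ≫ (FMDual.incl (Pf.exactStructure R) κ hκ).map
      ((Pf.dual R).map ρ.op) := n
  rw [evalHom, evalHom, h, op_comp, G.map_comp, Category.assoc, reassoc_of% n', d]
  simp only [Category.assoc]

lemma evalHom_comp {M N : FMMod Rᵐᵒᵖ κ} (f : M ⟶ N) (m : M.obj) :
    evalHom R hκ e N (f.hom.hom m) = G.map f.op ≫ evalHom R hκ e M m := by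
  have h : FMMod.ofElement hκ (f.hom.hom m) = FMMod.ofElement hκ m ≫ f := by
    apply ObjectProperty.hom_ext
    apply ModuleCat.hom_ext
    apply LinearMap.ext
    intro (a : Rᵐᵒᵖ)
    exact (map_smul f.hom.hom a m).symm
  rw [evalHom, evalHom, h, op_comp, G.map_comp, Category.assoc]

/-- The inverse of a duality equivalence is the functor of functionals. -/
lemma nonempty_leftOp_iso_homToSelf
    (Φ : (FMMod Rᵐᵒᵖ κ)ᵒᵖ ≌ FMDual (Pf.exactStructure R) κ) [Φ.functor.Additive]
    (e : (Pf.toFMMod Rᵐᵒᵖ κ hκ).op ⋙ Φ.functor ≅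
      Pf.dual R ⋙ FMDual.incl (Pf.exactStructure R) κ hκ) :
    Nonempty (Φ.inverse.leftOp ⋙ (IsFMModule Rᵐᵒᵖ κ).ι ⋙
      ModuleCat.uliftFunctor.{v + 1, v} Rᵐᵒᵖ ≅ FMDual.homToSelf R κ hκ) := by
  -- Maps of presheaves on the large category `Pf R` live one universe above the modules, which
  -- accounts for the lift.
  let t (Y : (FMDual (Pf.exactStructure R) κ)ᵒᵖ) :
      (Φ.inverse.leftOp ⋙ (IsFMModule Rᵐᵒᵖ κ).ι ⋙
        ModuleCat.uliftFunctor.{v + 1, v} Rᵐᵒᵖ).obj Y ⟶ (FMDual.homToSelf R κ hκ).obj Y :=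
    ModuleCat.ofHom (Y := (FMDual.homToSelf R κ hκ).obj Y)
      { toFun := fun m : ULift.{v + 1} (Φ.inverse.obj Y.unop).unop.obj =>
          (Φ.counitIso.inv.app Y.unop ≫ evalHom R hκ e (Φ.inverse.obj Y.unop).unop m.down :
            Y.unop ⟶ (FMDual.incl (Pf.exactStructure R) κ hκ).obj (Pf.self R))
        map_add' := fun m m' => by
          refine Eq.trans ?_ (Preadditive.comp_add _ _ _ _ _ _)
          exact congrArg (fun t => _ ≫ t) (evalHom_add R hκ e _ m.down m'.down)
        map_smul' := fun r m => by
          refine Eq.trans ?_ (Category.assoc _ _ _).symm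
          exact congrArg (fun t => _ ≫ t) (evalHom_smul R hκ e _ r m.down) }
  have ht (Y) : IsIso (t Y) := by
    rw [ConcreteCategory.isIso_iff_bijective]
    refine ⟨fun m m' h => ?_, fun φ => ?_⟩
    · have h' := (cancel_epi (Φ.counitIso.inv.app Y.unop)).1 h
      exact ULift.ext _ _ ((evalHom_bijective R hκ e _).1 h')
    · obtain ⟨m, hm⟩ := (evalHom_bijective R hκ e (Φ.inverse.obj Y.unop).unop).2
        (Φ.counitIso.hom.app Y.unop ≫ (show Y.unop ⟶ _ from φ))
      refine ⟨⟨m⟩, ?_⟩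
      refine (congrArg (fun t => Φ.counitIso.inv.app Y.unop ≫ t) hm).trans ?_
      exact Iso.inv_hom_id_app_assoc _ _ _
  refine ⟨NatIso.ofComponents (fun Y => asIso (t Y)) fun {Y Y'} f => ?_⟩
  apply ModuleCat.hom_ext
  apply LinearMap.ext
  intro (m : ULift.{v + 1} (Φ.inverse.obj Y.unop).unop.obj)
  refine (congrArg (fun t => Φ.counitIso.inv.app Y'.unop ≫ t)
    (evalHom_comp R hκ e (Φ.inverse.map f.unop).unop m.down)).trans ?_
  have n := Φ.counitIso.inv.naturality f.unop
  refine (Category.assoc _ _ _).symm.trans (Eq.trans ?_ (Category.assoc _ _ _))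
  exact congrArg (fun t => t ≫ evalHom R hκ e (Φ.inverse.obj Y.unop).unop m.down) n.symm

theorem exists_module_duality :
    ∃ (Φ : (FMMod Rᵐᵒᵖ κ)ᵒᵖ ≌ FMDual (Pf.exactStructure R) κ)
      (e : (Pf.toFMMod Rᵐᵒᵖ κ hκ).op ⋙ Φ.functor ≅
        Pf.dual R ⋙ FMDual.incl (Pf.exactStructure R) κ hκ),
      Nonempty (Functor.RightExtension.mk Φ.functor e.hom).IsPointwiseRightKanExtension ∧
      IsExactFunctor (fmModExact Rᵐᵒᵖ κ).op (fmDualExact (Pf.exactStructure R) κ) Φ.functor ∧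
      IsExactFunctor (fmDualExact (Pf.exactStructure R) κ) (fmModExact Rᵐᵒᵖ κ).op Φ.inverse ∧
      Nonempty (Φ.inverse.leftOp ⋙ (IsFMModule Rᵐᵒᵖ κ).ι ⋙
        ModuleCat.uliftFunctor.{v + 1, v} Rᵐᵒᵖ ≅ FMDual.homToSelf R κ hκ) := by
  have hD := isExactEquivalence_dual R
  obtain ⟨Ft, e₀, ⟨hKan⟩, hFt, -, -, hFt', hadd⟩ := exists_extension
    (EC := Pf.exactStructure Rᵐᵒᵖ) (ED := Pf.exactStructure R) hκ
    (fun _ _ _ f g h => (hD.2 f g).1 h)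
  have hFt' := hFt' hD
  have hJ := isExactEquivalence_toFM (A := Rᵐᵒᵖ) hκ
  have := hFt'.1
  let G := (FMMod.toFM (A := Rᵐᵒᵖ) hκ).op ⋙ Ft
  have hG {X Y Z} (f : X ⟶ Y) (g : Y ⟶ Z) :
      (fmModExact Rᵐᵒᵖ κ).op f g ↔ fmDualExact (Pf.exactStructure R) κ (G.map f) (G.map g) :=
    (hJ.2 g.unop f.unop).trans
      (hFt'.2 ((FMMod.toFM (A := Rᵐᵒᵖ) hκ).op.map f) ((FMMod.toFM (A := Rᵐᵒᵖ) hκ).op.map g))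
  let θ : (Pf.toFMMod Rᵐᵒᵖ κ hκ).op ⋙ (FMMod.toFM (A := Rᵐᵒᵖ) hκ).op ≅
      (FM.incl (Pf.exactStructure Rᵐᵒᵖ) κ hκ).op := NatIso.op (toFMModCompToFM hκ).symm
  let e : (Pf.toFMMod Rᵐᵒᵖ κ hκ).op ⋙ G ≅
      Pf.dual R ⋙ FMDual.incl (Pf.exactStructure R) κ hκ :=
    Functor.isoWhiskerRight θ Ft ≪≫ e₀
  have : G.Additive := inferInstance
  let Φ := G.asEquivalence
  have : Φ.functor.Additive := this
  refine ⟨Φ, e, ⟨isPointwiseRightKanExtensionComp _ θ hKan e.hom fun _ => rfl⟩,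
    fun _ _ _ f g h => (hG f g).1 h, fun X Y Z f g h => ?_,
    nonempty_leftOp_iso_homToSelf R hκ Φ e⟩
  -- Since `G` reflects exactness, the inverse is tested after applying `G`, where the counit
  -- identifies the sequence with the given one.
  refine (hG _ _).2 ?_
  exact SeqClass.isoClosed_karoubi _ _ _ _ _ (Φ.counitIso.symm.app X) (Φ.counitIso.symm.app Y)
    (Φ.counitIso.symm.app Z) (Φ.counitIso.inv.naturality f) (Φ.counitIso.inv.naturality g) h

end Final

end AdmInd

end

theorem proposition4 (κ : WithTop Cardinal.{v})
    (hκ : ((Cardinal.aleph0 : Cardinal.{v}) : WithTop Cardinal.{v}) ≤ κ) :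
    (∀ (C : Type u₁) [Category.{v} C] [Preadditive C] [HasFiniteBiproducts C]
      (D : Type u₂) [Category.{v} D] [Preadditive D] [HasFiniteBiproducts D]
      (EC : ExactStructure C) (ED : ExactStructure D) (F : Cᵒᵖ ⥤ D),
      IsExactFunctor EC.conf.op ED.conf F →
      ∃ (Ft : (FM EC κ)ᵒᵖ ⥤ FMDual ED κ)
        (e : (FM.incl EC κ hκ).op ⋙ Ft ≅ F ⋙ FMDual.incl ED κ hκ),
        Nonempty (Functor.RightExtension.mk Ft e.hom).IsPointwiseRightKanExtension ∧
        IsExactFunctor (fmExact EC κ).op (fmDualExact ED κ) Ft ∧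
        (F.Faithful → Ft.Faithful) ∧
        (F.Full → F.Faithful → Ft.Full ∧ Ft.Faithful) ∧
        (IsExactEquivalence EC.conf.op ED.conf F →
          IsExactEquivalence (fmExact EC κ).op (fmDualExact ED κ) Ft)) ∧
    (∀ (R : Type v) [Ring R],
      ∃ (Φ : (FMMod Rᵐᵒᵖ κ)ᵒᵖ ≌ FMDual (Pf.exactStructure R) κ)
        (e : (Pf.toFMMod Rᵐᵒᵖ κ hκ).op ⋙ Φ.functor ≅
          Pf.dual R ⋙ FMDual.incl (Pf.exactStructure R) κ hκ),
        Nonempty (Functor.RightExtension.mk Φ.functor e.hom).IsPointwiseRightKanExtension ∧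
        IsExactFunctor (fmModExact Rᵐᵒᵖ κ).op (fmDualExact (Pf.exactStructure R) κ) Φ.functor ∧
        IsExactFunctor (fmDualExact (Pf.exactStructure R) κ) (fmModExact Rᵐᵒᵖ κ).op Φ.inverse ∧
        Nonempty (Φ.inverse.leftOp ⋙ (IsFMModule Rᵐᵒᵖ κ).ι ⋙
          ModuleCat.uliftFunctor.{v + 1, v} Rᵐᵒᵖ ≅ FMDual.homToSelf R κ hκ)) := by
  refine ⟨fun C _ _ _ D _ _ _ EC ED F hF => ?_, fun R _ => ?_⟩
  · obtain ⟨Ft, e, h₁, h₂, h₃, h₄, h₅, -⟩ := exists_extension hκ hF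
    exact ⟨Ft, e, h₁, h₂, h₃, h₄, h₅⟩
  · exact exists_module_duality R hκ
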